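/- Let $d\ge 2$ and $0\le s\le d-2$. Write $\mathbf 1_{P}$ for the indicator of a condition $P$. Let $\mathsf g:\mathbb R^d\setminus\{0\}\to\mathbb R$ be a smooth even function with $\mathsf g(x)\to+\infty$ as $x\to0$ that satisfies the following, with constants $r_0>0$, $K_0,K_1,K_2,\dots$, $B$, $C_1>0$, $C_2$, $c_s<1$, $c_0>0$: * $\Delta\mathsf g\le 0$ in $B(0,r_0)$ in the sense of distributions; * $|\nabla^{\otimes k}\mathsf g(x)|\le K_k\big(|x|^{-s-k}+|\log|x||\,\mathbf 1_{s=k=0}\big)$ for all $k\ge0$ and $x\ne0$; * $|x||\nabla\mathsf g(x)|+|x|^2|\nabla^{\otimes2}\mathsf g(x)|\le B\,\mathsf g(x)$ for $0<|x|<r_0$; * away from the origin the (distributional) Fourier transform of $\mathsf g$ is a function with $C_1|\xi|^{s-d}\le\hat{\mathsf g}(\xi)\le C_2|\xi|^{s-d}$ for $\xi\neq 0$; * if $x,y\in B(0,r_0)\setminus\{0\}$ and $|y|\ge2|x|$, then $\mathsf g(y)<c_s\,\mathsf g(x)$ in the case $s>0$, and $\mathsf g(x)-\mathsf g(y)\ge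 c_0$ in the case $s=0$. For $\eta>0$ let $\delta_x^{(\eta)}$ be the uniform probability measure on the sphere $\partial B(x,\eta)$ and $\mathsf g_\eta=\mathsf g*\delta_0^{(\eta)}$. For $N\ge1$, pairwise distinct points $x_1,\dots,x_N\in\mathbb R^d$ and a probability measure $\mu$ with bounded density on $\mathbb R^d$ (and $\int\log(1+|x|)\,d\mu(x)<\infty$ if $s=0$) let $$F_N(\underline x_N,\mu)=\int_{\{(x,y):\,x\ne y\}}\mathsf g(x-y)\,d\Big(\frac1N\sum_{i=1}^N\delta_{x_i}-\mu\Big)^{\otimes2}(x,y),\qquad \|\nu\|_{\dot H^{\frac{s-d}2}}^2=\int_{\mathbb R^d}|\xi|^{s-d}|\hat\nu(\xi)|^2\,d\xi .$$ There is a constant $C>0$, depending only on $d$, $s$ and the constants $r_0,(K_k)_{k\ge 0},B,C_1,C_2,c_s,c_0$, such that for all such $\mathsf g$, $N$, $x_1,\dots,x_N$ and $\mu$ the integral defining $F_N(\underline x_N,\mu)$ converges absolutely and the following hold. (a) For all $\eta_1,\dots,\eta_N\in(0,r_0/2)$ the norm below is finite and $$\frac1{N^2}\sum_{\substack{1\le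 i\ne j\le N\\|x_i-x_j|\le r_0/2}}\big(\mathsf g(x_j-x_i)-\mathsf g_{\eta_i}(x_j-x_i)\big)_++C^{-1}\Big\|\frac1N\sum_{i=1}^N\delta_{x_i}^{(\eta_i)}-\mu\Big\|_{\dot H^{\frac{s-d}2}}^2$$ $$\le F_N(\underline x_N,\mu)+\frac1{N^2}\sum_{i=1}^N\mathsf g_{\eta_i}(0)+\frac CN\sum_{i=1}^N\eta_i^2+\frac CN\sum_{i=1}^N\|\mu\|_{L^\infty}\Big(\eta_i^{d-s}+\eta_i^2\mathbf 1_{s<d-2}+\eta_i^d|\log\eta_i|\mathbf 1_{s=0}+\eta_i^2|\log\eta_i|\mathbf 1_{s=d-2}\Big).$$ (b) $$F_N(\underline x_N,\mu)\ge-C\,(1+\|\mu\|_{L^\infty})\Big(N^{-\frac2{2+s}}+N^{-1}\log N\,\mathbf 1_{s=0}+N^{-\frac2d}\log N\,\mathbf 1_{s=d-2}\Big).$$ -/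

import Mathlib

open MeasureTheory Filter Topology
open scoped ENNReal ContDiff FourierTransform SchwartzMap Laplacian

noncomputable section

/-- `|log r|` times the indicator of the proposition `p`. -/
def logIf (p : Prop) (r : ℝ) : ℝ :=
  open Classical in if p then |Real.log r| else 0

/-- `g` is superharmonic in the ball `B(0, r₀)` in the sense of distributions: `∫ g Δφ ≤ 0` for
every nonnegative smooth `φ` with compact support in the ball. -/
def SuperharmonicInBall {d : ℕ} (g : EuclideanSpace ℝ (Fin d) → ℝ) (r₀ : ℝ) : Prop :=
  ∀ φ : EuclideanSpace ℝ (Fin d) → ℝ, ContDiff ℝ ∞ φ → HasCompactSupport φ →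
    tsupport φ ⊆ Metric.ball 0 r₀ → (∀ x, 0 ≤ φ x) → ∫ x, g x * Δ φ x ≤ 0

/-- Away from the origin the distributional Fourier transform of `g` is the function `G`: it is
tested against the Schwartz functions that vanish in a neighbourhood of the origin.
(The normalization is Mathlib's, with the kernel `exp (-2πi⟨x, ξ⟩)`.) -/
def HasFourierAwayFromZero {d : ℕ} (g G : EuclideanSpace ℝ (Fin d) → ℝ) : Prop :=
  ∀ φ : 𝓢(EuclideanSpace ℝ (Fin d), ℂ), (0 : EuclideanSpace ℝ (Fin d)) ∉ tsupport φ →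
    ∫ x, (g x : ℂ) * (𝓕 φ : 𝓢(EuclideanSpace ℝ (Fin d), ℂ)) x = ∫ ξ, (G ξ : ℂ) * φ ξ

/-- Potentials with a Riesz-type singularity of exponent `s` (logarithmic if `s = 0`) that are
superharmonic near the origin. All the constants of the assumptions are parameters:
the radius `r₀`, the constants `K k` of the bounds on the `k`-th derivatives, the constant `B` of
the bound of the derivatives by the potential, the constants `C₁, C₂` of the Fourier bounds, and the
constants `cs` (for `s > 0`) and `c₀` (for `s = 0`) of the decay conditions.
The value `g 0` plays no role. -/
structure RieszTypePotential (d : ℕ) (s r₀ : ℝ) (K : ℕ → ℝ) (B C₁ C₂ cs c₀ : ℝ)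
    (g : EuclideanSpace ℝ (Fin d) → ℝ) : Prop where
  smooth : ContDiffOn ℝ ∞ g {0}ᶜ
  even : ∀ x, x ≠ 0 → g x = g (-x)
  tendsto_zero : Tendsto g (𝓝[≠] 0) atTop
  superharmonic : SuperharmonicInBall g r₀
  deriv_bound : ∀ k : ℕ, ∀ x, x ≠ 0 →
    ‖iteratedFDeriv ℝ k g x‖ ≤ K k * (1 / ‖x‖ ^ (s + k) + logIf (s = 0 ∧ k = 0) ‖x‖)
  deriv_bound_self : ∀ x, x ≠ 0 → ‖x‖ < r₀ →
    ‖x‖ * ‖iteratedFDeriv ℝ 1 g x‖ + ‖x‖ ^ 2 * ‖iteratedFDeriv ℝ 2 g x‖ ≤ B * g x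
  fourier_bound : ∃ G : EuclideanSpace ℝ (Fin d) → ℝ, Measurable G ∧
    HasFourierAwayFromZero g G ∧
    ∀ ξ, ξ ≠ 0 → C₁ / ‖ξ‖ ^ ((d : ℝ) - s) ≤ G ξ ∧ G ξ ≤ C₂ / ‖ξ‖ ^ ((d : ℝ) - s)
  decay_pos : 0 < s → ∀ x y, x ≠ 0 → y ≠ 0 → ‖x‖ < r₀ → ‖y‖ < r₀ → 2 * ‖x‖ ≤ ‖y‖ →
    g y < cs * g x
  decay_zero : s = 0 → ∀ x y, x ≠ 0 → y ≠ 0 → ‖x‖ < r₀ → ‖y‖ < r₀ → 2 * ‖x‖ ≤ ‖y‖ →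
    c₀ ≤ g x - g y

/-- The uniform probability measure on the sphere `∂B(x, η)`, for `d ≥ 1` and `η > 0`: the image of
the normalized surface measure of the unit sphere under `u ↦ x + η u`. -/
def uniformSphere {d : ℕ} (x : EuclideanSpace ℝ (Fin d)) (η : ℝ) :
    Measure (EuclideanSpace ℝ (Fin d)) :=
  ((volume : Measure (EuclideanSpace ℝ (Fin d))).toSphere Set.univ)⁻¹ •
    Measure.map
      (fun u : Metric.sphere (0 : EuclideanSpace ℝ (Fin d)) 1 =>
        x + η • (u : EuclideanSpace ℝ (Fin d)))
      (volume : Measure (EuclideanSpace ℝ (Fin d))).toSphere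

/-- The smeared potential `g_η`, the convolution of `g` with the uniform probability measure on
`∂B(0, η)`. -/
def smearedPotential {d : ℕ} (g : EuclideanSpace ℝ (Fin d) → ℝ) (η : ℝ)
    (x : EuclideanSpace ℝ (Fin d)) : ℝ :=
  ∫ y, g (x - y) ∂(uniformSphere 0 η)

/-- The empirical measure `(1/N) ∑ᵢ δ_{xᵢ}`. -/
def empiricalMeasure {d N : ℕ} (x : Fin N → EuclideanSpace ℝ (Fin d)) :
    Measure (EuclideanSpace ℝ (Fin d)) :=
  (N : ℝ≥0∞)⁻¹ • ∑ i, Measure.dirac (x i)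

/-- The smeared empirical measure `(1/N) ∑ᵢ δ_{xᵢ}^{(ηᵢ)}`. -/
def smearedEmpiricalMeasure {d N : ℕ} (x : Fin N → EuclideanSpace ℝ (Fin d)) (η : Fin N → ℝ) :
    Measure (EuclideanSpace ℝ (Fin d)) :=
  (N : ℝ≥0∞)⁻¹ • ∑ i, uniformSphere (x i) (η i)

/-- The complement of the diagonal. -/
def offDiagonal (d : ℕ) : Set (EuclideanSpace ℝ (Fin d) × EuclideanSpace ℝ (Fin d)) :=
  {p | p.1 ≠ p.2}

/-- `∫∫ g(x - y) dα(x) dβ(y)` over the complement of the diagonal. -/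
def offDiagonalEnergy {d : ℕ} (g : EuclideanSpace ℝ (Fin d) → ℝ)
    (α β : Measure (EuclideanSpace ℝ (Fin d))) : ℝ :=
  ∫ p in offDiagonal d, g (p.1 - p.2) ∂(α.prod β)

/-- The modulated energy `F_N(x, μ)`, that is the integral of `g(x - y)` over the complement of the
diagonal against the tensor square of the signed measure `μ_N - μ`, where `μ_N` is the empirical
measure; the tensor square of the difference is expanded into its four products. -/
def modulatedEnergy {d N : ℕ} (g : EuclideanSpace ℝ (Fin d) → ℝ)
    (x : Fin N → EuclideanSpace ℝ (Fin d)) (μ : Measure (EuclideanSpace ℝ (Fin d))) : ℝ :=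
  offDiagonalEnergy g (empiricalMeasure x) (empiricalMeasure x)
    - offDiagonalEnergy g (empiricalMeasure x) μ
    - offDiagonalEnergy g μ (empiricalMeasure x)
    + offDiagonalEnergy g μ μ

/-- The integral defining the modulated energy converges absolutely: `g(x - y)` is integrable off
the diagonal against the tensor square of the sum `μ_N + μ`. -/
def ModulatedEnergyConverges {d N : ℕ} (g : EuclideanSpace ℝ (Fin d) → ℝ)
    (x : Fin N → EuclideanSpace ℝ (Fin d)) (μ : Measure (EuclideanSpace ℝ (Fin d))) : Prop :=
  IntegrableOn (fun p : EuclideanSpace ℝ (Fin d) × EuclideanSpace ℝ (Fin d) => g (p.1 - p.2))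
    (offDiagonal d) ((empiricalMeasure x + μ).prod (empiricalMeasure x + μ))

/-- The squared homogeneous Sobolev norm of order `σ` of the difference `α - β` of two finite
measures, `∫ |ξ|^{2σ} |α̂(ξ) - β̂(ξ)|² dξ`, with values in `[0, ∞]`. -/
def homogeneousSobolevSq {d : ℕ} (σ : ℝ) (α β : Measure (EuclideanSpace ℝ (Fin d))) : ℝ≥0∞ :=
  ∫⁻ ξ, ENNReal.ofReal (‖ξ‖ ^ (2 * σ) * ‖charFun α ξ - charFun β ξ‖ ^ 2)

/-- The `L^∞` norm of the density of a measure `μ ≪ volume`, with values in `[0, ∞]`. -/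
def densitySup {d : ℕ} (μ : Measure (EuclideanSpace ℝ (Fin d))) : ℝ≥0∞ :=
  essSup (μ.rnDeriv volume) volume

/-- The factor of `‖μ‖_{L^∞}` in the error made by smearing at scale `η`. -/
def smearingError (d : ℕ) (s η : ℝ) : ℝ :=
  η ^ ((d : ℝ) - s) + (if s < (d : ℝ) - 2 then η ^ 2 else 0)
    + η ^ d * logIf (s = 0) η + η ^ 2 * logIf (s = (d : ℝ) - 2) η

/-- `∑_{i ≠ j, |xᵢ - xⱼ| ≤ r₀/2} (g(xⱼ - xᵢ) - g_{ηᵢ}(xⱼ - xᵢ))₊`, over ordered pairs. -/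
def nearPairSum {d N : ℕ} (g : EuclideanSpace ℝ (Fin d) → ℝ) (r₀ : ℝ)
    (x : Fin N → EuclideanSpace ℝ (Fin d)) (η : Fin N → ℝ) : ℝ :=
  open Classical in
  ∑ i, ∑ j, if i ≠ j ∧ ‖x i - x j‖ ≤ r₀ / 2 then
    max (g (x j - x i) - smearedPotential g (η i) (x j - x i)) 0 else 0

end

/-- A smooth concave truncation: the primitive of `t ↦ smoothTransition (T + 1 - t)`, equal to `t`
for `t ≤ T` and constant for `t ≥ T + 1`. -/
noncomputable def smoothTrunc (T t : ℝ) : ℝ := ∫ r in (0 : ℝ)..t, Real.smoothTransition (T + 1 - r)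

theorem continuous_smoothTransition_sub (T : ℝ) :
    Continuous fun r : ℝ => Real.smoothTransition (T + 1 - r) :=
  Real.smoothTransition.continuous.comp (by fun_prop)

theorem hasDerivAt_smoothTrunc (T t : ℝ) :
    HasDerivAt (smoothTrunc T) (Real.smoothTransition (T + 1 - t)) t :=
  (continuous_smoothTransition_sub T).integral_hasStrictDerivAt 0 t |>.hasDerivAt

theorem deriv_smoothTrunc (T : ℝ) :
    deriv (smoothTrunc T) = fun t => Real.smoothTransition (T + 1 - t) :=
  funext fun t => (hasDerivAt_smoothTrunc T t).deriv

theorem contDiff_smoothTransition_sub (T : ℝ) :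
    ContDiff ℝ ∞ fun r : ℝ => Real.smoothTransition (T + 1 - r) :=
  Real.smoothTransition.contDiff.comp (by fun_prop)

theorem contDiff_smoothTrunc (T : ℝ) : ContDiff ℝ ∞ (smoothTrunc T) := by
  rw [contDiff_infty_iff_deriv, deriv_smoothTrunc]
  exact ⟨fun t => (hasDerivAt_smoothTrunc T t).differentiableAt, contDiff_smoothTransition_sub T⟩

theorem smoothTrunc_of_le {T t : ℝ} (hT : 0 ≤ T) (ht : t ≤ T) : smoothTrunc T t = t := by
  have : smoothTrunc T t = ∫ r in (0 : ℝ)..t, (1 : ℝ) := by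
    refine intervalIntegral.integral_congr fun r hr => ?_
    refine Real.smoothTransition.one_of_one_le ?_
    have : r ≤ max 0 t := hr.2
    have : r ≤ T := this.trans (max_le hT ht)
    linarith
  simp [this]

theorem smoothTrunc_eq_of_ge {T t : ℝ} (ht : T + 1 ≤ t) :
    smoothTrunc T t = smoothTrunc T (T + 1) := by
  have hi := fun a b => (continuous_smoothTransition_sub T).intervalIntegrable (μ := volume) a b
  have h : smoothTrunc T t - smoothTrunc T (T + 1)
      = ∫ r in (T + 1)..t, Real.smoothTransition (T + 1 - r) := by
    rw [smoothTrunc, smoothTrunc, intervalIntegral.integral_interval_sub_left (hi _ _) (hi _ _)]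
  have : ∫ r in (T + 1)..t, Real.smoothTransition (T + 1 - r) = ∫ r in (T + 1)..t, (0 : ℝ) := by
    refine intervalIntegral.integral_congr fun r hr => ?_
    rw [Set.uIcc_of_le ht] at hr
    exact Real.smoothTransition.zero_of_nonpos (by linarith [hr.1])
  rw [this] at h
  simp at h
  linarith

theorem smoothTrunc_monotone (T : ℝ) : Monotone (smoothTrunc T) :=
  monotone_of_deriv_nonneg (fun t => (hasDerivAt_smoothTrunc T t).differentiableAt) fun t => by
    rw [deriv_smoothTrunc]; exact Real.smoothTransition.nonneg _

theorem smoothTrunc_le_self {T : ℝ} (hT : 0 ≤ T) (t : ℝ) : smoothTrunc T t ≤ t := by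
  rcases le_or_gt t T with h | h
  · exact (smoothTrunc_of_le hT h).le
  · have hm : Monotone fun t => t - smoothTrunc T t := by
      refine monotone_of_deriv_nonneg
        (fun t => ((hasDerivAt_id t).sub (hasDerivAt_smoothTrunc T t)).differentiableAt) fun t => ?_
      have := ((hasDerivAt_id t).sub (hasDerivAt_smoothTrunc T t)).deriv
      have h1 := Real.smoothTransition.le_one (T + 1 - t)
      simp only [id_eq, Pi.sub_def] at this
      rw [this]; linarith
    have := hm (h.le.trans' hT)
    simp only [smoothTrunc_of_le hT hT] at this
    linarith

theorem min_le_smoothTrunc {T : ℝ} (hT : 0 ≤ T) (t : ℝ) : min t 0 ≤ smoothTrunc T t := by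
  rcases le_total t 0 with h | h
  · rw [smoothTrunc_of_le hT (h.trans hT)]; exact min_le_left _ _
  · have := smoothTrunc_monotone T h
    rw [smoothTrunc_of_le hT hT] at this
    exact (min_le_right _ _).trans this

theorem deriv_deriv_smoothTrunc_nonpos (T t : ℝ) : deriv (deriv (smoothTrunc T)) t ≤ 0 := by
  rw [deriv_smoothTrunc]
  have : Antitone fun t => Real.smoothTransition (T + 1 - t) := fun a b h =>
    Real.smoothTransition.monotone (by linarith)
  exact this.deriv_nonpos

theorem two_le_infty : (2 : WithTop ℕ∞) ≤ ((⊤ : ℕ∞) : WithTop ℕ∞) := WithTop.coe_le_coe.2 le_top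

section Laplacian

variable {d : ℕ}

theorem laplacian_eq_sum_fderiv {f : EuclideanSpace ℝ (Fin d) → ℝ} {x : EuclideanSpace ℝ (Fin d)}
    (hf : ContDiffAt ℝ 2 f x) :
    Δ f x = ∑ i, fderiv ℝ (fun y => fderiv ℝ f y (EuclideanSpace.basisFun (Fin d) ℝ i)) x
      (EuclideanSpace.basisFun (Fin d) ℝ i) := by
  rw [InnerProductSpace.laplacian_eq_iteratedFDeriv_orthonormalBasis f
    (EuclideanSpace.basisFun (Fin d) ℝ)]
  refine Finset.sum_congr rfl fun i _ => ?_
  rw [iteratedFDeriv_two_apply]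
  have hd : DifferentiableAt ℝ (fderiv ℝ f) x :=
    (hf.fderiv_right (m := 1) le_rfl).differentiableAt (by norm_num)
  rw [fderiv_clm_apply hd (differentiableAt_const _)]
  simp

/-- Green's second identity, for a test function supported where `f` is smooth. -/
theorem integral_mul_laplacian_eq {f ψ : EuclideanSpace ℝ (Fin d) → ℝ}
    {U : Set (EuclideanSpace ℝ (Fin d))} (hU : IsOpen U) (hf : ContDiffOn ℝ 2 f U)
    (hψ : ContDiff ℝ 2 ψ) (hc : HasCompactSupport ψ) (hs : tsupport ψ ⊆ U) :
    ∫ x, f x * Δ ψ x = ∫ x, Δ f x * ψ x := by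
  set e := EuclideanSpace.basisFun (Fin d) ℝ
  have hfa : ∀ x ∈ U, ContDiffAt ℝ 2 f x := fun x hx => hf.contDiffAt (hU.mem_nhds hx)
  have hf1 : ∀ i, ContDiffOn ℝ 1 (fun y => fderiv ℝ f y (e i)) U := fun i x hx =>
    (((hfa x hx).fderiv_right (m := 1) le_rfl).clm_apply contDiffAt_const).contDiffWithinAt
  have hf2 : ∀ i, ContinuousOn (fun y => fderiv ℝ (fun z => fderiv ℝ f z (e i)) y (e i)) U := by
    intro i x hx
    have h1 := ((hf1 i).contDiffAt (hU.mem_nhds hx)).fderiv_right (m := 0) le_rfl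
    exact ((h1.clm_apply contDiffAt_const).continuousAt).continuousWithinAt
  have hψ1 : ∀ i, ContDiff ℝ 1 (fun y => fderiv ℝ ψ y (e i)) := fun i =>
    (hψ.fderiv_right (m := 1) le_rfl).clm_apply contDiff_const
  have hψ2 : ∀ i, Continuous (fun y => fderiv ℝ (fun z => fderiv ℝ ψ z (e i)) y (e i)) := fun i =>
    (((hψ1 i).fderiv_right (m := 0) le_rfl).clm_apply contDiff_const).continuous
  have ts1 : ∀ i, tsupport (fun y => fderiv ℝ ψ y (e i)) ⊆ tsupport ψ := fun i =>
    tsupport_fderiv_apply_subset ℝ (e i)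
  have ts2 : ∀ i, tsupport (fun y => fderiv ℝ (fun z => fderiv ℝ ψ z (e i)) y (e i)) ⊆ tsupport ψ :=
    fun i => (tsupport_fderiv_apply_subset ℝ (e i)).trans (ts1 i)
  have key : ∀ a b : EuclideanSpace ℝ (Fin d) → ℝ, ContinuousOn a U → Continuous b →
      tsupport b ⊆ tsupport ψ → Integrable (fun x => a x * b x) := by
    intro a b ha hb hab
    have hts : tsupport (fun x => a x * b x) ⊆ tsupport b := tsupport_mul_subset_right
    refine Continuous.integrable_of_hasCompactSupport ?_ ?_
    · exact (ha.mul hb.continuousOn).continuous_of_tsupport_subset hU (hts.trans (hab.trans hs))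
    · exact hc.of_isClosed_subset (isClosed_tsupport _) (hts.trans hab)
  have h1 : ∀ x, f x * Δ ψ x
      = ∑ i, f x * fderiv ℝ (fun y => fderiv ℝ ψ y (e i)) x (e i) := fun x => by
    rw [laplacian_eq_sum_fderiv hψ.contDiffAt, Finset.mul_sum]
  have h2 : ∀ x, Δ f x * ψ x
      = ∑ i, fderiv ℝ (fun y => fderiv ℝ f y (e i)) x (e i) * ψ x := fun x => by
    by_cases hx : x ∈ tsupport ψ
    · rw [laplacian_eq_sum_fderiv (hfa x (hs hx)), Finset.sum_mul]
    · simp [image_eq_zero_of_notMem_tsupport hx]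
  simp_rw [h1, h2]
  have hf0 : ContinuousOn f U := hf.continuousOn
  rw [integral_finsetSum _ fun i _ => key _ _ hf0 (hψ2 i) (ts2 i),
    integral_finsetSum _ fun i _ => key _ _ (hf2 i) hψ.continuous subset_rfl]
  refine Finset.sum_congr rfl fun i _ => ?_
  rw [integral_mul_fderiv_eq_neg_fderiv_mul_of_integrable
      (key _ _ (hf1 i).continuousOn (hψ1 i).continuous (ts1 i))
      (key _ _ hf0 (hψ2 i) (ts2 i)) (key _ _ hf0 (hψ1 i).continuous (ts1 i))
      (fun x hx => (hfa x (hs (ts1 i hx))).differentiableAt (by norm_num))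
      (fun x _ => (hψ1 i).differentiable (by norm_num) x),
    integral_mul_fderiv_eq_neg_fderiv_mul_of_integrable
      (key _ _ (hf2 i) hψ.continuous subset_rfl)
      (key _ _ (hf1 i).continuousOn (hψ1 i).continuous (ts1 i))
      (key _ _ (hf1 i).continuousOn hψ.continuous subset_rfl)
      (fun x hx => ((hf1 i).contDiffAt (hU.mem_nhds (hs hx))).differentiableAt (by norm_num))
      (fun x _ => hψ.differentiable (by norm_num) x), neg_neg]

theorem continuousAt_laplacian {f : EuclideanSpace ℝ (Fin d) → ℝ} {x : EuclideanSpace ℝ (Fin d)}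
    (hf : ContDiffAt ℝ 2 f x) : ContinuousAt (Δ f) x := by
  have h : (Δ f) = fun y => ∑ i, iteratedFDeriv ℝ 2 f y
      ![EuclideanSpace.basisFun (Fin d) ℝ i, EuclideanSpace.basisFun (Fin d) ℝ i] :=
    InnerProductSpace.laplacian_eq_iteratedFDeriv_orthonormalBasis f _
  rw [h]
  refine tendsto_finsetSum _ fun i _ => ?_
  have := (hf.iteratedFDeriv_right (m := 0) (i := 2) (by norm_num)).continuousAt
  exact ((ContinuousMultilinearMap.apply ℝ (fun _ : Fin 2 => EuclideanSpace ℝ (Fin d)) ℝ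
    ![EuclideanSpace.basisFun (Fin d) ℝ i,
      EuclideanSpace.basisFun (Fin d) ℝ i]).continuous.continuousAt (x := iteratedFDeriv ℝ 2 f x)).comp
    this

theorem abs_laplacian_le (f : EuclideanSpace ℝ (Fin d) → ℝ) (x : EuclideanSpace ℝ (Fin d)) :
    |Δ f x| ≤ d * ‖iteratedFDeriv ℝ 2 f x‖ := by
  rw [InnerProductSpace.laplacian_eq_iteratedFDeriv_orthonormalBasis f
    (EuclideanSpace.basisFun (Fin d) ℝ)]
  have hi : ∀ i ∈ (Finset.univ : Finset (Fin d)), |iteratedFDeriv ℝ 2 f x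
      ![EuclideanSpace.basisFun (Fin d) ℝ i, EuclideanSpace.basisFun (Fin d) ℝ i]|
      ≤ ‖iteratedFDeriv ℝ 2 f x‖ := fun i _ => by
    refine ((iteratedFDeriv ℝ 2 f x).le_opNorm _).trans ?_
    simp [Fin.prod_univ_two]
  exact (Finset.abs_sum_le_sum_abs _ _).trans
    ((Finset.sum_le_card_nsmul _ _ _ hi).trans_eq (by simp))

theorem laplacian_smoothTrunc_comp_le {g : EuclideanSpace ℝ (Fin d) → ℝ}
    {x : EuclideanSpace ℝ (Fin d)} {M : ℝ} (hM : 0 ≤ M) (hg : ContDiffAt ℝ 2 g x)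
    (hx : Δ g x ≤ M) (T : ℝ) : Δ (fun y => smoothTrunc T (g y)) x ≤ M := by
  have hh : ContDiff ℝ 2 (smoothTrunc T) := (contDiff_smoothTrunc T).of_le two_le_infty
  have hu : ContDiffAt ℝ 2 (fun y => smoothTrunc T (g y)) x := hh.contDiffAt.comp x hg
  rw [laplacian_eq_sum_fderiv hg] at hx
  rw [laplacian_eq_sum_fderiv hu]
  set e := EuclideanSpace.basisFun (Fin d) ℝ
  have hev : ∀ i, (fun y => fderiv ℝ (fun y => smoothTrunc T (g y)) y (e i))
      =ᶠ[𝓝 x] fun y => deriv (smoothTrunc T) (g y) * fderiv ℝ g y (e i) := by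
    intro i
    filter_upwards [hg.eventually (by simp)] with y hy
    have h1 := (hasDerivAt_smoothTrunc T (g y)).comp_hasFDerivAt y
      (hy.differentiableAt (by norm_num)).hasFDerivAt
    rw [show (fun y => smoothTrunc T (g y)) = smoothTrunc T ∘ g from rfl, h1.fderiv,
      deriv_smoothTrunc]
    simp
  have hdd : DifferentiableAt ℝ (deriv (smoothTrunc T)) (g x) := by
    rw [deriv_smoothTrunc]
    exact (contDiff_smoothTransition_sub T).differentiable (by simp) _
  have hterm : ∀ i, fderiv ℝ (fun y => fderiv ℝ (fun y => smoothTrunc T (g y)) y (e i)) x (e i)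
      = deriv (smoothTrunc T) (g x) * fderiv ℝ (fun y => fderiv ℝ g y (e i)) x (e i)
        + deriv (deriv (smoothTrunc T)) (g x) * (fderiv ℝ g x (e i)) ^ 2 := by
    intro i
    rw [(hev i).fderiv_eq]
    have h1 := hdd.hasDerivAt.comp_hasFDerivAt x (hg.differentiableAt (by norm_num)).hasFDerivAt
    have h2 : DifferentiableAt ℝ (fun y => fderiv ℝ g y (e i)) x :=
      ((hg.fderiv_right (m := 1) le_rfl).clm_apply contDiffAt_const).differentiableAt (by norm_num)
    have h3 := h1.mul h2.hasFDerivAt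
    rw [show (fun y => deriv (smoothTrunc T) (g y) * fderiv ℝ g y (e i))
      = (deriv (smoothTrunc T) ∘ g) * (fun y => fderiv ℝ g y (e i)) from rfl, h3.fderiv]
    simp only [Function.comp, add_apply, smul_apply,
      smul_eq_mul]
    ring
  simp_rw [hterm]
  rw [Finset.sum_add_distrib, ← Finset.mul_sum]
  have h0 : ∑ i, deriv (deriv (smoothTrunc T)) (g x) * (fderiv ℝ g x (e i)) ^ 2 ≤ 0 :=
    Finset.sum_nonpos fun i _ =>
      mul_nonpos_of_nonpos_of_nonneg (deriv_deriv_smoothTrunc_nonpos T _) (sq_nonneg _)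
  have h1 : 0 ≤ deriv (smoothTrunc T) (g x) := by
    rw [deriv_smoothTrunc]; exact Real.smoothTransition.nonneg _
  have h2 : deriv (smoothTrunc T) (g x) ≤ 1 := by
    rw [deriv_smoothTrunc]; exact Real.smoothTransition.le_one _
  have h3 := mul_le_mul_of_nonneg_left hx h1
  have h4 := mul_le_mul_of_nonneg_right h2 hM
  linarith

/-- A function that is smooth off the origin and superharmonic in the sense of distributions has a
nonpositive Laplacian. -/
theorem SuperharmonicInBall.laplacian_nonpos {g : EuclideanSpace ℝ (Fin d) → ℝ} {r₀ : ℝ}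
    (hsup : SuperharmonicInBall g r₀) (hg : ContDiffOn ℝ ∞ g {0}ᶜ) {x : EuclideanSpace ℝ (Fin d)}
    (hx0 : x ≠ 0) (hx : ‖x‖ < r₀) : Δ g x ≤ 0 := by
  by_contra! hpos
  have hg2 : ContDiffOn ℝ 2 g {0}ᶜ := hg.of_le two_le_infty
  have hU : IsOpen ({0}ᶜ : Set (EuclideanSpace ℝ (Fin d))) := isOpen_compl_singleton
  have hca : ∀ y ≠ 0, ContDiffAt ℝ 2 g y := fun y hy => hg2.contDiffAt (hU.mem_nhds hy)
  have hev : ∀ᶠ y in 𝓝 x, 0 < Δ g y ∧ y ≠ 0 ∧ ‖y‖ < r₀ :=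
    ((continuousAt_laplacian (hca x hx0)).eventually (lt_mem_nhds hpos)).and
      ((eventually_ne_nhds hx0).and
        (continuous_norm.continuousAt.eventually (gt_mem_nhds hx)))
  obtain ⟨ε, hε, hball⟩ := Metric.eventually_nhds_iff_ball.1 hev
  let φ : ContDiffBump x := ⟨ε / 4, ε / 2, by linarith, by linarith⟩
  have hts : tsupport φ ⊆ Metric.ball x ε := by
    rw [φ.tsupport_eq]
    exact Metric.closedBall_subset_ball (show ε / 2 < ε by linarith)
  have hts0 : tsupport φ ⊆ {0}ᶜ := fun y hy => (hball y (hts hy)).2.1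
  have h1 := hsup φ φ.contDiff φ.hasCompactSupport
    (fun y hy => by simpa using (hball y (hts hy)).2.2) fun y => φ.nonneg
  rw [integral_mul_laplacian_eq hU hg2 φ.contDiff φ.hasCompactSupport hts0] at h1
  have hcont : Continuous fun y => Δ g y * φ y := by
    refine ContinuousOn.continuous_of_tsupport_subset (s := {0}ᶜ) ?_ hU
      ((tsupport_mul_subset_right).trans hts0)
    exact fun y hy => ((continuousAt_laplacian (hca y hy)).mul
      φ.continuous.continuousAt).continuousWithinAt
  have h2 : 0 < ∫ y, Δ g y * φ y := by
    refine hcont.integral_pos_of_hasCompactSupport_nonneg_nonzero ?_ ?_ (x := x) ?_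
    · exact φ.hasCompactSupport.mul_left
    · intro y
      by_cases hy : y ∈ tsupport φ
      · exact mul_nonneg (hball y (hts hy)).1.le φ.nonneg
      · simp [image_eq_zero_of_notMem_tsupport hy]
    · exact (mul_pos hpos (φ.pos_of_mem_ball (Metric.mem_ball_self φ.rOut_pos))).ne'
  linarith

end Laplacian

section MeanValue

variable {d : ℕ}

theorem hasFDerivAt_comp_normSq {Q : ℝ → ℝ} {q' : ℝ} (y : EuclideanSpace ℝ (Fin d))
    (hQ : HasDerivAt Q q' (‖y‖ ^ 2)) :
    HasFDerivAt (fun y : EuclideanSpace ℝ (Fin d) => Q (‖y‖ ^ 2)) (q' • (2 • innerSL ℝ y)) y := by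
  exact hQ.comp_hasFDerivAt y (hasStrictFDerivAt_norm_sq y).hasFDerivAt

theorem hasCompactSupport_comp_normSq {Ψ : ℝ → ℝ} (hc : HasCompactSupport Ψ) :
    HasCompactSupport fun y : EuclideanSpace ℝ (Fin d) => Ψ (‖y‖ ^ 2) := by
  obtain ⟨R, hR⟩ := hc.isCompact.isBounded.subset_closedBall 0
  refine HasCompactSupport.intro (isCompact_closedBall (0 : EuclideanSpace ℝ (Fin d)) (|R| + 1))
    fun y hy => ?_
  refine image_eq_zero_of_notMem_tsupport fun h => hy ?_
  have := hR h
  simp only [Metric.mem_closedBall, dist_zero_right, Real.norm_eq_abs, abs_pow, abs_norm] at this ⊢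
  nlinarith [le_abs_self R, abs_nonneg R, norm_nonneg y]

/-- The derivative in `t` of the radial averages `∫ u(x + t y) Ψ(|y|²) dy`. -/
theorem hasDerivAt_integral_comp_smul {u : EuclideanSpace ℝ (Fin d) → ℝ} (hu : ContDiff ℝ 2 u)
    (x : EuclideanSpace ℝ (Fin d)) {w : EuclideanSpace ℝ (Fin d) → ℝ} (hw : Continuous w)
    (hc : HasCompactSupport w) (t : ℝ) :
    HasDerivAt (fun t : ℝ => ∫ y, u (x + t • y) * w y)
      (∫ y, fderiv ℝ u (x + t • y) y * w y) t := by
  have hcu : Continuous u := hu.continuous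
  have hcd : Continuous (fderiv ℝ u) := (hu.continuous_fderiv (by norm_num))
  have hF' : Continuous fun p : ℝ × EuclideanSpace ℝ (Fin d) =>
      fderiv ℝ u (x + p.1 • p.2) p.2 * w p.2 :=
    ((hcd.comp (by fun_prop)).clm_apply continuous_snd).mul (hw.comp continuous_snd)
  obtain ⟨C, hC⟩ := ((isCompact_closedBall t 1).prod hc.isCompact).exists_bound_of_continuousOn
    hF'.continuousOn
  have hsup : ∀ f : EuclideanSpace ℝ (Fin d) → ℝ, Continuous f →
      Integrable fun y => f y * w y := fun f hf =>
    (hf.mul hw).integrable_of_hasCompactSupport hc.mul_left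
  refine (hasDerivAt_integral_of_dominated_loc_of_deriv_le (s := Metric.ball t 1)
    (F := fun t y => u (x + t • y) * w y) (F' := fun t y => fderiv ℝ u (x + t • y) y * w y)
    (bound := (tsupport w).indicator fun _ => C) (Metric.ball_mem_nhds _ one_pos) ?_ ?_ ?_ ?_ ?_ ?_).2
  · exact Eventually.of_forall fun t => (hsup _ (hcu.comp (by fun_prop))).aestronglyMeasurable
  · exact hsup _ (hcu.comp (by fun_prop))
  · exact (hsup _ ((hcd.comp (by fun_prop)).clm_apply continuous_id)).aestronglyMeasurable
  · refine Eventually.of_forall fun y s hs => ?_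
    by_cases hy : y ∈ tsupport w
    · rw [Set.indicator_of_mem hy]
      exact hC (s, y) ⟨Metric.ball_subset_closedBall hs, hy⟩
    · simp [hy, image_eq_zero_of_notMem_tsupport hy]
  · rw [integrable_indicator_iff (isClosed_tsupport _).measurableSet]
    exact integrableOn_const hc.isCompact.measure_lt_top.ne
  · refine Eventually.of_forall fun y s _ => ?_
    have h1 : HasDerivAt (fun s : ℝ => x + s • y) y s := by
      simpa using ((hasDerivAt_id s).smul_const y).const_add x
    have h2 := (hu.differentiable (by norm_num) (x + s • y)).hasFDerivAt.comp_hasDerivAt s h1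
    exact h2.mul_const _

theorem integral_fderiv_mul_comp_normSq_nonpos {u : EuclideanSpace ℝ (Fin d) → ℝ}
    (hu : ContDiff ℝ 2 u)
    (hΔ : ∀ x, Δ u x ≤ 0) {Ψ : ℝ → ℝ} (hΨ : ContDiff ℝ ∞ Ψ) (hc : HasCompactSupport Ψ)
    (h0 : ∀ t, 0 ≤ Ψ t) (x : EuclideanSpace ℝ (Fin d)) {t : ℝ} (ht : 0 ≤ t) :
    ∫ y, fderiv ℝ u (x + t • y) y * Ψ (‖y‖ ^ 2) ≤ 0 := by
  set e := EuclideanSpace.basisFun (Fin d) ℝ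
  obtain ⟨R, hR⟩ := hc.isCompact.isBounded.subset_closedBall 0
  have hΨ0 : ∀ t, |R| < t → Ψ t = 0 := fun t ht => image_eq_zero_of_notMem_tsupport fun h => by
    have := hR h
    simp only [Metric.mem_closedBall, dist_zero_right, Real.norm_eq_abs] at this
    linarith [le_abs_self R, le_abs_self t]
  set Q : ℝ → ℝ := fun t => ∫ r in (|R|)..t, Ψ r with hQ
  have hQd : ∀ t, HasDerivAt Q (Ψ t) t := fun t =>
    (hΨ.continuous.integral_hasStrictDerivAt _ t).hasDerivAt
  have hQ0 : ∀ t, |R| ≤ t → Q t = 0 := fun t ht => by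
    rw [hQ]
    refine intervalIntegral.integral_zero_ae (ae_of_all _ fun r hr => ?_)
    rw [Set.uIoc_of_le ht] at hr
    exact hΨ0 r hr.1
  have hQn : ∀ t, Q t ≤ 0 := fun t => by
    rcases le_total |R| t with h | h
    · exact (hQ0 t h).le
    · rw [hQ]
      simp only
      rw [intervalIntegral.integral_symm, neg_nonpos]
      exact intervalIntegral.integral_nonneg h fun r _ => h0 r
  have hQc : ContDiff ℝ 2 Q := by
    have : ContDiff ℝ ∞ Q := by
      rw [contDiff_infty_iff_deriv]
      exact ⟨fun t => (hQd t).differentiableAt, by rwa [funext fun t => (hQd t).deriv]⟩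
    exact this.of_le two_le_infty
  set q : EuclideanSpace ℝ (Fin d) → ℝ := fun y => Q (‖y‖ ^ 2) with hq
  have hqc : ContDiff ℝ 2 q := hQc.comp (contDiff_norm_sq ℝ)
  have hqs : HasCompactSupport q := by
    refine HasCompactSupport.intro (isCompact_closedBall (0 : EuclideanSpace ℝ (Fin d)) (|R| + 1))
      fun y hy => hQ0 _ ?_
    simp only [Metric.mem_closedBall, dist_zero_right, not_le] at hy
    nlinarith [abs_nonneg R, norm_nonneg y]
  have hqd : ∀ y v, fderiv ℝ q y v = 2 * (Ψ (‖y‖ ^ 2) * inner ℝ y v) := fun y v => by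
    rw [(hasFDerivAt_comp_normSq y (hQd _)).fderiv]
    simp [innerSL_apply_apply]; ring
  have hu1 : ∀ i, ContDiff ℝ 1 (fun y => fderiv ℝ u y (e i)) := fun i =>
    (hu.fderiv_right (m := 1) le_rfl).clm_apply contDiff_const
  have hu2 : ∀ i, Continuous (fun y => fderiv ℝ (fun z => fderiv ℝ u z (e i)) y (e i)) := fun i =>
    (((hu1 i).fderiv_right (m := 0) le_rfl).clm_apply contDiff_const).continuous
  have haff : ContDiff ℝ 1 fun y : EuclideanSpace ℝ (Fin d) => x + t • y := by fun_prop
  have hv1 : ∀ i, ContDiff ℝ 1 (fun y => fderiv ℝ u (x + t • y) (e i)) := fun i =>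
    (hu1 i).comp haff
  have hvd : ∀ i y, fderiv ℝ (fun y => fderiv ℝ u (x + t • y) (e i)) y (e i)
      = t * fderiv ℝ (fun z => fderiv ℝ u z (e i)) (x + t • y) (e i) := fun i y => by
    have h1 : HasFDerivAt (fun y : EuclideanSpace ℝ (Fin d) => x + t • y)
        (t • ContinuousLinearMap.id ℝ _) y := ((hasFDerivAt_id y).const_smul t).const_add x
    have h2 := ((hu1 i).differentiable (by norm_num) (x + t • y)).hasFDerivAt.comp y h1
    have h3 := h2.fderiv
    simp only [Function.comp_def] at h3
    rw [h3]
    simp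
  have hsum : ∀ y, fderiv ℝ u (x + t • y) y * Ψ (‖y‖ ^ 2)
      = ∑ i, (1 / 2) * (fderiv ℝ u (x + t • y) (e i) * fderiv ℝ q y (e i)) := fun y => by
    have h1 : fderiv ℝ u (x + t • y) y = ∑ i, inner ℝ (e i) y * fderiv ℝ u (x + t • y) (e i) := by
      have := congrArg (fderiv ℝ u (x + t • y)) (e.sum_repr' y)
      rw [← this]
      simp [map_sum]
    rw [h1, Finset.sum_mul]
    refine Finset.sum_congr rfl fun i _ => ?_
    rw [hqd, real_inner_comm]
    ring
  have hint : ∀ f : EuclideanSpace ℝ (Fin d) → ℝ, Continuous f → ∀ p : EuclideanSpace ℝ (Fin d) → ℝ,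
      Continuous p → HasCompactSupport p → Integrable fun y => f y * p y := fun f hf p hp hp' =>
    (hf.mul hp).integrable_of_hasCompactSupport hp'.mul_left
  have hq1 : ∀ i, Continuous fun y => fderiv ℝ q y (e i) := fun i =>
    (hqc.continuous_fderiv (by norm_num)).clm_apply continuous_const
  have hq1s : ∀ i, HasCompactSupport fun y => fderiv ℝ q y (e i) := fun i => hqs.fderiv_apply ℝ (e i)
  have hv1c : ∀ i, Continuous fun y => fderiv ℝ (fun y => fderiv ℝ u (x + t • y) (e i)) y (e i) :=
    fun i => ((hv1 i).continuous_fderiv (by norm_num)).clm_apply continuous_const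
  simp_rw [hsum]
  rw [integral_finsetSum _ fun i _ => (hint _ (hv1 i).continuous _ (hq1 i) (hq1s i)).const_mul _]
  have hterm : ∀ i, ∫ y, (1 / 2) * (fderiv ℝ u (x + t • y) (e i) * fderiv ℝ q y (e i))
      = ∫ y, -(t / 2) * (fderiv ℝ (fun z => fderiv ℝ u z (e i)) (x + t • y) (e i) * q y) := by
    intro i
    rw [integral_const_mul, integral_mul_fderiv_eq_neg_fderiv_mul_of_integrable
      (hint _ (hv1c i) _ hqc.continuous hqs)
      (hint _ (hv1 i).continuous _ (hq1 i) (hq1s i))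
      (hint _ (hv1 i).continuous _ hqc.continuous hqs)
      (fun y _ => (hv1 i).differentiable (by norm_num) y)
      (fun y _ => hqc.differentiable (by norm_num) y)]
    simp_rw [hvd, mul_assoc]
    rw [integral_const_mul, integral_const_mul]
    ring
  simp_rw [hterm]
  have hu2t : ∀ i, Continuous fun y =>
      fderiv ℝ (fun z => fderiv ℝ u z (e i)) (x + t • y) (e i) := fun i =>
    (hu2 i).comp haff.continuous
  rw [← integral_finsetSum _ fun i _ => (hint _ (hu2t i) _ hqc.continuous hqs).const_mul _]
  refine integral_nonpos fun y => ?_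
  have : ∑ i, -(t / 2) * (fderiv ℝ (fun z => fderiv ℝ u z (e i)) (x + t • y) (e i) * q y)
      = -(t / 2) * (Δ u (x + t • y) * q y) := by
    rw [laplacian_eq_sum_fderiv hu.contDiffAt, Finset.sum_mul, Finset.mul_sum]
  simp only [this]
  have := mul_nonneg_of_nonpos_of_nonpos (hΔ (x + t • y)) (hQn (‖y‖ ^ 2))
  simp only [Pi.zero_apply]
  nlinarith

/-- The mean value inequality for smooth superharmonic functions, with a smooth radial weight. -/
theorem integral_mul_comp_normSq_le {u : EuclideanSpace ℝ (Fin d) → ℝ}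
    (hu : ContDiff ℝ 2 u) (hΔ : ∀ x, Δ u x ≤ 0) {Ψ : ℝ → ℝ} (hΨ : ContDiff ℝ ∞ Ψ)
    (hc : HasCompactSupport Ψ) (h0 : ∀ t, 0 ≤ Ψ t) (x : EuclideanSpace ℝ (Fin d)) :
    ∫ y, (u (x + y) - u x) * Ψ (‖y‖ ^ 2) ≤ 0 := by
  have hw : Continuous fun y : EuclideanSpace ℝ (Fin d) => Ψ (‖y‖ ^ 2) :=
    hΨ.continuous.comp (by fun_prop)
  have hws := hasCompactSupport_comp_normSq (d := d) hc
  have hJ := fun t => hasDerivAt_integral_comp_smul hu x hw hws t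
  have hanti : AntitoneOn (fun t : ℝ => ∫ y, u (x + t • y) * Ψ (‖y‖ ^ 2)) (Set.Ici 0) := by
    refine antitoneOn_of_deriv_nonpos (convex_Ici 0) (fun t _ => (hJ t).continuousAt.continuousWithinAt)
      (fun t _ => (hJ t).differentiableAt.differentiableWithinAt) fun t ht => ?_
    rw [interior_Ici] at ht
    rw [(hJ t).deriv]
    exact integral_fderiv_mul_comp_normSq_nonpos hu hΔ hΨ hc h0 x (le_of_lt ht)
  have h1 := hanti (Set.mem_Ici.2 le_rfl) (Set.mem_Ici.2 zero_le_one) zero_le_one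
  simp only [one_smul, zero_smul, add_zero] at h1
  have hi1 : Integrable fun y => u (x + y) * Ψ (‖y‖ ^ 2) :=
    ((hu.continuous.comp (by fun_prop)).mul hw).integrable_of_hasCompactSupport hws.mul_left
  have hi2 : Integrable fun y : EuclideanSpace ℝ (Fin d) => u x * Ψ (‖y‖ ^ 2) :=
    (continuous_const.mul hw).integrable_of_hasCompactSupport hws.mul_left
  simp_rw [sub_mul]
  rw [integral_sub hi1 hi2]
  linarith

theorem laplacian_norm_sub_sq (x y : EuclideanSpace ℝ (Fin d)) :
    Δ (fun z : EuclideanSpace ℝ (Fin d) => ‖z - x‖ ^ 2) y = 2 * d := by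
  have hsm : ContDiff ℝ 2 fun z : EuclideanSpace ℝ (Fin d) => ‖z - x‖ ^ 2 :=
    (contDiff_norm_sq ℝ).comp (contDiff_id.sub contDiff_const)
  have h1 : ∀ z v : EuclideanSpace ℝ (Fin d),
      fderiv ℝ (fun z : EuclideanSpace ℝ (Fin d) => ‖z - x‖ ^ 2) z v = 2 * inner ℝ v (z - x) := by
    intro z v
    have := (hasStrictFDerivAt_norm_sq (z - x)).hasFDerivAt.comp z
      ((hasFDerivAt_id z).sub_const x)
    rw [show (fun z : EuclideanSpace ℝ (Fin d) => ‖z - x‖ ^ 2)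
      = (fun z => ‖z‖ ^ 2) ∘ fun z => id z - x from rfl, this.fderiv]
    rw [real_inner_comm]
    simp [inner_sub_left]
  rw [laplacian_eq_sum_fderiv hsm.contDiffAt]
  have h2 : ∀ i, fderiv ℝ (fun z => fderiv ℝ (fun z : EuclideanSpace ℝ (Fin d) => ‖z - x‖ ^ 2) z
      (EuclideanSpace.basisFun (Fin d) ℝ i)) y (EuclideanSpace.basisFun (Fin d) ℝ i) = 2 := by
    intro i
    simp only [h1]
    have h3 : HasFDerivAt (fun z => 2 * inner ℝ (EuclideanSpace.basisFun (Fin d) ℝ i) (z - x))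
        ((2 : ℝ) • innerSL ℝ (EuclideanSpace.basisFun (Fin d) ℝ i)) y :=
      (((innerSL ℝ (EuclideanSpace.basisFun (Fin d) ℝ i)).hasFDerivAt.comp y
        ((hasFDerivAt_id y).sub_const x))).const_mul 2
    rw [h3.fderiv]
    simp [innerSL_apply_apply]
  rw [Finset.sum_congr rfl fun i _ => h2 i]
  simp [mul_comm]

end MeanValue

section Polar

variable {d : ℕ} [Nontrivial (EuclideanSpace ℝ (Fin d))]

open Metric Set Measure

theorem integral_eq_integral_sphere {F : EuclideanSpace ℝ (Fin d) → ℝ} (hF : Integrable F) :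
    ∫ y, F y = ∫ r, ∫ θ, F ((r : ℝ) • (θ : EuclideanSpace ℝ (Fin d)))
      ∂(volume : Measure (EuclideanSpace ℝ (Fin d))).toSphere ∂(volumeIoiPow (d - 1)) := by
  have hmp := (volume : Measure (EuclideanSpace ℝ (Fin d))).measurePreserving_homeomorphUnitSphereProd
  rw [finrank_euclideanSpace_fin] at hmp
  have he := (homeomorphUnitSphereProd (EuclideanSpace ℝ (Fin d))).measurableEmbedding
  set G : sphere (0 : EuclideanSpace ℝ (Fin d)) 1 × Ioi (0 : ℝ) → ℝ :=
    fun p => F ((p.2 : ℝ) • (p.1 : EuclideanSpace ℝ (Fin d)))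
  have hcomp : G ∘ homeomorphUnitSphereProd (EuclideanSpace ℝ (Fin d))
      = F ∘ Subtype.val := by
    ext z
    have h : ‖(z : EuclideanSpace ℝ (Fin d))‖ ≠ 0 := norm_ne_zero_iff.2 z.2
    simp [G, smul_smul, mul_inv_cancel₀ h]
  have hFi : Integrable (F ∘ Subtype.val)
      ((volume : Measure (EuclideanSpace ℝ (Fin d))).comap
        (Subtype.val : ({0}ᶜ : Set (EuclideanSpace ℝ (Fin d))) → _)) :=
    (integrableOn_iff_comap_subtypeVal (measurableSet_singleton _).compl).1 hF.integrableOn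
  have hG : Integrable G
      ((volume : Measure (EuclideanSpace ℝ (Fin d))).toSphere.prod (volumeIoiPow (d - 1))) := by
    rw [← hmp.integrable_comp_emb he, hcomp]; exact hFi
  calc ∫ y, F y = ∫ x : ({0}ᶜ : Set (EuclideanSpace ℝ (Fin d))), F x
        ∂((volume : Measure (EuclideanSpace ℝ (Fin d))).comap (↑)) := by
        rw [integral_subtype_comap (measurableSet_singleton _).compl fun x => F x,
          restrict_compl_singleton]
    _ = ∫ p, G p ∂((volume : Measure (EuclideanSpace ℝ (Fin d))).toSphere.prod
        (volumeIoiPow (d - 1))) := by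
        rw [← hmp.integral_comp he]
        exact congrArg (fun f => ∫ x, f x ∂_) hcomp.symm
    _ = _ := integral_prod_symm G hG

/-- A weighted integral is nonpositive if the spherical means are. -/
theorem integral_nonpos_of_sphere {F : EuclideanSpace ℝ (Fin d) → ℝ} (hF : Integrable F)
    (h : ∀ r : ℝ, 0 < r → ∫ θ, F (r • (θ : EuclideanSpace ℝ (Fin d)))
      ∂(volume : Measure (EuclideanSpace ℝ (Fin d))).toSphere ≤ 0) : ∫ y, F y ≤ 0 := by
  rw [integral_eq_integral_sphere hF]
  exact integral_nonpos fun r => h r r.2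

/-- The mean value inequality on spheres for smooth superharmonic functions. -/
theorem integral_sphere_sub_le {u : EuclideanSpace ℝ (Fin d) → ℝ} (hu : ContDiff ℝ 2 u)
    (hΔ : ∀ x, Δ u x ≤ 0) (x : EuclideanSpace ℝ (Fin d)) {η : ℝ} (hη : 0 < η) :
    ∫ θ, (u (x + η • (θ : EuclideanSpace ℝ (Fin d))) - u x)
      ∂(volume : Measure (EuclideanSpace ℝ (Fin d))).toSphere ≤ 0 := by
  set τ := (volume : Measure (EuclideanSpace ℝ (Fin d))).toSphere
  set k : ℝ → ℝ := fun r => ∫ θ, (u (x + r • (θ : EuclideanSpace ℝ (Fin d))) - u x) ∂τ with hk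
  have hkc : Continuous k := by
    have : Continuous (Function.uncurry fun (r : ℝ) (θ : sphere (0 : EuclideanSpace ℝ (Fin d)) 1) =>
        u (x + r • (θ : EuclideanSpace ℝ (Fin d))) - u x) :=
      (hu.continuous.comp (by fun_prop)).sub continuous_const
    have h2 := continuous_parametric_integral_of_continuous (μ := τ) this isCompact_univ
    simpa [Measure.restrict_univ] using h2
  by_contra! hpos
  obtain ⟨ε, hε, hball⟩ := Metric.eventually_nhds_iff_ball.1
    ((hkc.continuousAt (x := η)).eventually (lt_mem_nhds hpos) |>.and (lt_mem_nhds hη))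
  have hsq : ∀ᶠ t in 𝓝 (η ^ 2), √t ∈ ball η ε := by
    refine Real.continuous_sqrt.continuousAt.eventually (?_ : ∀ᶠ y in 𝓝 √(η ^ 2), y ∈ ball η ε)
    rw [Real.sqrt_sq hη.le]
    exact ball_mem_nhds η hε
  obtain ⟨δ, hδ, hδball⟩ := Metric.eventually_nhds_iff_ball.1 hsq
  let Ψ : ContDiffBump (η ^ 2) := ⟨δ / 4, δ / 2, by linarith, by linarith⟩
  have hΨs : tsupport Ψ ⊆ ball (η ^ 2) δ := by
    rw [Ψ.tsupport_eq]
    exact closedBall_subset_ball (show δ / 2 < δ by linarith)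
  have hkΨ : ∀ r : ℝ, 0 ≤ r → 0 ≤ k r * Ψ (r ^ 2) := fun r hr => by
    by_cases h : r ^ 2 ∈ tsupport Ψ
    · have := hδball _ (hΨs h)
      rw [Real.sqrt_sq hr] at this
      exact mul_nonneg (hball r this).1.le Ψ.nonneg
    · simp [image_eq_zero_of_notMem_tsupport h]
  have hws := hasCompactSupport_comp_normSq (d := d) Ψ.hasCompactSupport
  have hw : Continuous fun y : EuclideanSpace ℝ (Fin d) => Ψ (‖y‖ ^ 2) :=
    Ψ.continuous.comp (by fun_prop)
  have h1 := integral_mul_comp_normSq_le hu hΔ Ψ.contDiff Ψ.hasCompactSupport (fun _ => Ψ.nonneg) x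
  have hnorm : ∀ (r : Ioi (0 : ℝ)) (θ : sphere (0 : EuclideanSpace ℝ (Fin d)) 1),
      ‖(r : ℝ) • (θ : EuclideanSpace ℝ (Fin d))‖ = r := fun r θ => by
    rw [norm_smul]; simp [abs_of_pos r.2.out]
  have hc1 : Continuous fun y => (u (x + y) - u x) * Ψ (‖y‖ ^ 2) :=
    ((hu.continuous.comp (by fun_prop)).sub continuous_const).mul hw
  rw [integral_eq_integral_sphere (hc1.integrable_of_hasCompactSupport hws.mul_left)] at h1
  simp only [hnorm, integral_mul_const] at h1
  have hcont : Continuous fun y : EuclideanSpace ℝ (Fin d) => k ‖y‖ * Ψ (‖y‖ ^ 2) :=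
    (hkc.comp continuous_norm).mul hw
  obtain ⟨v, hv⟩ := exists_norm_eq (EuclideanSpace ℝ (Fin d)) hη.le
  have h2 : 0 < ∫ y : EuclideanSpace ℝ (Fin d), k ‖y‖ * Ψ (‖y‖ ^ 2) := by
    refine hcont.integral_pos_of_hasCompactSupport_nonneg_nonzero hws.mul_left
      (fun y => hkΨ _ (norm_nonneg y)) (x := v) ?_
    rw [hv]
    exact (mul_pos hpos (Ψ.pos_of_mem_ball (mem_ball_self Ψ.rOut_pos))).ne'
  rw [integral_eq_integral_sphere (hcont.integrable_of_hasCompactSupport hws.mul_left)] at h2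
  simp only [hnorm, integral_const, smul_eq_mul] at h2
  rw [integral_const_mul] at h2
  have h3 : 0 ≤ τ.real univ := measureReal_nonneg
  nlinarith [h1, h2, h3]

/-- The mean value inequality on spheres for smooth functions with Laplacian bounded above. -/
theorem integral_sphere_le_of_laplacian_le {u : EuclideanSpace ℝ (Fin d) → ℝ}
    (hu : ContDiff ℝ 2 u) (hd : 0 < d) {M : ℝ} (hΔ : ∀ x, Δ u x ≤ M)
    (x : EuclideanSpace ℝ (Fin d)) {η : ℝ} (hη : 0 < η) :
    ∫ θ, (u (x + η • (θ : EuclideanSpace ℝ (Fin d))) - u x - M / (2 * d) * η ^ 2)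
      ∂(volume : Measure (EuclideanSpace ℝ (Fin d))).toSphere ≤ 0 := by
  set c := M / (2 * d) with hc
  have hsm : ContDiff ℝ 2 fun z : EuclideanSpace ℝ (Fin d) => ‖z - x‖ ^ 2 :=
    (contDiff_norm_sq ℝ).comp (contDiff_id.sub contDiff_const)
  have hd' : (0 : ℝ) < d := by exact_mod_cast hd
  have h := integral_sphere_sub_le (u := u - c • fun z => ‖z - x‖ ^ 2)
    (hu.sub (hsm.const_smul c)) (fun y => by
      have hs2 : ContDiffAt ℝ 2 (c • fun z : EuclideanSpace ℝ (Fin d) => ‖z - x‖ ^ 2) y :=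
        (hsm.const_smul c).contDiffAt
      rw [ContDiffAt.laplacian_sub hu.contDiffAt hs2, InnerProductSpace.laplacian_smul _ hsm.contDiffAt, laplacian_norm_sub_sq]
      have : c * (2 * d) = M := by rw [hc]; field_simp
      rw [smul_eq_mul, this]
      linarith [hΔ y]) x hη
  refine le_of_eq_of_le (integral_congr_ae (ae_of_all _ fun θ => ?_)) h
  have : ‖η • (θ : EuclideanSpace ℝ (Fin d))‖ = η := by
    rw [norm_smul]; simp [abs_of_pos hη]
  simp only [Pi.sub_apply, Pi.smul_apply, smul_eq_mul, add_sub_cancel_left, sub_self, norm_zero,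
    this]
  ring

end Polar

section Sphere

open Metric Set Measure
open scoped Pointwise

variable {d : ℕ}

/-- The uniform probability measure on the unit sphere, as a measure on the subtype. -/
noncomputable def unitSphereMeasure (d : ℕ) : Measure (sphere (0 : EuclideanSpace ℝ (Fin d)) 1) :=
  ((volume : Measure (EuclideanSpace ℝ (Fin d))).toSphere univ)⁻¹ •
    (volume : Measure (EuclideanSpace ℝ (Fin d))).toSphere

theorem nontrivial_euclideanSpace (hd : 0 < d) : Nontrivial (EuclideanSpace ℝ (Fin d)) := by
  have : Nonempty (Fin d) := ⟨⟨0, hd⟩⟩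
  infer_instance

theorem isProbabilityMeasure_unitSphereMeasure (hd : 0 < d) :
    IsProbabilityMeasure (unitSphereMeasure d) := by
  have := nontrivial_euclideanSpace hd
  refine ⟨?_⟩
  have h0 : (volume : Measure (EuclideanSpace ℝ (Fin d))).toSphere univ ≠ 0 :=
    measure_univ_ne_zero.2 (toSphere_ne_zero _)
  rw [unitSphereMeasure, Measure.smul_apply, smul_eq_mul,
    ENNReal.inv_mul_cancel h0 (measure_ne_top _ _)]

theorem uniformSphere_eq_map (x : EuclideanSpace ℝ (Fin d)) (η : ℝ) :
    uniformSphere x η = (unitSphereMeasure d).map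
      fun u : sphere (0 : EuclideanSpace ℝ (Fin d)) 1 => x + η • (u : EuclideanSpace ℝ (Fin d)) := by
  rw [unitSphereMeasure, Measure.map_smul, uniformSphere]

theorem measurable_add_smul_sphere (x : EuclideanSpace ℝ (Fin d)) (η : ℝ) : Measurable
    fun u : sphere (0 : EuclideanSpace ℝ (Fin d)) 1 => x + η • (u : EuclideanSpace ℝ (Fin d)) := by
  fun_prop

theorem isProbabilityMeasure_uniformSphere (hd : 0 < d) (x : EuclideanSpace ℝ (Fin d)) (η : ℝ) :
    IsProbabilityMeasure (uniformSphere x η) := by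
  have := isProbabilityMeasure_unitSphereMeasure hd
  rw [uniformSphere_eq_map]
  exact Measure.isProbabilityMeasure_map (measurable_add_smul_sphere x η).aemeasurable

theorem measurableEmbedding_add_smul_sphere (x : EuclideanSpace ℝ (Fin d)) {η : ℝ} (hη : η ≠ 0) :
    MeasurableEmbedding
      fun u : sphere (0 : EuclideanSpace ℝ (Fin d)) 1 => x + η • (u : EuclideanSpace ℝ (Fin d)) := by
  refine (Continuous.isClosedEmbedding (by fun_prop) fun a b h => ?_).measurableEmbedding
  have h2 : η • (a : EuclideanSpace ℝ (Fin d)) = η • (b : EuclideanSpace ℝ (Fin d)) :=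
    add_left_cancel h
  exact Subtype.ext (smul_right_injective _ hη h2)

theorem integral_uniformSphere (f : EuclideanSpace ℝ (Fin d) → ℝ) (x : EuclideanSpace ℝ (Fin d))
    {η : ℝ} (hη : η ≠ 0) : ∫ y, f y ∂(uniformSphere x η)
      = ∫ θ, f (x + η • (θ : EuclideanSpace ℝ (Fin d))) ∂(unitSphereMeasure d) := by
  rw [uniformSphere_eq_map, (measurableEmbedding_add_smul_sphere x hη).integral_map]

theorem integrable_uniformSphere_iff {f : EuclideanSpace ℝ (Fin d) → ℝ}
    {x : EuclideanSpace ℝ (Fin d)} {η : ℝ} (hη : η ≠ 0) : Integrable f (uniformSphere x η)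
      ↔ Integrable (fun θ : sphere (0 : EuclideanSpace ℝ (Fin d)) 1 =>
        f (x + η • (θ : EuclideanSpace ℝ (Fin d)))) (unitSphereMeasure d) := by
  rw [uniformSphere_eq_map, (measurableEmbedding_add_smul_sphere x hη).integrable_map_iff]
  rfl

theorem ae_uniformSphere {p : EuclideanSpace ℝ (Fin d) → Prop} {x : EuclideanSpace ℝ (Fin d)}
    {η : ℝ} (hη : 0 < η) (h : ∀ y, ‖y - x‖ = η → p y) : ∀ᵐ y ∂(uniformSphere x η), p y := by
  rw [uniformSphere_eq_map, (measurableEmbedding_add_smul_sphere x hη.ne').ae_map_iff]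
  refine ae_of_all _ fun θ => h _ ?_
  simp [norm_smul, abs_of_pos hη]

theorem unitSphereMeasure_singleton (hd : 2 ≤ d) (θ : sphere (0 : EuclideanSpace ℝ (Fin d)) 1) :
    unitSphereMeasure d {θ} = 0 := by
  rw [unitSphereMeasure, Measure.smul_apply, toSphere_apply' _ (measurableSet_singleton θ)]
  have hsub : Ioo (0 : ℝ) 1 • ((↑) '' {θ} : Set (EuclideanSpace ℝ (Fin d)))
      ⊆ (Submodule.span ℝ {(θ : EuclideanSpace ℝ (Fin d))} : Set (EuclideanSpace ℝ (Fin d))) := by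
    rintro _ ⟨r, _, _, ⟨t, ht, rfl⟩, rfl⟩
    rw [mem_singleton_iff.1 ht]
    exact Submodule.smul_mem _ _ (Submodule.mem_span_singleton_self _)
  have hne : Submodule.span ℝ {(θ : EuclideanSpace ℝ (Fin d))} ≠ ⊤ := by
    intro h
    have h1 := finrank_span_singleton (K := ℝ) (v := (θ : EuclideanSpace ℝ (Fin d)))
      (fun h0 => by simpa [h0] using θ.2)
    rw [h, finrank_top, finrank_euclideanSpace_fin] at h1
    omega
  rw [measure_mono_null hsub (addHaar_submodule _ _ hne)]
  simp

theorem nullSingletonClass_uniformSphere (hd : 2 ≤ d) (x : EuclideanSpace ℝ (Fin d)) {η : ℝ}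
    (hη : 0 < η) : NullSingletonClass (uniformSphere x η) := by
  refine ⟨fun y => ?_⟩
  rw [uniformSphere_eq_map, (measurableEmbedding_add_smul_sphere x hη.ne').map_apply]
  have hinj := (measurableEmbedding_add_smul_sphere x hη.ne').injective
  rcases (Set.subsingleton_singleton (a := y)).preimage hinj |>.eq_empty_or_singleton with h | ⟨θ, h⟩
  · rw [h]; simp
  · rw [h]; exact unitSphereMeasure_singleton hd θ

theorem integral_unitSphereMeasure_neg (f : EuclideanSpace ℝ (Fin d) → ℝ) :
    ∫ θ, f (-(θ : EuclideanSpace ℝ (Fin d))) ∂(unitSphereMeasure d)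
      = ∫ θ, f (θ : EuclideanSpace ℝ (Fin d)) ∂(unitSphereMeasure d) := by
  let e := (Homeomorph.neg (sphere (0 : EuclideanSpace ℝ (Fin d)) 1))
  have hmap : (unitSphereMeasure d).map e = unitSphereMeasure d := by
    rw [unitSphereMeasure, Measure.map_smul]
    congr 1
    ext s hs
    rw [Measure.map_apply e.measurable hs, toSphere_apply' _ hs,
      toSphere_apply' _ (e.measurable hs), ← measure_neg volume (Ioo (0 : ℝ) 1 • _)]
    congr 2
    ext y
    simp only [Set.mem_neg, Set.mem_smul, mem_image, mem_preimage]
    constructor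
    · rintro ⟨r, hr, _, ⟨t, ht, rfl⟩, hy⟩
      refine ⟨r, hr, _, ⟨-t, by simpa [e] using ht, rfl⟩, ?_⟩
      rw [show ((-t : sphere (0 : EuclideanSpace ℝ (Fin d)) 1) : EuclideanSpace ℝ (Fin d)) = -t from rfl,
        smul_neg, hy, neg_neg]
    · rintro ⟨r, hr, _, ⟨t, ht, rfl⟩, hy⟩
      refine ⟨r, hr, _, ⟨-t, by simpa [e] using ht, rfl⟩, ?_⟩
      simp [hy]
  conv_rhs => rw [← hmap]
  rw [e.measurableEmbedding.integral_map]
  rfl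

end Sphere

theorem integrable_of_tendsto_of_integral_le {X : Type*} [MeasurableSpace X] {ρ : Measure X}
    [IsFiniteMeasure ρ] {F : ℕ → X → ℝ} {f : X → ℝ} {A b : ℝ} (hF : ∀ n, Integrable (F n) ρ)
    (hlow : ∀ n, ∀ᵐ x ∂ρ, -A ≤ F n x) (hlim : ∀ᵐ x ∂ρ, Tendsto (fun n => F n x) atTop (𝓝 (f x)))
    (hb : ∀ n, ∫ x, F n x ∂ρ ≤ b) : Integrable f ρ ∧ ∫ x, f x ∂ρ ≤ b := by
  have hfm : AEStronglyMeasurable f ρ :=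
    aestronglyMeasurable_of_tendsto_ae atTop (fun n => (hF n).1) hlim
  have hflow : ∀ᵐ x ∂ρ, 0 ≤ f x + A := by
    filter_upwards [ae_all_iff.2 hlow, hlim] with x h1 h2
    have := ge_of_tendsto' h2 h1
    linarith
  set B := b + A * ρ.real Set.univ
  have hFi : ∀ n, ∫⁻ x, ENNReal.ofReal (F n x + A) ∂ρ ≤ ENNReal.ofReal B := fun n => by
    have hi : Integrable (fun x => F n x + A) ρ := (hF n).add (integrable_const A)
    rw [← ofReal_integral_eq_lintegral_ofReal hi
      ((hlow n).mono fun x hx => by simp only [Pi.zero_apply]; linarith)]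
    refine ENNReal.ofReal_le_ofReal ?_
    rw [integral_add (hF n) (integrable_const A)]
    simp only [integral_const, smul_eq_mul, B]
    linarith [hb n, mul_comm A (ρ.real Set.univ)]
  have hfat : ∫⁻ x, ENNReal.ofReal (f x + A) ∂ρ ≤ ENNReal.ofReal B := by
    calc ∫⁻ x, ENNReal.ofReal (f x + A) ∂ρ
        = ∫⁻ x, liminf (fun n => ENNReal.ofReal (F n x + A)) atTop ∂ρ := by
          refine lintegral_congr_ae (hlim.mono fun x hx => ?_)
          exact ((ENNReal.tendsto_ofReal (hx.add_const A)).liminf_eq).symm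
      _ ≤ liminf (fun n => ∫⁻ x, ENNReal.ofReal (F n x + A) ∂ρ) atTop :=
          lintegral_liminf_le' fun n => ((hF n).1.aemeasurable.add_const A).ennreal_ofReal
      _ ≤ ENNReal.ofReal B := by
          refine (liminf_le_liminf (Eventually.of_forall hFi)).trans_eq (by simp)
  have hfA : Integrable (fun x => f x + A) ρ := by
    refine ⟨hfm.add aestronglyMeasurable_const, ?_⟩
    rw [hasFiniteIntegral_iff_ofReal hflow]
    exact hfat.trans_lt ENNReal.ofReal_lt_top
  have hf : Integrable f ρ := by
    simpa [Pi.sub_def] using hfA.sub (integrable_const A)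
  refine ⟨hf, ?_⟩
  have hB : 0 ≤ B := by
    have := integral_nonneg_of_ae (μ := ρ) (f := fun x => F 0 x + A)
      ((hlow 0).mono fun x hx => by simp only [Pi.zero_apply]; linarith)
    rw [integral_add (hF 0) (integrable_const A)] at this
    simp only [integral_const, smul_eq_mul] at this
    simp only [B]
    linarith [hb 0, mul_comm A (ρ.real Set.univ)]
  rw [← ofReal_integral_eq_lintegral_ofReal hfA hflow, ENNReal.ofReal_le_ofReal_iff hB,
    integral_add hf (integrable_const A)] at hfat
  simp only [integral_const, smul_eq_mul, B] at hfat
  linarith [mul_comm A (ρ.real Set.univ)]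

/-- A potential that is smooth off the origin, tends to `+∞` there, and has Laplacian at most `M`
off the origin. -/
structure AlmostSuperharmonic {d : ℕ} (M : ℝ) (g : EuclideanSpace ℝ (Fin d) → ℝ) : Prop where
  nonneg : 0 ≤ M
  smooth : ContDiffOn ℝ ∞ g {0}ᶜ
  tendsto_zero : Tendsto g (𝓝[≠] 0) atTop
  laplacian_le : ∀ x, x ≠ 0 → Δ g x ≤ M

/-- The truncation of a potential, extended by its limit value at the origin. -/
noncomputable def truncatedPotential {d : ℕ} (g : EuclideanSpace ℝ (Fin d) → ℝ) (T : ℝ)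
    (x : EuclideanSpace ℝ (Fin d)) : ℝ :=
  open Classical in if x = 0 then smoothTrunc T (T + 1) else smoothTrunc T (g x)

theorem ae_prod_ne {X : Type*} [TopologicalSpace X] [MeasurableSpace X] [BorelSpace X] [T2Space X]
    [SecondCountableTopology X] (ρ ν : Measure X) [SFinite ρ] [SFinite ν] [NullSingletonClass ν] :
    ∀ᵐ p ∂(ρ.prod ν), p.1 ≠ p.2 := by
  have hm : MeasurableSet {p : X × X | p.1 ≠ p.2} :=
    (isClosed_eq continuous_fst continuous_snd).measurableSet.compl
  rw [Measure.ae_prod_iff_ae_ae hm]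
  refine ae_of_all _ fun x => ?_
  simp [ae_iff]

namespace AlmostSuperharmonic

variable {d : ℕ} {M : ℝ} {g : EuclideanSpace ℝ (Fin d) → ℝ}

theorem contDiffAt (hg : AlmostSuperharmonic M g) {x : EuclideanSpace ℝ (Fin d)} (hx : x ≠ 0) :
    ContDiffAt ℝ 2 g x :=
  (hg.smooth.of_le two_le_infty).contDiffAt (isOpen_compl_singleton.mem_nhds hx)

theorem continuousAt (hg : AlmostSuperharmonic M g) {x : EuclideanSpace ℝ (Fin d)} (hx : x ≠ 0) :
    ContinuousAt g x := (hg.contDiffAt hx).continuousAt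

theorem measurable (hg : AlmostSuperharmonic M g) : Measurable g :=
  measurable_of_continuousOn_compl_singleton 0 hg.smooth.continuousOn

theorem truncatedPotential_eventuallyEq_zero (hg : AlmostSuperharmonic M g) (T : ℝ) :
    truncatedPotential g T =ᶠ[𝓝 0] fun _ => smoothTrunc T (T + 1) := by
  have h := hg.tendsto_zero.eventually (eventually_ge_atTop (T + 1))
  rw [eventually_nhdsWithin_iff] at h
  filter_upwards [h] with y hy
  by_cases h0 : y = 0
  · simp [truncatedPotential, h0]
  · simp [truncatedPotential, h0, smoothTrunc_eq_of_ge (hy h0)]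

theorem truncatedPotential_eventuallyEq {x : EuclideanSpace ℝ (Fin d)}
    (hx : x ≠ 0) (T : ℝ) : truncatedPotential g T =ᶠ[𝓝 x] fun y => smoothTrunc T (g y) := by
  filter_upwards [eventually_ne_nhds hx] with y hy
  simp [truncatedPotential, hy]

theorem contDiff_truncatedPotential (hg : AlmostSuperharmonic M g) (T : ℝ) :
    ContDiff ℝ 2 (truncatedPotential g T) := by
  rw [contDiff_iff_contDiffAt]
  intro x
  by_cases hx : x = 0
  · subst hx
    exact contDiffAt_const.congr_of_eventuallyEq (hg.truncatedPotential_eventuallyEq_zero T)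
  · refine ContDiffAt.congr_of_eventuallyEq ?_ (truncatedPotential_eventuallyEq hx T)
    exact ((contDiff_smoothTrunc T).of_le two_le_infty).contDiffAt.comp x (hg.contDiffAt hx)

theorem laplacian_truncatedPotential_le (hg : AlmostSuperharmonic M g) (T : ℝ)
    (x : EuclideanSpace ℝ (Fin d)) : Δ (truncatedPotential g T) x ≤ M := by
  by_cases hx : x = 0
  · subst hx
    rw [(InnerProductSpace.laplacian_congr_nhds
      (hg.truncatedPotential_eventuallyEq_zero T)).eq_of_nhds]
    simpa using hg.nonneg
  · rw [(InnerProductSpace.laplacian_congr_nhds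
      (truncatedPotential_eventuallyEq hx T)).eq_of_nhds]
    exact laplacian_smoothTrunc_comp_le hg.nonneg (hg.contDiffAt hx) (hg.laplacian_le x hx) T

theorem truncatedPotential_le {T : ℝ} (hT : 0 ≤ T) {x : EuclideanSpace ℝ (Fin d)} (hx : x ≠ 0) :
    truncatedPotential g T x ≤ g x := by
  simpa [truncatedPotential, hx] using smoothTrunc_le_self hT _

theorem min_le_truncatedPotential {T : ℝ} (hT : 0 ≤ T) (x : EuclideanSpace ℝ (Fin d)) :
    min (g x) 0 ≤ truncatedPotential g T x := by
  by_cases hx : x = 0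
  · simp only [truncatedPotential, hx, if_true]
    have := smoothTrunc_monotone T (show T ≤ T + 1 by linarith)
    rw [smoothTrunc_of_le hT le_rfl] at this
    exact (min_le_right _ _).trans (hT.trans this)
  · simpa only [truncatedPotential, hx, if_false] using min_le_smoothTrunc hT _

theorem tendsto_truncatedPotential {x : EuclideanSpace ℝ (Fin d)} (hx : x ≠ 0) :
    Tendsto (fun n : ℕ => truncatedPotential g n x) atTop (𝓝 (g x)) := by
  refine tendsto_const_nhds.congr' ?_
  filter_upwards [eventually_ge_atTop ⌈|g x|⌉₊] with n hn
  have : g x ≤ n := (le_abs_self _).trans ((Nat.le_ceil _).trans (by exact_mod_cast hn))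
  simp [truncatedPotential, hx, smoothTrunc_of_le n.cast_nonneg this]

theorem exists_lower_bound (hg : AlmostSuperharmonic M g) (R : ℝ) :
    ∃ A : ℝ, 0 ≤ A ∧ ∀ x, x ≠ 0 → ‖x‖ ≤ R → -A ≤ g x := by
  obtain ⟨C, hC⟩ := (isCompact_closedBall (0 : EuclideanSpace ℝ (Fin d)) R).exists_bound_of_continuousOn
    (hg.contDiff_truncatedPotential 0).continuous.continuousOn
  refine ⟨|C|, abs_nonneg _, fun x hx hxR => ?_⟩
  have h1 := (abs_le.1 (hC x (by simpa using hxR))).1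
  have h2 := truncatedPotential_le (g := g) le_rfl hx
  linarith [le_abs_self C]

theorem integral_sphere_truncatedPotential_le (hg : AlmostSuperharmonic M g) (hd : 0 < d) (T : ℝ)
    (x : EuclideanSpace ℝ (Fin d)) {η : ℝ} (hη : 0 < η) :
    Integrable (fun θ : Metric.sphere (0 : EuclideanSpace ℝ (Fin d)) 1 =>
      truncatedPotential g T (x + η • (θ : EuclideanSpace ℝ (Fin d)))) (unitSphereMeasure d) ∧
    ∫ θ, truncatedPotential g T (x + η • (θ : EuclideanSpace ℝ (Fin d))) ∂(unitSphereMeasure d)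
      ≤ truncatedPotential g T x + M / (2 * d) * η ^ 2 := by
  have := nontrivial_euclideanSpace hd
  have := isProbabilityMeasure_unitSphereMeasure hd
  have hc := (hg.contDiff_truncatedPotential T)
  have hi : Integrable (fun θ : Metric.sphere (0 : EuclideanSpace ℝ (Fin d)) 1 =>
      truncatedPotential g T (x + η • (θ : EuclideanSpace ℝ (Fin d)))) (unitSphereMeasure d) := by
    have hcc : Continuous fun θ : Metric.sphere (0 : EuclideanSpace ℝ (Fin d)) 1 =>
      truncatedPotential g T (x + η • (θ : EuclideanSpace ℝ (Fin d))) :=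
      hc.continuous.comp (by fun_prop)
    exact hcc.integrable_of_hasCompactSupport (HasCompactSupport.of_compactSpace _)
  refine ⟨hi, ?_⟩
  have h := integral_sphere_le_of_laplacian_le hc hd (hg.laplacian_truncatedPotential_le T) x hη
  have h2 : ∫ θ, (truncatedPotential g T (x + η • (θ : EuclideanSpace ℝ (Fin d)))
      - truncatedPotential g T x - M / (2 * d) * η ^ 2) ∂(unitSphereMeasure d) ≤ 0 := by
    rw [unitSphereMeasure, integral_smul_measure]
    exact mul_nonpos_of_nonneg_of_nonpos ENNReal.toReal_nonneg h
  simp_rw [sub_sub] at h2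
  rw [integral_sub hi (integrable_const _)] at h2
  simp at h2
  linarith

/-- The smeared values of an almost superharmonic potential are almost below its values. -/
theorem integral_sphere_le (hg : AlmostSuperharmonic M g) (hd : 2 ≤ d)
    {x : EuclideanSpace ℝ (Fin d)} (hx : x ≠ 0) {η : ℝ} (hη : 0 < η) :
    Integrable (fun θ : Metric.sphere (0 : EuclideanSpace ℝ (Fin d)) 1 =>
      g (x + η • (θ : EuclideanSpace ℝ (Fin d)))) (unitSphereMeasure d) ∧
    ∫ θ, g (x + η • (θ : EuclideanSpace ℝ (Fin d))) ∂(unitSphereMeasure d)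
      ≤ g x + M / (2 * d) * η ^ 2 := by
  have := isProbabilityMeasure_unitSphereMeasure (d := d) (by omega)
  obtain ⟨A, hA0, hA⟩ := hg.exists_lower_bound (‖x‖ + η)
  have hne : ∀ᵐ (θ : Metric.sphere (0 : EuclideanSpace ℝ (Fin d)) 1) ∂(unitSphereMeasure d),
      x + η • (θ : EuclideanSpace ℝ (Fin d)) ≠ 0 := by
    have := nullSingletonClass_uniformSphere hd x hη
    have h : ∀ᵐ y ∂(uniformSphere x η), y ≠ 0 := by simp [ae_iff]
    rwa [uniformSphere_eq_map, (measurableEmbedding_add_smul_sphere x hη.ne').ae_map_iff] at h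
  refine integrable_of_tendsto_of_integral_le (A := A)
    (F := fun (n : ℕ) (θ : Metric.sphere (0 : EuclideanSpace ℝ (Fin d)) 1) =>
      truncatedPotential g n (x + η • (θ : EuclideanSpace ℝ (Fin d))))
    (fun n => (hg.integral_sphere_truncatedPotential_le (by omega) n x hη).1) (fun n => ?_)
    (hne.mono fun θ hθ => tendsto_truncatedPotential hθ) fun n => ?_
  · filter_upwards [hne] with θ hθ
    have hn : ‖x + η • (θ : EuclideanSpace ℝ (Fin d))‖ ≤ ‖x‖ + η := by
      refine (norm_add_le _ _).trans ?_
      simp [norm_smul, abs_of_pos hη]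
    exact (le_min (hA _ hθ hn) (by linarith)).trans (min_le_truncatedPotential n.cast_nonneg _)
  · refine (hg.integral_sphere_truncatedPotential_le (by omega) n x hη).2.trans ?_
    linarith [truncatedPotential_le (g := g) (T := n) n.cast_nonneg hx]

/-- Smearing the second variable of an interaction energy almost decreases it. -/
theorem integral_prod_uniformSphere_le (hg : AlmostSuperharmonic M g) (hd : 2 ≤ d)
    {ρ : Measure (EuclideanSpace ℝ (Fin d))} [IsProbabilityMeasure ρ]
    {w : EuclideanSpace ℝ (Fin d)} {R : ℝ} (hρw : ∀ᵐ y ∂ρ, y ≠ w) (hρR : ∀ᵐ y ∂ρ, ‖y‖ ≤ R)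
    (hρg : Integrable (fun y => g (y - w)) ρ) {η : ℝ} (hη : 0 < η) :
    Integrable (fun p : EuclideanSpace ℝ (Fin d) × EuclideanSpace ℝ (Fin d) => g (p.1 - p.2))
      (ρ.prod (uniformSphere w η)) ∧
    ∫ p, g (p.1 - p.2) ∂(ρ.prod (uniformSphere w η))
      ≤ ∫ y, g (y - w) ∂ρ + M / (2 * d) * η ^ 2 := by
  have := isProbabilityMeasure_uniformSphere (d := d) (by omega) w η
  have := nullSingletonClass_uniformSphere hd w hη
  have hdiag := ae_prod_ne ρ (uniformSphere w η)
  have hbd : ∀ᵐ p ∂(ρ.prod (uniformSphere w η)), ‖p.1 - p.2‖ ≤ R + (‖w‖ + η) := by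
    filter_upwards [Measure.quasiMeasurePreserving_fst.ae hρR,
      Measure.quasiMeasurePreserving_snd.ae (ae_uniformSphere (x := w) hη (p := fun y => ‖y - w‖ = η)
        fun y hy => hy)] with p h1 h2
    have h3 : ‖p.2‖ ≤ ‖p.2 - w‖ + ‖w‖ := norm_le_norm_sub_add _ _
    linarith [norm_sub_le p.1 p.2]
  obtain ⟨A, hA0, hA⟩ := hg.exists_lower_bound (R + (‖w‖ + η))
  have hui : ∀ n : ℕ, Integrable (fun p : EuclideanSpace ℝ (Fin d) × EuclideanSpace ℝ (Fin d) =>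
      truncatedPotential g n (p.1 - p.2)) (ρ.prod (uniformSphere w η)) := fun n => by
    have hc := (hg.contDiff_truncatedPotential n).continuous
    obtain ⟨C, hC⟩ := (isCompact_closedBall (0 : EuclideanSpace ℝ (Fin d))
      (R + (‖w‖ + η))).exists_bound_of_continuousOn hc.continuousOn
    have hm : Measurable fun p : EuclideanSpace ℝ (Fin d) × EuclideanSpace ℝ (Fin d) =>
      truncatedPotential g n (p.1 - p.2) := hc.measurable.comp (by fun_prop)
    exact Integrable.of_bound hm.aestronglyMeasurable C
      (hbd.mono fun p hp => hC _ (by simpa using hp))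
  refine integrable_of_tendsto_of_integral_le (A := A)
    (F := fun (n : ℕ) (p : EuclideanSpace ℝ (Fin d) × EuclideanSpace ℝ (Fin d)) =>
      truncatedPotential g n (p.1 - p.2)) hui (fun n => ?_)
    (hdiag.mono fun p hp => tendsto_truncatedPotential (sub_ne_zero.2 hp)) fun n => ?_
  · filter_upwards [hdiag, hbd] with p h1 h2
    exact (le_min (hA _ (sub_ne_zero.2 h1) h2) (by linarith)).trans
      (min_le_truncatedPotential n.cast_nonneg _)
  · rw [integral_prod _ (hui n)]
    have hr : ∫ y, g (y - w) ∂ρ + M / (2 * d) * η ^ 2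
        = ∫ y, (g (y - w) + M / (2 * d) * η ^ 2) ∂ρ := by
      rw [integral_add hρg (integrable_const _)]; simp
    rw [hr]
    refine integral_mono_ae (hui n).integral_prod_left (hρg.add (integrable_const _)) ?_
    filter_upwards [hρw] with y hy
    rw [integral_uniformSphere _ _ hη.ne']
    have h1 := (hg.integral_sphere_truncatedPotential_le (by omega) n (y - w) hη).2
    rw [← integral_unitSphereMeasure_neg
      (fun θ => truncatedPotential g n (y - w + η • θ))] at h1
    have h2 : ∀ θ : EuclideanSpace ℝ (Fin d), y - (w + η • θ) = y - w + η • (-θ) := fun θ => by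
      rw [smul_neg]; abel
    simp only [h2]
    exact h1.trans (by
      linarith [truncatedPotential_le (g := g) (T := n) n.cast_nonneg (sub_ne_zero.2 hy)])

/-- Averages against radial weights are almost below the values. -/
theorem integral_radial_le (hg : AlmostSuperharmonic M g) (hd : 2 ≤ d)
    {x : EuclideanSpace ℝ (Fin d)} (hx : x ≠ 0) {w : ℝ → ℝ} (hw : ∀ r, 0 ≤ w r)
    (hi : Integrable fun y => (g (x + y) - g x - M / (2 * d) * ‖y‖ ^ 2) * w ‖y‖) :
    ∫ y, (g (x + y) - g x - M / (2 * d) * ‖y‖ ^ 2) * w ‖y‖ ≤ 0 := by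
  have := nontrivial_euclideanSpace (d := d) (by omega)
  have := isProbabilityMeasure_unitSphereMeasure (d := d) (by omega)
  refine integral_nonpos_of_sphere hi fun r hr => ?_
  have hn : ∀ θ : Metric.sphere (0 : EuclideanSpace ℝ (Fin d)) 1,
      ‖r • (θ : EuclideanSpace ℝ (Fin d))‖ = r := fun θ => by
    rw [norm_smul]; simp [abs_of_pos hr]
  simp only [hn]
  rw [integral_mul_const]
  refine mul_nonpos_of_nonpos_of_nonneg ?_ (hw r)
  obtain ⟨h1, h2⟩ := hg.integral_sphere_le hd hx hr
  have h3 : ∫ θ : Metric.sphere (0 : EuclideanSpace ℝ (Fin d)) 1,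
      (g (x + r • (θ : EuclideanSpace ℝ (Fin d))) - g x - M / (2 * d) * r ^ 2)
        ∂(unitSphereMeasure d) ≤ 0 := by
    simp_rw [sub_sub]
    rw [integral_sub h1 (integrable_const _)]
    simp only [integral_const, probReal_univ, smul_eq_mul, one_mul]
    linarith
  rw [unitSphereMeasure, integral_smul_measure, smul_eq_mul] at h3
  have h4 : 0 < (((volume : Measure (EuclideanSpace ℝ (Fin d))).toSphere Set.univ)⁻¹).toReal := by
    refine ENNReal.toReal_pos (ENNReal.inv_ne_zero.2 (measure_ne_top _ _)) (ENNReal.inv_ne_top.2 ?_)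
    exact Measure.measure_univ_ne_zero.2 (Measure.toSphere_ne_zero _)
  exact nonpos_of_mul_nonpos_right h3 h4

end AlmostSuperharmonic

/-- The model kernel `|z|^{-s}`, with a logarithm added if `s = 0`. -/
noncomputable def rieszKernel {d : ℕ} (s : ℝ) (z : EuclideanSpace ℝ (Fin d)) : ℝ :=
  1 / ‖z‖ ^ s + logIf (s = 0) ‖z‖

/-- The growth at infinity of the potentials: `log (1 + |z|)` if `s = 0`. -/
noncomputable def logGrowth {d : ℕ} (s : ℝ) (z : EuclideanSpace ℝ (Fin d)) : ℝ :=
  open Classical in if s = 0 then Real.log (1 + ‖z‖) else 0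

section Kernel

open Metric Set

variable {d : ℕ} {s : ℝ}

theorem logIf_nonneg (p : Prop) (r : ℝ) : 0 ≤ logIf p r := by
  unfold logIf; split_ifs <;> positivity

theorem logIf_mul_le (p : Prop) {a b : ℝ} (ha : 0 < a) (hb : 0 < b) :
    logIf p (a * b) ≤ logIf p a + logIf p b := by
  unfold logIf
  split_ifs
  · rw [Real.log_mul ha.ne' hb.ne']; exact abs_add_le _ _
  · simp

theorem measurable_logIf (p : Prop) : Measurable (logIf p) := by
  unfold logIf
  split_ifs
  · fun_prop
  · fun_prop

theorem rieszKernel_nonneg (z : EuclideanSpace ℝ (Fin d)) : 0 ≤ rieszKernel s z :=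
  add_nonneg (by positivity) (logIf_nonneg _ _)

theorem measurable_rieszKernel : Measurable (rieszKernel (d := d) s) := by
  unfold rieszKernel
  exact (measurable_const.div (measurable_norm.pow_const s)).add
    ((measurable_logIf _).comp measurable_norm)

theorem rieszKernel_smul_le {R : ℝ} (hR : 0 < R) {z : EuclideanSpace ℝ (Fin d)} (hz : z ≠ 0) :
    rieszKernel s (R • z) ≤ R ^ (-s) * (1 / ‖z‖ ^ s) + logIf (s = 0) R + logIf (s = 0) ‖z‖ := by
  have hz' := norm_pos_iff.2 hz
  rw [rieszKernel, norm_smul, Real.norm_eq_abs, abs_of_pos hR, Real.mul_rpow hR.le hz'.le,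
    Real.rpow_neg hR.le, add_assoc]
  refine add_le_add (le_of_eq ?_) (logIf_mul_le _ hR hz')
  field_simp

theorem logGrowth_nonneg (z : EuclideanSpace ℝ (Fin d)) : 0 ≤ logGrowth s z := by
  unfold logGrowth
  split_ifs
  · exact Real.log_nonneg (by linarith [norm_nonneg z])
  · exact le_rfl

theorem logGrowth_sub_le (x y : EuclideanSpace ℝ (Fin d)) :
    logGrowth s (x - y) ≤ logGrowth s x + logGrowth s y := by
  unfold logGrowth
  split_ifs
  · have hx := norm_nonneg x
    have hy := norm_nonneg y
    rw [← Real.log_mul (by positivity) (by positivity)]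
    refine Real.log_le_log (by positivity) ?_
    nlinarith [norm_sub_le x y]
  · simp

theorem measurable_logGrowth : Measurable (logGrowth (d := d) s) := by
  unfold logGrowth
  split_ifs <;> fun_prop

theorem logGrowth_le_norm (z : EuclideanSpace ℝ (Fin d)) : logGrowth s z ≤ ‖z‖ := by
  unfold logGrowth
  split_ifs
  · have := Real.log_le_sub_one_of_pos (show 0 < 1 + ‖z‖ by positivity)
    linarith
  · positivity

theorem rieszKernel_le_of_one_le (hs : 0 ≤ s) {z : EuclideanSpace ℝ (Fin d)} (hz : 1 ≤ ‖z‖) :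
    rieszKernel s z ≤ 1 + logGrowth s z := by
  unfold rieszKernel logGrowth logIf
  have h1 : 1 / ‖z‖ ^ s ≤ 1 := by
    rw [div_le_one (by positivity)]
    exact Real.one_le_rpow hz hs
  refine add_le_add h1 ?_
  split_ifs
  · rw [abs_of_nonneg (Real.log_nonneg hz)]
    exact Real.log_le_log (by linarith) (by linarith)
  · exact le_rfl

theorem integrableOn_ball_norm_rpow (hd : 0 < d) {p : ℝ} (hp : p < d) (R : ℝ) :
    IntegrableOn (fun z : EuclideanSpace ℝ (Fin d) => 1 / ‖z‖ ^ p) (ball 0 R) := by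
  have := nontrivial_euclideanSpace hd
  rw [integrableOn_fun_norm_addHaar volume (f := fun r : ℝ => 1 / r ^ p),
    finrank_euclideanSpace_fin]
  rcases le_or_gt R 0 with hR | hR
  · rw [Ioo_eq_empty (by simpa using hR)]; exact integrableOn_empty
  have h := (intervalIntegral.intervalIntegrable_rpow' (a := 0) (b := R) (r := (d : ℝ) - 1 - p)
    (by linarith)).1
  refine (h.mono_set Ioo_subset_Ioc_self).congr_fun (fun r hr => ?_) measurableSet_Ioo
  have hr0 : 0 < r := hr.1
  simp only [smul_eq_mul]
  rw [Real.rpow_sub hr0, ← Real.rpow_natCast, Nat.cast_sub hd, Nat.cast_one]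
  field_simp

theorem integrableOn_ball_logIf (hd : 2 ≤ d) (p : Prop) :
    IntegrableOn (fun z : EuclideanSpace ℝ (Fin d) => logIf p ‖z‖) (ball 0 1) := by
  have hd' : (1 : ℝ) < d := by exact_mod_cast hd
  have hm : Measurable fun z : EuclideanSpace ℝ (Fin d) => logIf p ‖z‖ :=
    (measurable_logIf p).comp measurable_norm
  refine (integrableOn_ball_norm_rpow (by omega) hd' 1).mono' hm.aestronglyMeasurable ?_
  rw [ae_restrict_iff' measurableSet_ball]
  have h0 : ∀ᵐ z : EuclideanSpace ℝ (Fin d), z ≠ 0 := by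
    have := nontrivial_euclideanSpace (d := d) (by omega)
    simp [ae_iff]
  filter_upwards [h0] with z hz hz1
  rw [Real.norm_of_nonneg (logIf_nonneg _ _), Real.rpow_one]
  have hzp : 0 < ‖z‖ := norm_pos_iff.2 hz
  have hz1' : ‖z‖ < 1 := by simpa using hz1
  unfold logIf
  split_ifs
  · rw [abs_of_nonpos (Real.log_nonpos hzp.le hz1'.le), ← Real.log_inv, ← one_div]
    have := Real.log_le_sub_one_of_pos (show 0 < 1 / ‖z‖ by positivity)
    linarith
  · positivity

theorem lintegral_eq_mul_lintegral_comp_smul {f : EuclideanSpace ℝ (Fin d) → ℝ≥0∞}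
    (hf : Measurable f) {R : ℝ} (hR : 0 < R) :
    ∫⁻ z, f z = ENNReal.ofReal (R ^ d) * ∫⁻ z, f (R • z) := by
  have h := Measure.map_addHaar_smul (volume : Measure (EuclideanSpace ℝ (Fin d))) hR.ne'
  rw [← lintegral_map hf (measurable_const_smul R), h, lintegral_smul_measure,
    finrank_euclideanSpace_fin, smul_eq_mul, ← mul_assoc, ← ENNReal.ofReal_mul (by positivity),
    abs_of_pos (by positivity), mul_inv_cancel₀ (by positivity)]
  simp

/-- The integral of the model kernel over balls. -/
theorem exists_lintegral_ball_rieszKernel_le (hd : 2 ≤ d) (hsd : s < d) :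
    ∃ C : ℝ, 0 ≤ C ∧ ∀ R : ℝ, 0 < R →
      ∫⁻ z in ball (0 : EuclideanSpace ℝ (Fin d)) R, ENNReal.ofReal (rieszKernel s z)
        ≤ ENNReal.ofReal (C * (R ^ ((d : ℝ) - s) + R ^ d * logIf (s = 0) R)) := by
  have hd0 : 0 < d := by omega
  have hi1 := integrableOn_ball_norm_rpow hd0 hsd 1
  have hi2 := integrableOn_ball_logIf hd (s = 0)
  set B := ball (0 : EuclideanSpace ℝ (Fin d)) 1
  set I1 := ∫ z in B, 1 / ‖z‖ ^ s
  set I2 := ∫ z in B, logIf (s = 0) ‖z‖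
  set V := volume.real B
  have hI1 : 0 ≤ I1 := integral_nonneg fun z => by positivity
  have hI2 : 0 ≤ I2 := integral_nonneg fun z => logIf_nonneg _ _
  have hV : 0 ≤ V := measureReal_nonneg
  refine ⟨I1 + I2 + V, by positivity, fun R hR => ?_⟩
  have h0 : ∀ᵐ z : EuclideanSpace ℝ (Fin d), z ≠ 0 := by
    have := nontrivial_euclideanSpace hd0
    simp [ae_iff]
  have hlog := logIf_nonneg (s = 0) R
  set f : EuclideanSpace ℝ (Fin d) → ℝ := fun z =>
    R ^ (-s) * (1 / ‖z‖ ^ s) + logIf (s = 0) R + logIf (s = 0) ‖z‖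
  have hf0 : ∀ z, 0 ≤ f z := fun z => by
    have := logIf_nonneg (s = 0) ‖z‖
    positivity
  have hfi : IntegrableOn f B :=
    ((hi1.const_mul _).add (integrableOn_const (measure_ball_lt_top.ne))).add hi2
  have hscale : ∫⁻ z in ball (0 : EuclideanSpace ℝ (Fin d)) R, ENNReal.ofReal (rieszKernel s z)
      = ENNReal.ofReal (R ^ d) * ∫⁻ z in B, ENNReal.ofReal (rieszKernel s (R • z)) := by
    rw [← lintegral_indicator measurableSet_ball, ← lintegral_indicator measurableSet_ball,
      lintegral_eq_mul_lintegral_comp_smul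
        ((measurable_rieszKernel.ennreal_ofReal).indicator measurableSet_ball) hR]
    congr 1
    refine lintegral_congr fun z => ?_
    have hiff : R • z ∈ ball (0 : EuclideanSpace ℝ (Fin d)) R ↔ z ∈ B := by
      simp only [B, mem_ball_zero_iff, norm_smul, Real.norm_eq_abs, abs_of_pos hR]
      exact mul_lt_iff_lt_one_right hR
    by_cases hz : z ∈ B
    · rw [indicator_of_mem hz, indicator_of_mem (hiff.2 hz)]
    · rw [indicator_of_notMem hz, indicator_of_notMem (fun h => hz (hiff.1 h))]
  calc ∫⁻ z in ball (0 : EuclideanSpace ℝ (Fin d)) R, ENNReal.ofReal (rieszKernel s z)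
      = ENNReal.ofReal (R ^ d) * ∫⁻ z in B, ENNReal.ofReal (rieszKernel s (R • z)) := hscale
    _ ≤ ENNReal.ofReal (R ^ d) * ∫⁻ z in B, ENNReal.ofReal (f z) := by
        refine mul_le_mul_right (lintegral_mono_ae (ae_restrict_of_ae (h0.mono fun z hz => ?_))) _
        exact ENNReal.ofReal_le_ofReal (rieszKernel_smul_le hR hz)
    _ = ENNReal.ofReal (R ^ d * ∫ z in B, f z) := by
        rw [← ofReal_integral_eq_lintegral_ofReal hfi (ae_of_all _ hf0),
          ENNReal.ofReal_mul (by positivity)]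
    _ ≤ _ := by
        refine ENNReal.ofReal_le_ofReal ?_
        have hint : ∫ z in B, f z = R ^ (-s) * I1 + logIf (s = 0) R * V + I2 := by
          have hic : IntegrableOn (fun _ : EuclideanSpace ℝ (Fin d) => logIf (s = 0) R) B :=
            integrableOn_const measure_ball_lt_top.ne
          have hi12 : IntegrableOn (fun z => R ^ (-s) * (1 / ‖z‖ ^ s) + logIf (s = 0) R) B :=
            (hi1.const_mul _).add hic
          rw [integral_add hi12 hi2, integral_add (hi1.const_mul _) hic,
            integral_const_mul, setIntegral_const, smul_eq_mul, mul_comm V]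
        have hRd : R ^ d * R ^ (-s) = R ^ ((d : ℝ) - s) := by
          rw [← Real.rpow_natCast, ← Real.rpow_add hR, sub_eq_add_neg]
        have hRd0 : 0 ≤ R ^ ((d : ℝ) - s) := by positivity
        have hI2' : R ^ d * I2 ≤ I2 * R ^ ((d : ℝ) - s) := by
          by_cases h : s = 0
          · rw [h, sub_zero, Real.rpow_natCast, mul_comm]
          · have : I2 = 0 := by simp [I2, logIf, h]
            simp [this]
        rw [hint]
        have e1 : R ^ d * (R ^ (-s) * I1 + logIf (s = 0) R * V + I2)
            = I1 * R ^ ((d : ℝ) - s) + R ^ d * logIf (s = 0) R * V + R ^ d * I2 := by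
          rw [← hRd]; ring
        rw [e1]
        have e2 : 0 ≤ R ^ d * logIf (s = 0) R := by positivity
        nlinarith [mul_nonneg hV hRd0, mul_nonneg hI1 e2, mul_nonneg hI2 e2]

/-- The integral of `|z|^{-s-2}` over annuli. -/
theorem exists_lintegral_annulus_le (hd : 2 ≤ d) (hsd : s ≤ (d : ℝ) - 2) {r₀ : ℝ} (hr₀ : 0 < r₀) :
    ∃ C : ℝ, 0 ≤ C ∧ ∀ η : ℝ, 0 < η → 2 * η < r₀ →
      ∫⁻ z in {z : EuclideanSpace ℝ (Fin d) | 2 * η ≤ ‖z‖ ∧ ‖z‖ < r₀},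
        ENNReal.ofReal (1 / ‖z‖ ^ (s + 2))
        ≤ ENNReal.ofReal (C * (1 + logIf (s = (d : ℝ) - 2) η)) := by
  have hd0 : 0 < d := by omega
  have := nontrivial_euclideanSpace hd0
  rcases hsd.lt_or_eq with hlt | heq
  · have hi := integrableOn_ball_norm_rpow hd0 (show s + 2 < d by linarith) r₀
    refine ⟨∫ z in ball (0 : EuclideanSpace ℝ (Fin d)) r₀, 1 / ‖z‖ ^ (s + 2),
      integral_nonneg fun z => by positivity, fun η hη hηr => ?_⟩
    have : logIf (s = (d : ℝ) - 2) η = 0 := by simp [logIf, hlt.ne]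
    rw [this, add_zero, mul_one, ofReal_integral_eq_lintegral_ofReal hi
      (ae_of_all _ fun z => by simp only [Pi.zero_apply]; positivity)]
    exact lintegral_mono_set fun z hz => by simpa using hz.2
  · set V := (d : ℝ) * volume.real (ball (0 : EuclideanSpace ℝ (Fin d)) 1)
    have hV : 0 ≤ V := by positivity
    refine ⟨V * (1 + |Real.log (r₀ / 2)|), by positivity, fun η hη hηr => ?_⟩
    set F : ℝ → ℝ := (Ico (2 * η) r₀).indicator fun r => 1 / r ^ (s + 2)
    have hset : {z : EuclideanSpace ℝ (Fin d) | 2 * η ≤ ‖z‖ ∧ ‖z‖ < r₀}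
        = (fun z => ‖z‖) ⁻¹' Ico (2 * η) r₀ := rfl
    have hms : MeasurableSet {z : EuclideanSpace ℝ (Fin d) | 2 * η ≤ ‖z‖ ∧ ‖z‖ < r₀} :=
      measurable_norm measurableSet_Ico
    have hF0 : ∀ r, 0 ≤ F r := fun r => indicator_nonneg (fun r hr => by
      have : 0 ≤ r := by linarith [hr.1]
      positivity) r
    have hprod : ∀ r ∈ Ioi (0 : ℝ), r ^ (d - 1) • F r = (Ico (2 * η) r₀).indicator (fun r => r⁻¹) r := by
      intro r hr
      have hr0 : (0 : ℝ) < r := hr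
      by_cases h : r ∈ Ico (2 * η) r₀
      · rw [indicator_of_mem h]
        simp only [F, indicator_of_mem h, smul_eq_mul]
        have : s + 2 = ((d - 1 + 1 : ℕ) : ℝ) := by
          rw [Nat.sub_add_cancel (by omega)]; linarith
        rw [this, Real.rpow_natCast, pow_succ]
        field_simp
      · simp only [F, indicator_of_notMem h, smul_zero]
    have hiInv : IntegrableOn (fun r : ℝ => r⁻¹) (Ico (2 * η) r₀) := by
      refine IntegrableOn.mono_set (ContinuousOn.integrableOn_Icc ?_) Ico_subset_Icc_self
      exact continuousOn_inv₀.mono fun r hr => (show (0 : ℝ) < r by linarith [hr.1]).ne'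
    have hFi : Integrable (fun z : EuclideanSpace ℝ (Fin d) => F ‖z‖) := by
      rw [integrable_fun_norm_addHaar, finrank_euclideanSpace_fin]
      refine IntegrableOn.congr_fun ?_ (fun r hr => (hprod r hr).symm) measurableSet_Ioi
      exact ((integrable_indicator_iff measurableSet_Ico).2 hiInv).integrableOn
    have hinter : Ioi (0 : ℝ) ∩ Ico (2 * η) r₀ = Ico (2 * η) r₀ :=
      inter_eq_right.2 fun r hr => lt_of_lt_of_le (by linarith) hr.1
    have hval : ∫ z : EuclideanSpace ℝ (Fin d), F ‖z‖ = V * Real.log (r₀ / (2 * η)) := by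
      rw [integral_fun_norm_addHaar, finrank_euclideanSpace_fin,
        setIntegral_congr_fun measurableSet_Ioi hprod, setIntegral_indicator measurableSet_Ico,
        hinter,
        integral_Ico_eq_integral_Ioc, ← intervalIntegral.integral_of_le hηr.le,
        integral_inv_of_pos (by linarith) hr₀]
      simp [V, mul_assoc]
    have hlhs : ∫⁻ z in {z : EuclideanSpace ℝ (Fin d) | 2 * η ≤ ‖z‖ ∧ ‖z‖ < r₀},
        ENNReal.ofReal (1 / ‖z‖ ^ (s + 2)) = ∫⁻ z : EuclideanSpace ℝ (Fin d), ENNReal.ofReal (F ‖z‖) := by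
      rw [← lintegral_indicator hms]
      refine lintegral_congr fun z => ?_
      by_cases h : z ∈ {z : EuclideanSpace ℝ (Fin d) | 2 * η ≤ ‖z‖ ∧ ‖z‖ < r₀}
      · rw [indicator_of_mem h]
        simp only [F]
        rw [indicator_of_mem (show ‖z‖ ∈ Ico (2 * η) r₀ from h)]
      · rw [indicator_of_notMem h]
        simp only [F]
        rw [indicator_of_notMem (show ‖z‖ ∉ Ico (2 * η) r₀ from h)]
        simp
    rw [hlhs, ← ofReal_integral_eq_lintegral_ofReal hFi (ae_of_all _ fun z => hF0 _), hval]
    refine ENNReal.ofReal_le_ofReal ?_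
    have hl : Real.log (r₀ / (2 * η)) = Real.log (r₀ / 2) - Real.log η := by
      rw [← Real.log_div (by positivity) hη.ne']
      congr 1
      field_simp
    have hli : logIf (s = (d : ℝ) - 2) η = |Real.log η| := by simp [logIf, heq]
    rw [hl, hli, mul_assoc V]
    refine mul_le_mul_of_nonneg_left ?_ hV
    have a1 := le_abs_self (Real.log (r₀ / 2))
    have a2 := neg_abs_le (Real.log η)
    nlinarith [abs_nonneg (Real.log η), abs_nonneg (Real.log (r₀ / 2))]

end Kernel

section Density

variable {d : ℕ}

theorem lintegral_le_densitySup_mul {μ : Measure (EuclideanSpace ℝ (Fin d))} [SigmaFinite μ]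
    (hμ : μ ≪ volume) (f : EuclideanSpace ℝ (Fin d) → ℝ≥0∞) :
    ∫⁻ y, f y ∂μ ≤ densitySup μ * ∫⁻ y, f y := by
  have hle : μ ≤ densitySup μ • volume := by
    rw [← withDensity_const]
    calc μ = volume.withDensity (μ.rnDeriv volume) :=
          (Measure.withDensity_rnDeriv_eq μ volume hμ).symm
      _ ≤ _ := withDensity_mono (ENNReal.ae_le_essSup _)
  calc ∫⁻ y, f y ∂μ ≤ ∫⁻ y, f y ∂(densitySup μ • volume) := lintegral_mono' hle le_rfl
    _ = _ := by rw [lintegral_smul_measure, smul_eq_mul]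

end Density

/-- Almost superharmonic even potentials with a Riesz-type bound on the values and on the second
derivatives. -/
structure TamePotential {d : ℕ} (s M A L : ℝ) (g : EuclideanSpace ℝ (Fin d) → ℝ) : Prop
    extends AlmostSuperharmonic M g where
  even : ∀ x, x ≠ 0 → g x = g (-x)
  nonneg_left : 0 ≤ A
  nonneg_right : 0 ≤ L
  abs_bound : ∀ x, x ≠ 0 → |g x| ≤ A * rieszKernel s x
  hessian_le : ∀ x, x ≠ 0 → ‖iteratedFDeriv ℝ 2 g x‖ ≤ L / ‖x‖ ^ (s + 2)

section

variable {d : ℕ} {s M A L : ℝ} {g : EuclideanSpace ℝ (Fin d) → ℝ}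

theorem RieszTypePotential.tame {r₀ : ℝ} {K : ℕ → ℝ} {B C₁ C₂ cs c₀ : ℝ}
    (hg : RieszTypePotential d s r₀ K B C₁ C₂ cs c₀ g) (hs : 0 ≤ s) (hr₀ : 0 < r₀) :
    TamePotential s (d * (|K 2| / r₀ ^ (s + 2))) |K 0| |K 2| g := by
  have hess : ∀ x, x ≠ 0 → ‖iteratedFDeriv ℝ 2 g x‖ ≤ |K 2| / ‖x‖ ^ (s + 2) := fun x hx => by
    have h := hg.deriv_bound 2 x hx
    have h0 : logIf (s = 0 ∧ 2 = 0) ‖x‖ = 0 := by simp [logIf]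
    rw [h0, add_zero, mul_one_div] at h
    exact h.trans (by push_cast; gcongr; exact le_abs_self _)
  refine { nonneg := by positivity, smooth := hg.smooth, tendsto_zero := hg.tendsto_zero,
           laplacian_le := fun x hx => ?_, even := hg.even, nonneg_left := abs_nonneg _,
           nonneg_right := abs_nonneg _, abs_bound := fun x hx => ?_, hessian_le := hess }
  · rcases lt_or_ge ‖x‖ r₀ with h | h
    · exact (hg.superharmonic.laplacian_nonpos hg.smooth hx h).trans (by positivity)
    · refine (le_abs_self _).trans ((abs_laplacian_le g x).trans ?_)
      refine mul_le_mul_of_nonneg_left ((hess x hx).trans ?_) (Nat.cast_nonneg d)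
      gcongr
  · have h := hg.deriv_bound 0 x hx
    simp only [norm_iteratedFDeriv_zero, Real.norm_eq_abs, CharP.cast_eq_zero, add_zero,
      and_true] at h
    exact h.trans (mul_le_mul_of_nonneg_right (le_abs_self _) (rieszKernel_nonneg x))

theorem ae_add_smul_ne_zero (hd : 2 ≤ d) (x : EuclideanSpace ℝ (Fin d)) {η : ℝ} (hη : 0 < η) :
    ∀ᵐ (θ : Metric.sphere (0 : EuclideanSpace ℝ (Fin d)) 1) ∂(unitSphereMeasure d),
      x + η • (θ : EuclideanSpace ℝ (Fin d)) ≠ 0 := by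
  have := nullSingletonClass_uniformSphere hd x hη
  have h : ∀ᵐ y ∂(uniformSphere x η), y ≠ 0 := by simp [ae_iff]
  rwa [uniformSphere_eq_map, (measurableEmbedding_add_smul_sphere x hη.ne').ae_map_iff] at h

namespace TamePotential

/-- The second difference of a tame potential away from the origin. -/
theorem two_mul_le (hg : TamePotential s M A L g) (hs : 0 ≤ s) {z v : EuclideanSpace ℝ (Fin d)}
    {η : ℝ} (hη : 0 < η) (hz : 2 * η ≤ ‖z‖) (hv : ‖v‖ = 1) :
    2 * g z ≤ g (z + η • v) + g (z - η • v) + η ^ 2 * (L * 2 ^ (s + 2) / ‖z‖ ^ (s + 2)) := by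
  set Λ := L * 2 ^ (s + 2) / ‖z‖ ^ (s + 2)
  have hz0 : 0 < ‖z‖ := by linarith
  have hlow : ∀ t ∈ Set.Icc (-η) η, ‖z‖ / 2 ≤ ‖z + t • v‖ := fun t ht => by
    have h1 : ‖z‖ ≤ ‖z + t • v‖ + ‖t • v‖ := norm_le_add_norm_add _ _
    rw [norm_smul, hv, mul_one, Real.norm_eq_abs] at h1
    linarith [abs_le.2 ht]
  have hne : ∀ t ∈ Set.Icc (-η) η, z + t • v ≠ 0 := fun t ht =>
    norm_pos_iff.1 (lt_of_lt_of_le (by linarith) (hlow t ht))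
  have hline : ∀ t : ℝ, HasDerivAt (fun t : ℝ => z + t • v) v t := fun t => by
    simpa using ((hasDerivAt_id t).smul_const v).const_add z
  have hp1 : ∀ t ∈ Set.Icc (-η) η,
      HasDerivAt (fun t : ℝ => g (z + t • v)) (fderiv ℝ g (z + t • v) v) t := fun t ht =>
    ((hg.contDiffAt (hne t ht)).differentiableAt (by norm_num)).hasFDerivAt.comp_hasDerivAt t
      (hline t)
  have hp2 : ∀ t ∈ Set.Icc (-η) η, HasDerivAt (fun t : ℝ => fderiv ℝ g (z + t • v) v)
      (iteratedFDeriv ℝ 2 g (z + t • v) ![v, v]) t := fun t ht => by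
    have h1 : DifferentiableAt ℝ (fderiv ℝ g) (z + t • v) :=
      ((hg.contDiffAt (hne t ht)).fderiv_right (m := 1) le_rfl).differentiableAt (by norm_num)
    have h2 := h1.hasFDerivAt.comp_hasDerivAt t (hline t)
    have h3 := h2.clm_apply (hasDerivAt_const t v)
    rw [iteratedFDeriv_two_apply]
    simpa using h3
  have hbound : ∀ t ∈ Set.Icc (-η) η, -Λ ≤ iteratedFDeriv ℝ 2 g (z + t • v) ![v, v] := by
    intro t ht
    have h1 := (iteratedFDeriv ℝ 2 g (z + t • v)).le_opNorm ![v, v]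
    simp only [Fin.prod_univ_two, Matrix.cons_val_zero, Matrix.cons_val_one, hv, mul_one,
      Real.norm_eq_abs] at h1
    have h2 := hg.hessian_le _ (hne t ht)
    have h3 : L / ‖z + t • v‖ ^ (s + 2) ≤ Λ := by
      have : Λ = L / (‖z‖ / 2) ^ (s + 2) := by
        rw [Real.div_rpow hz0.le (by norm_num)]
        simp only [Λ]
        field_simp
      rw [this]
      have := hg.nonneg_right
      gcongr
      exact hlow t ht
    linarith [(abs_le.1 (h1.trans (h2.trans h3))).1]
  have hq1 : ∀ t ∈ Set.Icc (-η) η, HasDerivAt (fun t : ℝ => g (z + t • v) + Λ / 2 * t ^ 2)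
      (fderiv ℝ g (z + t • v) v + Λ * t) t := fun t ht => by
    refine ((hp1 t ht).add (((hasDerivAt_pow 2 t).const_mul (Λ / 2)))).congr_deriv ?_
    simp; ring
  have hq2 : ∀ t ∈ Set.Icc (-η) η, HasDerivAt (fun t : ℝ => fderiv ℝ g (z + t • v) v + Λ * t)
      (iteratedFDeriv ℝ 2 g (z + t • v) ![v, v] + Λ) t := fun t ht => by
    refine ((hp2 t ht).add ((hasDerivAt_id t).const_mul Λ)).congr_deriv (by simp)
  have hconv : ConvexOn ℝ (Set.Icc (-η) η) (fun t : ℝ => g (z + t • v) + Λ / 2 * t ^ 2) := by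
    refine convexOn_of_hasDerivWithinAt2_nonneg (convex_Icc _ _)
      (fun t ht => (hq1 t ht).continuousAt.continuousWithinAt)
      (fun t ht => (hq1 t (interior_subset ht)).hasDerivWithinAt)
      (fun t ht => (hq2 t (interior_subset ht)).hasDerivWithinAt) fun t ht => ?_
    linarith [hbound t (interior_subset ht)]
  have hm1 : -η ∈ Set.Icc (-η) η := ⟨le_rfl, by linarith⟩
  have hm2 : η ∈ Set.Icc (-η) η := ⟨by linarith, le_rfl⟩
  have h := hconv.2 hm1 hm2 (show (0 : ℝ) ≤ 1 / 2 by norm_num) (show (0 : ℝ) ≤ 1 / 2 by norm_num)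
    (by norm_num)
  simp only [smul_eq_mul, neg_smul] at h
  have h0 : (1 / 2 : ℝ) * -η + 1 / 2 * η = 0 := by ring
  rw [h0, zero_smul, add_zero, ← sub_eq_add_neg] at h
  nlinarith

/-- Away from the origin a tame potential is close to its spherical means. -/
theorem sub_integral_sphere_le (hg : TamePotential s M A L g) (hd : 2 ≤ d) (hs : 0 ≤ s)
    {z : EuclideanSpace ℝ (Fin d)} {η : ℝ} (hη : 0 < η) (hz : 2 * η ≤ ‖z‖) :
    g z - ∫ θ, g (z + η • (θ : EuclideanSpace ℝ (Fin d))) ∂(unitSphereMeasure d)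
      ≤ L * 2 ^ (s + 2) * (η ^ 2 * (1 / ‖z‖ ^ (s + 2))) := by
  have := isProbabilityMeasure_unitSphereMeasure (d := d) (by omega)
  have hz0 : z ≠ 0 := norm_pos_iff.1 (by linarith)
  have hi : ∀ ε : ℝ, |ε| = 1 → Integrable (fun θ : Metric.sphere (0 : EuclideanSpace ℝ (Fin d)) 1 =>
      g (z + ε • η • (θ : EuclideanSpace ℝ (Fin d)))) (unitSphereMeasure d) := fun ε hε => by
    refine Continuous.integrable_of_hasCompactSupport (continuous_iff_continuousAt.2 fun θ => ?_)
      (HasCompactSupport.of_compactSpace _)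
    have hne : z + ε • η • (θ : EuclideanSpace ℝ (Fin d)) ≠ 0 := fun h => by
      have h1 := congrArg norm (eq_neg_of_add_eq_zero_left h)
      rw [norm_neg, norm_smul, norm_smul, Real.norm_eq_abs, hε, Real.norm_of_nonneg hη.le] at h1
      simp at h1
      linarith
    exact ContinuousAt.comp (g := g) (hg.continuousAt hne) (by fun_prop)
  have hip := hi 1 (by simp)
  have hin := hi (-1) (by simp)
  simp only [one_smul, neg_smul, ← sub_eq_add_neg] at hip hin
  have hneg := integral_unitSphereMeasure_neg (d := d) (fun θ => g (z + η • θ))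
  simp only [smul_neg, ← sub_eq_add_neg] at hneg
  set Λ := η ^ 2 * (L * 2 ^ (s + 2) / ‖z‖ ^ (s + 2)) with hΛ
  have h : ∫ _θ : Metric.sphere (0 : EuclideanSpace ℝ (Fin d)) 1, 2 * g z ∂(unitSphereMeasure d)
      ≤ ∫ θ : Metric.sphere (0 : EuclideanSpace ℝ (Fin d)) 1,
        (g (z + η • (θ : EuclideanSpace ℝ (Fin d)))
        + g (z - η • (θ : EuclideanSpace ℝ (Fin d))) + Λ) ∂(unitSphereMeasure d) :=
    integral_mono (integrable_const _) ((hip.add hin).add (integrable_const _)) fun θ =>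
      hg.two_mul_le hs hη hz (by simp)
  have hadd : Integrable (fun θ : Metric.sphere (0 : EuclideanSpace ℝ (Fin d)) 1 =>
      g (z + η • (θ : EuclideanSpace ℝ (Fin d))) + g (z - η • (θ : EuclideanSpace ℝ (Fin d))))
      (unitSphereMeasure d) := hip.add hin
  rw [integral_add hadd (integrable_const _), integral_add hip hin, hneg] at h
  simp only [integral_const, probReal_univ, smul_eq_mul, one_mul] at h
  have hΛ' : Λ = L * 2 ^ (s + 2) * (η ^ 2 * (1 / ‖z‖ ^ (s + 2))) := by rw [hΛ]; ring
  have : 0 ≤ Λ := by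
    have := hg.nonneg_right
    positivity
  linarith

theorem ofReal_sub_integral_sphere_le (hg : TamePotential s M A L g) (hd : 2 ≤ d) (hs : 0 ≤ s)
    {z : EuclideanSpace ℝ (Fin d)} (hz : z ≠ 0) {η r₀ : ℝ} (hη : 0 < η) (hr₀ : 2 * η < r₀) :
    ENNReal.ofReal (g z - ∫ θ, g (z + η • (θ : EuclideanSpace ℝ (Fin d))) ∂(unitSphereMeasure d))
      ≤ (Metric.ball 0 (2 * η)).indicator (fun z => ENNReal.ofReal A *
          (ENNReal.ofReal (rieszKernel s z) + ∫⁻ θ : Metric.sphere (0 : EuclideanSpace ℝ (Fin d)) 1,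
          ENNReal.ofReal (rieszKernel s (z + η • (θ : EuclideanSpace ℝ (Fin d))))
          ∂(unitSphereMeasure d))) z
        + {z : EuclideanSpace ℝ (Fin d) | 2 * η ≤ ‖z‖ ∧ ‖z‖ < r₀}.indicator
          (fun z => ENNReal.ofReal (L * 2 ^ (s + 2) * η ^ 2) *
            ENNReal.ofReal (1 / ‖z‖ ^ (s + 2))) z
        + ENNReal.ofReal (L * 2 ^ (s + 2) * (1 / r₀ ^ (s + 2)) * η ^ 2) := by
  have hL := hg.nonneg_right
  have hA := hg.nonneg_left
  rcases lt_or_ge ‖z‖ (2 * η) with h | h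
  · rw [Set.indicator_of_mem (by simpa using h), add_assoc]
    refine le_add_right ?_
    have h1 : ENNReal.ofReal (-∫ θ, g (z + η • (θ : EuclideanSpace ℝ (Fin d)))
        ∂(unitSphereMeasure d)) ≤ ENNReal.ofReal A *
        ∫⁻ θ : Metric.sphere (0 : EuclideanSpace ℝ (Fin d)) 1,
          ENNReal.ofReal (rieszKernel s (z + η • (θ : EuclideanSpace ℝ (Fin d))))
          ∂(unitSphereMeasure d) := by
      calc ENNReal.ofReal (-∫ θ, g (z + η • (θ : EuclideanSpace ℝ (Fin d))) ∂(unitSphereMeasure d))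
          ≤ ‖∫ θ, g (z + η • (θ : EuclideanSpace ℝ (Fin d))) ∂(unitSphereMeasure d)‖ₑ := by
            rw [← ofReal_norm]
            exact ENNReal.ofReal_le_ofReal (neg_le_abs _)
        _ ≤ ∫⁻ θ : Metric.sphere (0 : EuclideanSpace ℝ (Fin d)) 1,
            ‖g (z + η • (θ : EuclideanSpace ℝ (Fin d)))‖ₑ ∂(unitSphereMeasure d) :=
            enorm_integral_le_lintegral_enorm _
        _ ≤ ∫⁻ θ : Metric.sphere (0 : EuclideanSpace ℝ (Fin d)) 1, ENNReal.ofReal A *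
            ENNReal.ofReal (rieszKernel s (z + η • (θ : EuclideanSpace ℝ (Fin d))))
            ∂(unitSphereMeasure d) := by
            refine lintegral_mono_ae ((ae_add_smul_ne_zero hd z hη).mono fun θ hθ => ?_)
            rw [← ofReal_norm, ← ENNReal.ofReal_mul hA]
            exact ENNReal.ofReal_le_ofReal (hg.abs_bound _ hθ)
        _ = _ := lintegral_const_mul' _ _ ENNReal.ofReal_ne_top
    rw [sub_eq_add_neg, mul_add]
    refine ENNReal.ofReal_add_le.trans (add_le_add ?_ h1)
    rw [← ENNReal.ofReal_mul hA]
    exact ENNReal.ofReal_le_ofReal ((le_abs_self _).trans (hg.abs_bound z hz))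
  · have h1 := hg.sub_integral_sphere_le hd hs hη h
    rcases lt_or_ge ‖z‖ r₀ with h2 | h2
    · rw [Set.indicator_of_mem (show z ∈ {z : EuclideanSpace ℝ (Fin d) |
        2 * η ≤ ‖z‖ ∧ ‖z‖ < r₀} from ⟨h, h2⟩)]
      refine le_add_right (le_add_left ?_)
      rw [← ENNReal.ofReal_mul (by positivity)]
      exact ENNReal.ofReal_le_ofReal (h1.trans_eq (by ring))
    · refine le_add_left (ENNReal.ofReal_le_ofReal (h1.trans ?_))
      have : 1 / ‖z‖ ^ (s + 2) ≤ 1 / r₀ ^ (s + 2) := by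
        have : 0 < r₀ := by linarith
        gcongr
      calc L * 2 ^ (s + 2) * (η ^ 2 * (1 / ‖z‖ ^ (s + 2)))
          ≤ L * 2 ^ (s + 2) * (η ^ 2 * (1 / r₀ ^ (s + 2))) := by gcongr
        _ = _ := by ring

end TamePotential

end

section

open Metric Set

variable {d : ℕ} {s M A L : ℝ} {g : EuclideanSpace ℝ (Fin d) → ℝ}

theorem isProbabilityMeasure_unitSphereMeasure_of_two_le (hd : 2 ≤ d) :
    IsProbabilityMeasure (unitSphereMeasure d) :=
  isProbabilityMeasure_unitSphereMeasure (by omega)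

theorem lintegral_ball_smeared_rieszKernel_le (hd : 2 ≤ d) {η : ℝ} (hη : 0 < η) :
    ∫⁻ z in ball (0 : EuclideanSpace ℝ (Fin d)) (2 * η),
      ∫⁻ θ : sphere (0 : EuclideanSpace ℝ (Fin d)) 1,
        ENNReal.ofReal (rieszKernel s (z + η • (θ : EuclideanSpace ℝ (Fin d))))
        ∂(unitSphereMeasure d)
      ≤ ∫⁻ z in ball (0 : EuclideanSpace ℝ (Fin d)) (3 * η), ENNReal.ofReal (rieszKernel s z) := by
  have := isProbabilityMeasure_unitSphereMeasure_of_two_le hd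
  have hm : Measurable fun p : EuclideanSpace ℝ (Fin d) × sphere (0 : EuclideanSpace ℝ (Fin d)) 1 =>
      ENNReal.ofReal (rieszKernel s (p.1 + η • (p.2 : EuclideanSpace ℝ (Fin d)))) :=
    (measurable_rieszKernel.comp (by fun_prop)).ennreal_ofReal
  rw [lintegral_lintegral_swap hm.aemeasurable]
  calc _ ≤ ∫⁻ _θ : sphere (0 : EuclideanSpace ℝ (Fin d)) 1,
        (∫⁻ z in ball (0 : EuclideanSpace ℝ (Fin d)) (3 * η), ENNReal.ofReal (rieszKernel s z))
        ∂(unitSphereMeasure d) := by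
        refine lintegral_mono fun θ => ?_
        rw [← lintegral_indicator measurableSet_ball, ← lintegral_indicator measurableSet_ball,
          ← lintegral_add_right_eq_self ((ball (0 : EuclideanSpace ℝ (Fin d)) (3 * η)).indicator _)
            (η • (θ : EuclideanSpace ℝ (Fin d)))]
        refine lintegral_mono fun z => ?_
        by_cases hz : z ∈ ball (0 : EuclideanSpace ℝ (Fin d)) (2 * η)
        · rw [indicator_of_mem hz, indicator_of_mem]
          rw [mem_ball_zero_iff] at hz ⊢
          have h1 : ‖η • (θ : EuclideanSpace ℝ (Fin d))‖ = η := by simp [norm_smul, abs_of_pos hη]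
          linarith [norm_add_le z (η • (θ : EuclideanSpace ℝ (Fin d)))]
        · rw [indicator_of_notMem hz]; exact zero_le
    _ = _ := by simp

/-- The error made by smearing the interaction of a point charge with a bounded density. -/
theorem exists_integral_sub_smeared_le (hd : 2 ≤ d) (hs : 0 ≤ s) (hsd : s ≤ (d : ℝ) - 2)
    {r₀ : ℝ} (hr₀ : 0 < r₀) (hA : 0 ≤ A) (hL : 0 ≤ L) : ∃ C : ℝ, 0 ≤ C ∧
      ∀ g : EuclideanSpace ℝ (Fin d) → ℝ, TamePotential s M A L g →
      ∀ μ : Measure (EuclideanSpace ℝ (Fin d)), IsProbabilityMeasure μ → μ ≪ volume →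
        densitySup μ ≠ ⊤ → ∀ (x : EuclideanSpace ℝ (Fin d)) (η : ℝ), 0 < η → η < r₀ / 2 →
        ∫ y, (g (y - x) - ∫ θ, g (y - x + η • (θ : EuclideanSpace ℝ (Fin d)))
          ∂(unitSphereMeasure d)) ∂μ
          ≤ C * η ^ 2 + C * ((densitySup μ).toReal * smearingError d s η) := by
  have hsd' : s < d := by linarith
  obtain ⟨C₁, hC₁, h₁⟩ := exists_lintegral_ball_rieszKernel_le hd hsd'
  obtain ⟨C₂, hC₂, h₂⟩ := exists_lintegral_annulus_le hd hsd hr₀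
  set a := L * 2 ^ (s + 2)
  have ha : 0 ≤ a := by positivity
  set e := (d : ℝ) - s
  have he : 0 < e := by simp only [e]; linarith
  set D1 := A * (2 * C₁) * (3 ^ e + 3 ^ d * (1 + Real.log 3))
  have hlog3 : 0 ≤ Real.log 3 := Real.log_nonneg (by norm_num)
  have hD1 : 0 ≤ D1 := by positivity
  refine ⟨D1 + a * C₂ + a * (1 / r₀ ^ (s + 2)), by positivity, fun g hg μ _ hμ hμd x η hη hηr => ?_⟩
  have := isProbabilityMeasure_unitSphereMeasure_of_two_le hd
  set D := densitySup μ with hD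
  have hμ0 : ∀ᵐ y ∂μ, y - x ≠ 0 := by
    have := nontrivial_euclideanSpace (d := d) (by omega)
    have h0 : ∀ᵐ y : EuclideanSpace ℝ (Fin d), y ≠ x := by simp [ae_iff]
    have h1 : ∀ᵐ y ∂μ, y ≠ x := hμ.ae_le h0
    exact h1.mono fun y hy => sub_ne_zero.2 hy
  set err := smearingError d s η with herr
  have hlogs := logIf_nonneg (s = 0) η
  have hlogd := logIf_nonneg (s = (d : ℝ) - 2) η
  have herr0 : 0 ≤ err := by
    simp only [err, smearingError]
    split_ifs <;> positivity
  -- the volume integral of the pointwise bound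
  set f1 : EuclideanSpace ℝ (Fin d) → ℝ≥0∞ := (ball 0 (2 * η)).indicator (fun z => ENNReal.ofReal A *
          (ENNReal.ofReal (rieszKernel s z) + ∫⁻ θ : sphere (0 : EuclideanSpace ℝ (Fin d)) 1,
          ENNReal.ofReal (rieszKernel s (z + η • (θ : EuclideanSpace ℝ (Fin d))))
          ∂(unitSphereMeasure d))) with hf1
  set f2 : EuclideanSpace ℝ (Fin d) → ℝ≥0∞ :=
    {z : EuclideanSpace ℝ (Fin d) | 2 * η ≤ ‖z‖ ∧ ‖z‖ < r₀}.indicator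
          (fun z => ENNReal.ofReal (a * η ^ 2) * ENNReal.ofReal (1 / ‖z‖ ^ (s + 2))) with hf2
  have hms : MeasurableSet {z : EuclideanSpace ℝ (Fin d) | 2 * η ≤ ‖z‖ ∧ ‖z‖ < r₀} :=
    measurable_norm measurableSet_Ico
  have hI1 : ∫⁻ z, f1 z ≤ ENNReal.ofReal (D1 * err) := by
    have hmk : Measurable fun z : EuclideanSpace ℝ (Fin d) => ENNReal.ofReal (rieszKernel s z) :=
      measurable_rieszKernel.ennreal_ofReal
    rw [hf1, lintegral_indicator measurableSet_ball, lintegral_const_mul' _ _ ENNReal.ofReal_ne_top,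
      lintegral_add_left hmk]
    have hb := h₁ (3 * η) (by positivity)
    have hb2 : ∫⁻ z in ball (0 : EuclideanSpace ℝ (Fin d)) (2 * η), ENNReal.ofReal (rieszKernel s z)
        ≤ ENNReal.ofReal (C₁ * ((3 * η) ^ e + (3 * η) ^ d * logIf (s = 0) (3 * η))) :=
      (lintegral_mono_set (ball_subset_ball (by linarith))).trans hb
    have hl3 := logIf_nonneg (s = 0) (3 * η)
    refine (mul_le_mul_right (add_le_add hb2
      ((lintegral_ball_smeared_rieszKernel_le hd hη).trans hb)) _).trans ?_
    rw [← ENNReal.ofReal_add (by positivity) (by positivity), ← ENNReal.ofReal_mul hA]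
    refine ENNReal.ofReal_le_ofReal ?_
    have e1 : (3 * η) ^ e = 3 ^ e * η ^ e := Real.mul_rpow (by norm_num) hη.le
    have e2 : (3 * η) ^ d * logIf (s = 0) (3 * η)
        ≤ 3 ^ d * (1 + Real.log 3) * (η ^ e + η ^ d * logIf (s = 0) η) := by
      by_cases h0 : s = 0
      · have h3 : logIf (s = 0) (3 * η) ≤ Real.log 3 + logIf (s = 0) η := by
          refine (logIf_mul_le _ (by norm_num) hη).trans_eq ?_
          simp [logIf, h0, abs_of_nonneg hlog3]
        have hee : η ^ e = η ^ d := by simp only [e]; rw [h0, sub_zero, Real.rpow_natCast]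
        rw [hee, mul_pow, mul_assoc]
        have hp : 0 ≤ η ^ d := by positivity
        calc (3 : ℝ) ^ d * (η ^ d * logIf (s = 0) (3 * η))
            ≤ 3 ^ d * (η ^ d * (Real.log 3 + logIf (s = 0) η)) := by gcongr
          _ ≤ 3 ^ d * ((1 + Real.log 3) * (η ^ d + η ^ d * logIf (s = 0) η)) := by
              refine mul_le_mul_of_nonneg_left ?_ (by positivity)
              nlinarith [mul_nonneg hp hlogs, mul_nonneg hlog3 (mul_nonneg hp hlogs)]
          _ = _ := by ring
      · have : logIf (s = 0) (3 * η) = 0 := by simp [logIf, h0]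
        rw [this, mul_zero]
        positivity
    have e3 : η ^ e + η ^ d * logIf (s = 0) η ≤ err := by
      simp only [err, smearingError]
      have : 0 ≤ η ^ 2 * logIf (s = (d : ℝ) - 2) η := by positivity
      have h5 : (0 : ℝ) ≤ if s < (d : ℝ) - 2 then η ^ 2 else 0 := by split_ifs <;> positivity
      linarith
    have e4 : (3 * η) ^ e ≤ 3 ^ e * (η ^ e + η ^ d * logIf (s = 0) η) := by
      rw [e1]
      have : 0 ≤ η ^ d * logIf (s = 0) η := by positivity
      gcongr
      linarith
    calc _ = A * (2 * C₁) * ((3 * η) ^ e + (3 * η) ^ d * logIf (s = 0) (3 * η)) := by ring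
      _ ≤ A * (2 * C₁) * ((3 ^ e + 3 ^ d * (1 + Real.log 3)) * err) := by
          gcongr
          refine (add_le_add e4 e2).trans ?_
          rw [← add_mul]
          gcongr
      _ = _ := by simp only [D1]; ring
  have hI2 : ∫⁻ z, f2 z ≤ ENNReal.ofReal (a * C₂ * err) := by
    rw [hf2, lintegral_indicator hms, lintegral_const_mul' _ _ ENNReal.ofReal_ne_top]
    refine (mul_le_mul_right (h₂ η hη (by linarith)) _).trans ?_
    rw [← ENNReal.ofReal_mul (by positivity)]
    refine ENNReal.ofReal_le_ofReal ?_
    have e1 : η ^ 2 * (1 + logIf (s = (d : ℝ) - 2) η) ≤ err := by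
      simp only [err, smearingError]
      have h5 : 0 ≤ η ^ d * logIf (s = 0) η := by positivity
      rcases hsd.lt_or_eq with h | h
      · rw [if_pos h]
        have : 0 ≤ η ^ ((d : ℝ) - s) := by positivity
        linarith
      · have : η ^ ((d : ℝ) - s) = η ^ 2 := by
          rw [show (d : ℝ) - s = (2 : ℕ) by rw [h]; push_cast; ring, Real.rpow_natCast]
        rw [this]
        have h5' : (0 : ℝ) ≤ if s < (d : ℝ) - 2 then η ^ 2 else 0 := by split_ifs <;> positivity
        linarith
    calc a * η ^ 2 * (C₂ * (1 + logIf (s = (d : ℝ) - 2) η))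
        = a * C₂ * (η ^ 2 * (1 + logIf (s = (d : ℝ) - 2) η)) := by ring
      _ ≤ _ := by gcongr
  set B := D.toReal * (D1 * err) + D.toReal * (a * C₂ * err) + a * (1 / r₀ ^ (s + 2)) * η ^ 2
  have hB : 0 ≤ B := by positivity
  have hlin : ∫⁻ y, ENNReal.ofReal (g (y - x) - ∫ θ, g (y - x + η • (θ : EuclideanSpace ℝ (Fin d)))
          ∂(unitSphereMeasure d)) ∂μ ≤ ENNReal.ofReal B := by
    have hshift : ∀ f : EuclideanSpace ℝ (Fin d) → ℝ≥0∞, ∫⁻ y, f (y - x) ∂μ ≤ D * ∫⁻ z, f z :=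
      fun f => (lintegral_le_densitySup_mul hμ _).trans_eq (by
        rw [lintegral_sub_right_eq_self (fun y => f y)])
    have hf2m : Measurable f2 := by
      refine Measurable.indicator ?_ hms
      exact measurable_const.mul ((measurable_const.div (measurable_norm.pow_const _)).ennreal_ofReal)
    have hf2x : Measurable fun y => f2 (y - x) := hf2m.comp (measurable_id.sub_const x)
    calc _ ≤ ∫⁻ y, (f1 (y - x) + f2 (y - x)
          + ENNReal.ofReal (a * (1 / r₀ ^ (s + 2)) * η ^ 2)) ∂μ :=
          lintegral_mono_ae (hμ0.mono fun y hy =>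
            hg.ofReal_sub_integral_sphere_le hd hs hy hη (by linarith))
      _ = ∫⁻ y, f1 (y - x) ∂μ + ∫⁻ y, f2 (y - x) ∂μ
          + ENNReal.ofReal (a * (1 / r₀ ^ (s + 2)) * η ^ 2) := by
          rw [lintegral_add_right _ measurable_const,
            lintegral_add_right _ hf2x]
          simp
      _ ≤ D * ENNReal.ofReal (D1 * err) + D * ENNReal.ofReal (a * C₂ * err)
          + ENNReal.ofReal (a * (1 / r₀ ^ (s + 2)) * η ^ 2) := by
          gcongr
          · exact (hshift f1).trans (mul_le_mul_right hI1 _)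
          · exact (hshift f2).trans (mul_le_mul_right hI2 _)
      _ = ENNReal.ofReal B := by
          rw [← ENNReal.ofReal_toReal hμd, ← ENNReal.ofReal_mul (by positivity),
            ← ENNReal.ofReal_mul (by positivity), ← ENNReal.ofReal_add (by positivity)
            (by positivity), ← ENNReal.ofReal_add (by positivity) (by positivity)]
  have hint : ∫ y, (g (y - x) - ∫ θ, g (y - x + η • (θ : EuclideanSpace ℝ (Fin d)))
          ∂(unitSphereMeasure d)) ∂μ ≤ B := by
    by_cases hi : Integrable (fun y => g (y - x) - ∫ θ, g (y - x + η • (θ : EuclideanSpace ℝ (Fin d)))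
          ∂(unitSphereMeasure d)) μ
    · rw [integral_eq_lintegral_pos_part_sub_lintegral_neg_part hi]
      exact (sub_le_self _ ENNReal.toReal_nonneg).trans (ENNReal.toReal_le_of_le_ofReal hB hlin)
    · rw [integral_undef hi]; exact hB
  refine hint.trans ?_
  have t1 : 0 ≤ D.toReal := ENNReal.toReal_nonneg
  have t2 : 0 ≤ a * (1 / r₀ ^ (s + 2)) := by positivity
  have t3 : 0 ≤ (D1 + a * C₂) * η ^ 2 := by positivity
  have t4 : 0 ≤ a * (1 / r₀ ^ (s + 2)) * (D.toReal * err) := by positivity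
  simp only [B]
  nlinarith

end

/-- The average of finitely many measures. -/
noncomputable def averageMeasure {X : Type*} [MeasurableSpace X] {N : ℕ} (ν : Fin N → Measure X) :
    Measure X := (N : ℝ≥0∞)⁻¹ • ∑ i, ν i

section Average

variable {X Y : Type*} [MeasurableSpace X] [MeasurableSpace Y] {N : ℕ} {ν : Fin N → Measure X}

theorem isProbabilityMeasure_averageMeasure (hN : 1 ≤ N) (hν : ∀ i, IsProbabilityMeasure (ν i)) :
    IsProbabilityMeasure (averageMeasure ν) := by
  refine ⟨?_⟩
  have h0 : (N : ℝ≥0∞) ≠ 0 := by exact_mod_cast (by omega : N ≠ 0)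
  rw [averageMeasure, Measure.smul_apply, Measure.finsetSum_apply]
  simp [ENNReal.inv_mul_cancel h0 (ENNReal.natCast_ne_top N)]

theorem ae_averageMeasure {p : X → Prop} (h : ∀ i, ∀ᵐ x ∂(ν i), p x) :
    ∀ᵐ x ∂(averageMeasure ν), p x := by
  refine Measure.ae_smul_measure ?_ _
  rw [ae_iff, Measure.finsetSum_apply]
  exact Finset.sum_eq_zero fun i _ => ae_iff.1 (h i)

theorem integrable_averageMeasure (hN : 1 ≤ N) {E : Type*} [NormedAddCommGroup E] {f : X → E}
    (hf : ∀ i, Integrable f (ν i)) : Integrable f (averageMeasure ν) := by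
  refine Integrable.smul_measure ?_ (by simp; omega)
  exact integrable_finsetSum_measure.2 fun i _ => hf i

theorem integral_averageMeasure {E : Type*} [NormedAddCommGroup E] [NormedSpace ℝ E] {f : X → E}
    (hf : ∀ i, Integrable f (ν i)) :
    ∫ x, f x ∂(averageMeasure ν) = (N : ℝ)⁻¹ • ∑ i, ∫ x, f x ∂(ν i) := by
  rw [averageMeasure, integral_smul_measure, integral_finsetSum_measure fun i _ => hf i]
  simp

theorem averageMeasure_prod [∀ i, SFinite (ν i)] (ρ : Measure Y) [SFinite ρ] :
    (averageMeasure ν).prod ρ = averageMeasure fun i => (ν i).prod ρ := by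
  rw [averageMeasure, averageMeasure, Measure.prod_smul_left, ← Measure.sum_fintype,
    Measure.prod_sum_left, Measure.sum_fintype]

theorem prod_averageMeasure (ρ : Measure Y) [SFinite ρ] [∀ i, SFinite (ν i)] :
    ρ.prod (averageMeasure ν) = averageMeasure fun i => ρ.prod (ν i) := by
  have : SFinite (∑ i, ν i) := by rw [← Measure.sum_fintype]; infer_instance
  rw [averageMeasure, averageMeasure, Measure.prod_smul_right, ← Measure.sum_fintype,
    Measure.prod_sum_right, Measure.sum_fintype]

end Average

section

open Metric Set

variable {d : ℕ} {s M A L : ℝ} {g : EuclideanSpace ℝ (Fin d) → ℝ}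

theorem nullSingletonClass_of_absolutelyContinuous (hd : 2 ≤ d)
    {μ : Measure (EuclideanSpace ℝ (Fin d))} (hμ : μ ≪ volume) : NullSingletonClass μ := by
  have := nontrivial_euclideanSpace (d := d) (by omega)
  exact ⟨fun x => hμ (measure_singleton x)⟩

theorem rieszKernel_le_indicator_add (hs : 0 ≤ s) (x y : EuclideanSpace ℝ (Fin d)) :
    rieszKernel s (x - y) ≤ (ball 0 1).indicator (rieszKernel s) (x - y)
      + (1 + (logGrowth s x + logGrowth s y)) := by
  have hx := logGrowth_nonneg (s := s) x
  have hy := logGrowth_nonneg (s := s) y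
  by_cases h : x - y ∈ ball (0 : EuclideanSpace ℝ (Fin d)) 1
  · rw [indicator_of_mem h]; linarith
  · rw [indicator_of_notMem h]
    have h1 : 1 ≤ ‖x - y‖ := by simpa using h
    linarith [rieszKernel_le_of_one_le hs h1, logGrowth_sub_le (s := s) x y]

/-- The Riesz kernel is integrable with respect to the product of a finite measure and a measure
with bounded density. -/
theorem integrable_rieszKernel_prod (hd : 2 ≤ d) (hs : 0 ≤ s) (hsd : s < d)
    {α μ : Measure (EuclideanSpace ℝ (Fin d))} [IsFiniteMeasure α] [IsFiniteMeasure μ]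
    (hμ : μ ≪ volume) (hμd : densitySup μ ≠ ⊤) (hα : Integrable (logGrowth s) α)
    (hμl : Integrable (logGrowth s) μ) :
    Integrable (fun p : EuclideanSpace ℝ (Fin d) × EuclideanSpace ℝ (Fin d) =>
      rieszKernel s (p.1 - p.2)) (α.prod μ) := by
  have hmk := measurable_rieszKernel (d := d) (s := s)
  have hms : Measurable fun p : EuclideanSpace ℝ (Fin d) × EuclideanSpace ℝ (Fin d) => p.1 - p.2 :=
    measurable_fst.sub measurable_snd
  set k : EuclideanSpace ℝ (Fin d) → ℝ := (ball 0 1).indicator (rieszKernel s) with hk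
  have hkm : Measurable k := hmk.indicator measurableSet_ball
  have hk0 : ∀ z, 0 ≤ k z := fun z => indicator_nonneg (fun _ _ => rieszKernel_nonneg _) z
  have hkI : ∫⁻ z, ENNReal.ofReal (k z) ≠ ⊤ := by
    obtain ⟨C, -, hC⟩ := exists_lintegral_ball_rieszKernel_le hd hsd
    have h1 : ∀ z, ENNReal.ofReal (k z)
        = (ball 0 1).indicator (fun z => ENNReal.ofReal (rieszKernel s z)) z := fun z => by
      simp only [k, indicator]; split_ifs <;> simp
    simp_rw [h1]
    rw [lintegral_indicator measurableSet_ball]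
    exact ((hC 1 one_pos).trans_lt ENNReal.ofReal_lt_top).ne
  have h1 : Integrable (fun p : EuclideanSpace ℝ (Fin d) × EuclideanSpace ℝ (Fin d) =>
      k (p.1 - p.2)) (α.prod μ) := by
    refine ⟨(hkm.comp hms).aestronglyMeasurable, ?_⟩
    have hm2 : Measurable fun p : EuclideanSpace ℝ (Fin d) × EuclideanSpace ℝ (Fin d) =>
        ENNReal.ofReal (k (p.1 - p.2)) := (hkm.comp hms).ennreal_ofReal
    rw [hasFiniteIntegral_iff_ofReal (ae_of_all _ fun p => hk0 _), lintegral_prod _ hm2.aemeasurable]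
    calc _ ≤ ∫⁻ _x : EuclideanSpace ℝ (Fin d),
          (densitySup μ * ∫⁻ z : EuclideanSpace ℝ (Fin d), ENNReal.ofReal (k z)) ∂α := by
          refine lintegral_mono fun x => (lintegral_le_densitySup_mul hμ _).trans_eq ?_
          rw [lintegral_sub_left_eq_self fun z => ENNReal.ofReal (k z)]
      _ < ⊤ := by
          rw [lintegral_const]
          exact ENNReal.mul_lt_top (ENNReal.mul_lt_top hμd.lt_top hkI.lt_top) (measure_lt_top _ _)
  refine (h1.add ((integrable_const 1).add ((hα.comp_fst μ).add (hμl.comp_snd α)))).mono'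
    (hmk.comp hms).aestronglyMeasurable (ae_of_all _ fun p => ?_)
  rw [Real.norm_of_nonneg (rieszKernel_nonneg _)]
  exact rieszKernel_le_indicator_add hs p.1 p.2

namespace TamePotential

theorem integrable_prod (hg : TamePotential s M A L g) (hd : 2 ≤ d) (hs : 0 ≤ s) (hsd : s < d)
    {α μ : Measure (EuclideanSpace ℝ (Fin d))} [IsFiniteMeasure α] [IsFiniteMeasure μ]
    (hμ : μ ≪ volume) (hμd : densitySup μ ≠ ⊤) (hα : Integrable (logGrowth s) α)
    (hμl : Integrable (logGrowth s) μ) :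
    Integrable (fun p : EuclideanSpace ℝ (Fin d) × EuclideanSpace ℝ (Fin d) => g (p.1 - p.2))
      (α.prod μ) := by
  have := nullSingletonClass_of_absolutelyContinuous hd hμ
  refine ((integrable_rieszKernel_prod hd hs hsd hμ hμd hα hμl).const_mul A).mono'
    (hg.measurable.comp (measurable_fst.sub measurable_snd)).aestronglyMeasurable ?_
  exact (ae_prod_ne α μ).mono fun p hp => hg.abs_bound _ (sub_ne_zero.2 hp)

/-- A tame potential is bounded below up to its logarithmic growth. -/
theorem exists_lower_bound_logGrowth (hg : TamePotential s M A L g) (hs : 0 ≤ s) :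
    ∃ D : ℝ, 0 ≤ D ∧ ∀ z, z ≠ 0 → -(D * (1 + logGrowth s z)) ≤ g z := by
  obtain ⟨D, hD, h⟩ := hg.exists_lower_bound 1
  have hA := hg.nonneg_left
  refine ⟨D + A, by positivity, fun z hz => ?_⟩
  have hl := logGrowth_nonneg (s := s) z
  rcases le_total ‖z‖ 1 with h1 | h1
  · have := h z hz h1
    nlinarith [mul_nonneg hA hl, mul_nonneg hD hl]
  · have h2 := (abs_le.1 (hg.abs_bound z hz)).1
    have h3 := mul_le_mul_of_nonneg_left (rieszKernel_le_of_one_le hs h1) hA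
    nlinarith [mul_nonneg hD hl]

end TamePotential

theorem empiricalMeasure_eq_average {N : ℕ} (x : Fin N → EuclideanSpace ℝ (Fin d)) :
    empiricalMeasure x = averageMeasure fun i => Measure.dirac (x i) := rfl

theorem smearedEmpiricalMeasure_eq_average {N : ℕ} (x : Fin N → EuclideanSpace ℝ (Fin d))
    (η : Fin N → ℝ) :
    smearedEmpiricalMeasure x η = averageMeasure fun i => uniformSphere (x i) (η i) := rfl

theorem integrable_dirac_real (f : EuclideanSpace ℝ (Fin d) → ℝ) (a : EuclideanSpace ℝ (Fin d)) :
    Integrable f (Measure.dirac a) := integrable_dirac enorm_lt_top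

/-- The interaction off the diagonal, as a function on the product space. -/
noncomputable def offDiagonalKernel (g : EuclideanSpace ℝ (Fin d) → ℝ) :
    EuclideanSpace ℝ (Fin d) × EuclideanSpace ℝ (Fin d) → ℝ :=
  (offDiagonal d).indicator fun p => g (p.1 - p.2)

theorem measurableSet_offDiagonal : MeasurableSet (offDiagonal d) :=
  (isClosed_eq continuous_fst continuous_snd).measurableSet.compl

theorem offDiagonalEnergy_eq (α β : Measure (EuclideanSpace ℝ (Fin d))) :
    offDiagonalEnergy g α β = ∫ p, offDiagonalKernel g p ∂(α.prod β) :=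
  (integral_indicator measurableSet_offDiagonal).symm

theorem offDiagonalEnergy_of_nullSingletonClass {α β : Measure (EuclideanSpace ℝ (Fin d))}
    [SFinite α] [SFinite β] [NullSingletonClass β] :
    offDiagonalEnergy g α β = ∫ p, g (p.1 - p.2) ∂(α.prod β) := by
  rw [offDiagonalEnergy_eq]
  exact integral_congr_ae ((ae_prod_ne α β).mono fun p hp => indicator_of_mem hp _)

theorem integrable_dirac_prod_dirac (a b : EuclideanSpace ℝ (Fin d))
    (f : EuclideanSpace ℝ (Fin d) × EuclideanSpace ℝ (Fin d) → ℝ) :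
    Integrable f ((Measure.dirac a).prod (Measure.dirac b)) := by
  rw [Measure.dirac_prod_dirac]
  exact integrable_dirac enorm_lt_top

theorem integrable_offDiagonalKernel_empirical {N : ℕ} (hN : 1 ≤ N)
    (x : Fin N → EuclideanSpace ℝ (Fin d)) :
    Integrable (offDiagonalKernel g) ((empiricalMeasure x).prod (empiricalMeasure x)) := by
  have := isProbabilityMeasure_averageMeasure hN fun i => (inferInstance :
    IsProbabilityMeasure (Measure.dirac (x i)))
  rw [empiricalMeasure_eq_average, averageMeasure_prod]
  refine integrable_averageMeasure hN fun i => ?_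
  rw [prod_averageMeasure]
  exact integrable_averageMeasure hN fun j => integrable_dirac_prod_dirac _ _ _

theorem offDiagonalEnergy_empirical {N : ℕ} (hN : 1 ≤ N) (x : Fin N → EuclideanSpace ℝ (Fin d)) :
    offDiagonalEnergy g (empiricalMeasure x) (empiricalMeasure x)
      = (N : ℝ)⁻¹ * ∑ i, (N : ℝ)⁻¹ * ∑ j, offDiagonalKernel g (x i, x j) := by
  have := isProbabilityMeasure_averageMeasure hN fun i => (inferInstance :
    IsProbabilityMeasure (Measure.dirac (x i)))
  have hi : ∀ i, Integrable (offDiagonalKernel g)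
      ((Measure.dirac (x i)).prod (averageMeasure fun i => Measure.dirac (x i))) := fun i => by
    rw [prod_averageMeasure]
    exact integrable_averageMeasure hN fun j => integrable_dirac_prod_dirac _ _ _
  rw [offDiagonalEnergy_eq, empiricalMeasure_eq_average, averageMeasure_prod,
    integral_averageMeasure hi, smul_eq_mul]
  congr 1
  refine Finset.sum_congr rfl fun i _ => ?_
  rw [prod_averageMeasure, integral_averageMeasure fun j => integrable_dirac_prod_dirac _ _ _,
    smul_eq_mul]
  congr 1
  refine Finset.sum_congr rfl fun j _ => ?_
  rw [Measure.dirac_prod_dirac, integral_dirac]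

theorem TamePotential.modulatedEnergyConverges (hg : TamePotential s M A L g) (hd : 2 ≤ d)
    (hs : 0 ≤ s) (hsd : s < d) {N : ℕ} (hN : 1 ≤ N) (x : Fin N → EuclideanSpace ℝ (Fin d))
    {μ : Measure (EuclideanSpace ℝ (Fin d))} [IsFiniteMeasure μ]
    (hμ : μ ≪ volume) (hμd : densitySup μ ≠ ⊤) (hμl : Integrable (logGrowth s) μ) :
    ModulatedEnergyConverges g x μ := by
  have hp : IsProbabilityMeasure (empiricalMeasure x) :=
    isProbabilityMeasure_averageMeasure hN fun i => inferInstance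
  have hel : Integrable (logGrowth s) (empiricalMeasure x) :=
    integrable_averageMeasure hN fun i => integrable_dirac_real _ _
  have hem := hg.integrable_prod hd hs hsd hμ hμd hel hμl
  have hmm := hg.integrable_prod hd hs hsd hμ hμd hμl hμl
  have hme : Integrable (offDiagonalKernel g) (μ.prod (empiricalMeasure x)) := by
    refine (hem.indicator measurableSet_offDiagonal).swap.congr (ae_of_all _ fun p => ?_)
    by_cases h : p.1 = p.2
    · simp [offDiagonalKernel, offDiagonal, h]
    · have h1 := hg.even _ (sub_ne_zero.2 h)
      simp [offDiagonalKernel, offDiagonal, h, Ne.symm h, h1, indicator]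
  unfold ModulatedEnergyConverges
  rw [← integrable_indicator_iff measurableSet_offDiagonal, Measure.add_prod, Measure.prod_add,
    Measure.prod_add, integrable_add_measure, integrable_add_measure, integrable_add_measure]
  exact ⟨⟨integrable_offDiagonalKernel_empirical hN x, hem.indicator measurableSet_offDiagonal⟩,
    hme, hmm.indicator measurableSet_offDiagonal⟩

end

/-- The density of the centred Gaussian measure with Fourier transform `exp (-b |ξ|²)`. -/
noncomputable def gaussianDensity {d : ℕ} (b : ℝ) (y : EuclideanSpace ℝ (Fin d)) : ℝ :=
  (Real.pi / b) ^ ((d : ℝ) / 2) * Real.exp (-(Real.pi ^ 2 / b) * ‖y‖ ^ 2)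

/-- The centred Gaussian measure with Fourier transform `exp (-b |ξ|²)`. -/
noncomputable def gaussianMeasure (d : ℕ) (b : ℝ) : Measure (EuclideanSpace ℝ (Fin d)) :=
  volume.withDensity fun y => ENNReal.ofReal (gaussianDensity b y)

section

variable {d : ℕ} {s M A L b : ℝ} {g : EuclideanSpace ℝ (Fin d) → ℝ}

theorem integral_rexp_neg_mul_sq_norm_euclideanSpace {a : ℝ} (ha : 0 < a) :
    ∫ v : EuclideanSpace ℝ (Fin d), Real.exp (-a * ‖v‖ ^ 2) = (Real.pi / a) ^ ((d : ℝ) / 2) := by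
  rw [GaussianFourier.integral_rexp_neg_mul_sq_norm ha, finrank_euclideanSpace_fin]

theorem integrable_rexp_neg_mul_sq_norm {a : ℝ} (ha : 0 < a) :
    Integrable fun v : EuclideanSpace ℝ (Fin d) => Real.exp (-a * ‖v‖ ^ 2) := by
  refine Integrable.of_integral_ne_zero ?_
  rw [integral_rexp_neg_mul_sq_norm_euclideanSpace ha]
  have := Real.pi_pos
  positivity

theorem gaussianDensity_nonneg (hb : 0 < b) (y : EuclideanSpace ℝ (Fin d)) :
    0 ≤ gaussianDensity b y := by
  have := Real.pi_pos
  unfold gaussianDensity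
  positivity

theorem continuous_gaussianDensity : Continuous (gaussianDensity (d := d) b) := by
  unfold gaussianDensity
  fun_prop

theorem gaussianDensity_neg (y : EuclideanSpace ℝ (Fin d)) :
    gaussianDensity b (-y) = gaussianDensity b y := by simp [gaussianDensity]

theorem gaussianDensity_le (hb : 0 < b) (y : EuclideanSpace ℝ (Fin d)) :
    gaussianDensity b y ≤ (Real.pi / b) ^ ((d : ℝ) / 2) := by
  have := Real.pi_pos
  unfold gaussianDensity
  refine mul_le_of_le_one_right (by positivity) (Real.exp_le_one_iff.2 ?_)
  have : 0 ≤ Real.pi ^ 2 / b * ‖y‖ ^ 2 := by positivity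
  linarith

theorem integrable_gaussianDensity (hb : 0 < b) : Integrable (gaussianDensity (d := d) b) :=
  (integrable_rexp_neg_mul_sq_norm (by have := Real.pi_pos; positivity)).const_mul _

theorem integral_gaussianDensity (hb : 0 < b) :
    ∫ y : EuclideanSpace ℝ (Fin d), gaussianDensity b y = 1 := by
  have hp := Real.pi_pos
  unfold gaussianDensity
  rw [integral_const_mul, integral_rexp_neg_mul_sq_norm_euclideanSpace (by positivity),
    ← Real.mul_rpow (by positivity) (by positivity)]
  have : Real.pi / b * (Real.pi / (Real.pi ^ 2 / b)) = 1 := by field_simp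
  rw [this, Real.one_rpow]

theorem isProbabilityMeasure_gaussianMeasure (hb : 0 < b) :
    IsProbabilityMeasure (gaussianMeasure d b) := by
  refine ⟨?_⟩
  rw [gaussianMeasure, withDensity_apply _ MeasurableSet.univ, Measure.restrict_univ,
    ← ofReal_integral_eq_lintegral_ofReal (integrable_gaussianDensity hb)
      (ae_of_all _ (gaussianDensity_nonneg hb)), integral_gaussianDensity hb, ENNReal.ofReal_one]

theorem gaussianMeasure_absolutelyContinuous : gaussianMeasure d b ≪ volume :=
  withDensity_absolutelyContinuous _ _

theorem densitySup_gaussianMeasure_ne_top (hb : 0 < b) : densitySup (gaussianMeasure d b) ≠ ⊤ := by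
  have h1 := Measure.rnDeriv_withDensity (volume : Measure (EuclideanSpace ℝ (Fin d)))
    (continuous_gaussianDensity (d := d) (b := b)).measurable.ennreal_ofReal
  refine ne_top_of_le_ne_top (ENNReal.ofReal_ne_top (r := (Real.pi / b) ^ ((d : ℝ) / 2))) ?_
  refine essSup_le_of_ae_le _ ?_
  filter_upwards [h1] with y hy
  rw [gaussianMeasure, hy]
  exact ENNReal.ofReal_le_ofReal (gaussianDensity_le hb y)

theorem integrable_gaussianMeasure_iff (hb : 0 < b) {f : EuclideanSpace ℝ (Fin d) → ℝ} :
    Integrable f (gaussianMeasure d b) ↔ Integrable fun y => f y * gaussianDensity b y := by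
  rw [gaussianMeasure, integrable_withDensity_iff continuous_gaussianDensity.measurable.ennreal_ofReal
    (ae_of_all _ fun _ => ENNReal.ofReal_lt_top)]
  simp_rw [ENNReal.toReal_ofReal (gaussianDensity_nonneg hb _)]

theorem integral_gaussianMeasure (hb : 0 < b) (f : EuclideanSpace ℝ (Fin d) → ℝ) :
    ∫ y, f y ∂(gaussianMeasure d b) = ∫ y, f y * gaussianDensity b y := by
  rw [gaussianMeasure, integral_withDensity_eq_integral_toReal_smul
    continuous_gaussianDensity.measurable.ennreal_ofReal (ae_of_all _ fun _ => ENNReal.ofReal_lt_top)]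
  simp_rw [ENNReal.toReal_ofReal (gaussianDensity_nonneg hb _), smul_eq_mul, mul_comm]

/-- The second moment of the Gaussian measure. -/
theorem integral_sq_norm_gaussianMeasure_le (d : ℕ) : ∃ C : ℝ, 0 ≤ C ∧ ∀ b : ℝ, 0 < b →
    Integrable (fun y => ‖y‖ ^ 2) (gaussianMeasure d b) ∧
    ∫ y, ‖y‖ ^ 2 ∂(gaussianMeasure d b) ≤ C * b := by
  have hp := Real.pi_pos
  refine ⟨2 / Real.pi ^ 2 * 2 ^ ((d : ℝ) / 2), by positivity, fun b hb => ?_⟩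
  set a := Real.pi ^ 2 / b with ha
  have ha0 : 0 < a := by positivity
  set c := (Real.pi / b) ^ ((d : ℝ) / 2) with hc
  have hc0 : 0 < c := by positivity
  have hle : ∀ y : EuclideanSpace ℝ (Fin d), ‖y‖ ^ 2 * gaussianDensity b y
      ≤ 2 / a * c * Real.exp (-(a / 2) * ‖y‖ ^ 2) := fun y => by
    have h1 : a / 2 * ‖y‖ ^ 2 ≤ Real.exp (a / 2 * ‖y‖ ^ 2) := by
      linarith [Real.add_one_le_exp (a / 2 * ‖y‖ ^ 2)]
    have h2 : Real.exp (-a * ‖y‖ ^ 2)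
        = Real.exp (-(a / 2) * ‖y‖ ^ 2) * Real.exp (-(a / 2) * ‖y‖ ^ 2) := by
      rw [← Real.exp_add]; congr 1; ring
    have h3 : Real.exp (a / 2 * ‖y‖ ^ 2) * Real.exp (-(a / 2) * ‖y‖ ^ 2) = 1 := by
      rw [← Real.exp_add]; simp
    set e := Real.exp (-(a / 2) * ‖y‖ ^ 2)
    have he : 0 < e := Real.exp_pos _
    have h4 : ‖y‖ ^ 2 * e ≤ 2 / a := by
      rw [le_div_iff₀ ha0]
      nlinarith
    rw [gaussianDensity, h2]
    calc ‖y‖ ^ 2 * (c * (e * e)) = (‖y‖ ^ 2 * e) * (c * e) := by ring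
      _ ≤ 2 / a * (c * e) := by gcongr
      _ = _ := by ring
  have hi : Integrable fun y : EuclideanSpace ℝ (Fin d) =>
      2 / a * c * Real.exp (-(a / 2) * ‖y‖ ^ 2) :=
    (integrable_rexp_neg_mul_sq_norm (half_pos ha0)).const_mul _
  have hi2 : Integrable fun y : EuclideanSpace ℝ (Fin d) => ‖y‖ ^ 2 * gaussianDensity b y :=
    hi.mono' ((continuous_norm.pow 2).mul continuous_gaussianDensity).aestronglyMeasurable
      (ae_of_all _ fun y => by
        rw [Real.norm_of_nonneg (mul_nonneg (by positivity) (gaussianDensity_nonneg hb y))]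
        exact hle y)
  refine ⟨(integrable_gaussianMeasure_iff hb).2 hi2, ?_⟩
  rw [integral_gaussianMeasure hb]
  refine (integral_mono hi2 hi hle).trans_eq ?_
  rw [integral_const_mul, integral_rexp_neg_mul_sq_norm_euclideanSpace (half_pos ha0)]
  have e1 : Real.pi / (a / 2) = 2 * (b / Real.pi) := by rw [ha]; field_simp
  have e2 : c * (b / Real.pi) ^ ((d : ℝ) / 2) = 1 := by
    rw [hc, ← Real.mul_rpow (by positivity) (by positivity)]
    have : Real.pi / b * (b / Real.pi) = 1 := by field_simp
    rw [this, Real.one_rpow]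
  rw [e1, Real.mul_rpow (by norm_num) (by positivity)]
  calc 2 / a * c * (2 ^ ((d : ℝ) / 2) * (b / Real.pi) ^ ((d : ℝ) / 2))
      = 2 / a * 2 ^ ((d : ℝ) / 2) * (c * (b / Real.pi) ^ ((d : ℝ) / 2)) := by ring
    _ = _ := by rw [e2, ha]; field_simp

theorem logGrowth_le_one_add_sq (z : EuclideanSpace ℝ (Fin d)) : logGrowth s z ≤ 1 + ‖z‖ ^ 2 :=
  (logGrowth_le_norm z).trans (by nlinarith [sq_nonneg (‖z‖ - 1)])

theorem integrable_logGrowth_gaussianMeasure (hb : 0 < b) :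
    Integrable (logGrowth s) (gaussianMeasure d b) := by
  obtain ⟨C, -, hC⟩ := integral_sq_norm_gaussianMeasure_le d
  have := isProbabilityMeasure_gaussianMeasure (d := d) hb
  refine ((integrable_const (1 : ℝ)).add (hC b hb).1).mono'
    measurable_logGrowth.aestronglyMeasurable (ae_of_all _ fun y => ?_)
  rw [Real.norm_of_nonneg (logGrowth_nonneg y)]
  exact logGrowth_le_one_add_sq y

/-- The Gaussian function as a Schwartz function. -/
theorem exists_pow_mul_norm_iteratedFDeriv_gaussian_le (hb : 0 < b) (k n : ℕ) : ∃ C : ℝ,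
    ∀ x : EuclideanSpace ℝ (Fin d), ‖x‖ ^ k *
      ‖iteratedFDeriv ℝ n (fun x : EuclideanSpace ℝ (Fin d) => Real.exp (-b * ‖x‖ ^ 2)) x‖ ≤ C := by
  have hq : Function.HasTemperateGrowth fun x : EuclideanSpace ℝ (Fin d) => -b * ‖x‖ ^ 2 :=
    (Function.HasTemperateGrowth.const (-b)).mul
      (Function.hasTemperateGrowth_norm_sq (EuclideanSpace ℝ (Fin d)))
  obtain ⟨m, C, hC0, hC⟩ := hq.norm_iteratedFDeriv_le_uniform n
  refine ⟨n.factorial * (1 + C) ^ n * ((k + m * n).factorial * Real.exp (1 + 1 / (4 * b))),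
    fun x => ?_⟩
  have hx := norm_nonneg x
  have h1 : ‖iteratedFDeriv ℝ n (Real.exp ∘ fun x : EuclideanSpace ℝ (Fin d) => -b * ‖x‖ ^ 2) x‖
      ≤ n.factorial * Real.exp (-b * ‖x‖ ^ 2) * ((1 + C) * (1 + ‖x‖) ^ m) ^ n := by
    refine norm_iteratedFDeriv_comp_le Real.contDiff_exp hq.1 (n := n) (by exact_mod_cast le_top) x
      (fun i _ => ?_) fun i h1 hi => ?_
    · rw [norm_iteratedFDeriv_eq_norm_iteratedDeriv, iteratedDeriv_eq_iterate, Real.iter_deriv_exp,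
        Real.norm_of_nonneg (Real.exp_pos _).le]
    · refine (hC i hi x).trans (le_trans ?_ (le_self_pow₀ ?_ (by omega)))
      · gcongr; linarith
      · exact one_le_mul_of_one_le_of_one_le (by linarith) (one_le_pow₀ (by linarith))
  have h2 : (1 + ‖x‖) ^ (k + m * n) ≤ (k + m * n).factorial * Real.exp (1 + ‖x‖) := by
    have := Real.pow_div_factorial_le_exp (1 + ‖x‖) (by positivity) (k + m * n)
    rwa [div_le_iff₀' (by positivity)] at this
  have h3 : Real.exp (1 + ‖x‖) * Real.exp (-b * ‖x‖ ^ 2) ≤ Real.exp (1 + 1 / (4 * b)) := by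
    rw [← Real.exp_add]
    refine Real.exp_le_exp.2 ?_
    have : 0 ≤ b * (‖x‖ - 1 / (2 * b)) ^ 2 := by positivity
    have e : b * (‖x‖ - 1 / (2 * b)) ^ 2 = b * ‖x‖ ^ 2 - ‖x‖ + 1 / (4 * b) := by field_simp; ring
    linarith
  calc _ ≤ (1 + ‖x‖) ^ k *
        (n.factorial * Real.exp (-b * ‖x‖ ^ 2) * ((1 + C) * (1 + ‖x‖) ^ m) ^ n) := by
        refine mul_le_mul (pow_le_pow_left₀ hx (by linarith) k) h1 (norm_nonneg _) (by positivity)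
    _ = n.factorial * (1 + C) ^ n * ((1 + ‖x‖) ^ (k + m * n) * Real.exp (-b * ‖x‖ ^ 2)) := by
        rw [mul_pow, ← pow_mul, pow_add]; ring
    _ ≤ n.factorial * (1 + C) ^ n * (((k + m * n).factorial * Real.exp (1 + ‖x‖)) *
        Real.exp (-b * ‖x‖ ^ 2)) := by gcongr
    _ ≤ _ := by
        rw [mul_assoc ((k + m * n).factorial : ℝ)]
        gcongr

end

/-- The Gaussian function `exp (-b |ξ|²)` as a Schwartz function. -/
noncomputable def gaussianSchwartz (d : ℕ) {b : ℝ} (hb : 0 < b) :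
    𝓢(EuclideanSpace ℝ (Fin d), ℂ) :=
  SchwartzMap.postcompCLM (𝕜 := ℝ) Complex.ofRealCLM
    ({ toFun := fun x => Real.exp (-b * ‖x‖ ^ 2)
       smooth' := Real.contDiff_exp.comp (contDiff_const.mul (contDiff_norm_sq ℝ))
       decay' := exists_pow_mul_norm_iteratedFDeriv_gaussian_le hb } :
      𝓢(EuclideanSpace ℝ (Fin d), ℝ))

section

variable {d : ℕ} {s M A L b : ℝ} {g : EuclideanSpace ℝ (Fin d) → ℝ}

theorem gaussianSchwartz_apply (hb : 0 < b) (ξ : EuclideanSpace ℝ (Fin d)) :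
    gaussianSchwartz d hb ξ = (Real.exp (-b * ‖ξ‖ ^ 2) : ℝ) := rfl

/-- The characteristic function of a compactly supported measure has temperate growth. -/
theorem hasTemperateGrowth_charFun {P : Measure (EuclideanSpace ℝ (Fin d))} [IsFiniteMeasure P]
    {R : ℝ} (hR : ∀ᵐ z ∂P, ‖z‖ ≤ R) :
    Function.HasTemperateGrowth fun ξ => charFun P ((2 * Real.pi) • ξ) := by
  have hi : ∀ n : ℕ, Integrable (fun v : EuclideanSpace ℝ (Fin d) =>
      ‖v‖ ^ n * ‖(1 : EuclideanSpace ℝ (Fin d) → ℂ) v‖) P := fun n => by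
    refine Integrable.of_bound (by fun_prop) (R ^ n) (hR.mono fun z hz => ?_)
    simp only [Pi.one_apply, norm_one, mul_one, norm_pow, norm_norm]
    gcongr
  have hm : AEStronglyMeasurable (1 : EuclideanSpace ℝ (Fin d) → ℂ) P :=
    aestronglyMeasurable_const
  set F := VectorFourier.fourierIntegral Real.fourierChar P
    (innerSL ℝ (E := EuclideanSpace ℝ (Fin d))).toLinearMap₁₂
    (1 : EuclideanSpace ℝ (Fin d) → ℂ) with hF
  have hFt : Function.HasTemperateGrowth F := by
    refine ⟨VectorFourier.contDiff_fourierIntegral _ fun n _ => hi n, fun n => ⟨0,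
      ∫ v, ‖VectorFourier.fourierPowSMulRight (innerSL ℝ (E := EuclideanSpace ℝ (Fin d)))
        (1 : EuclideanSpace ℝ (Fin d) → ℂ) v n‖ ∂P, fun x => ?_⟩⟩
    rw [hF, VectorFourier.iteratedFDeriv_fourierIntegral (N := ⊤) _ (fun n _ => hi n) hm le_top,
      pow_zero, mul_one]
    exact VectorFourier.norm_fourierIntegral_le_integral_norm _ _ _ _ _
  have he : (fun ξ => charFun P ((2 * Real.pi) • ξ))
      = F ∘ (-ContinuousLinearMap.id ℝ (EuclideanSpace ℝ (Fin d))) := by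
    funext ξ
    rw [charFun_eq_fourierIntegral']
    have : -(2 * Real.pi)⁻¹ • (2 * Real.pi) • ξ = -ξ := by
      rw [neg_smul, smul_smul, inv_mul_cancel₀ (by positivity), one_smul]
    rw [this]
    rfl
  rw [he]
  exact hFt.comp (ContinuousLinearMap.hasTemperateGrowth _)

end

/-- The Fourier transform of a measure, damped by a Gaussian. -/
noncomputable def dampedCharFun {d : ℕ} {b : ℝ} (hb : 0 < b)
    (P : Measure (EuclideanSpace ℝ (Fin d))) : 𝓢(EuclideanSpace ℝ (Fin d), ℂ) :=
  SchwartzMap.smulLeftCLM ℂ (fun ξ => charFun P ((2 * Real.pi) • ξ)) (gaussianSchwartz d hb)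

section

variable {d : ℕ} {s M A L b : ℝ} {g : EuclideanSpace ℝ (Fin d) → ℝ}
  {P : Measure (EuclideanSpace ℝ (Fin d))}

theorem dampedCharFun_apply (hb : 0 < b) [IsFiniteMeasure P] {R : ℝ} (hR : ∀ᵐ z ∂P, ‖z‖ ≤ R)
    (ξ : EuclideanSpace ℝ (Fin d)) : dampedCharFun hb P ξ
      = charFun P ((2 * Real.pi) • ξ) * (Real.exp (-b * ‖ξ‖ ^ 2) : ℝ) := by
  rw [dampedCharFun, SchwartzMap.smulLeftCLM_apply_apply (hasTemperateGrowth_charFun hR),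
    gaussianSchwartz_apply, smul_eq_mul]

theorem fourier_dampedCharFun (hb : 0 < b) [IsFiniteMeasure P] {R : ℝ} (hR : ∀ᵐ z ∂P, ‖z‖ ≤ R)
    (x : EuclideanSpace ℝ (Fin d)) :
    (𝓕 (dampedCharFun hb P) : 𝓢(EuclideanSpace ℝ (Fin d), ℂ)) x
      = (∫ z, gaussianDensity b (z - x) ∂P : ℝ) := by
  rw [SchwartzMap.fourier_coe, Real.fourier_eq]
  have h1 : ∀ v : EuclideanSpace ℝ (Fin d), Real.fourierChar (-inner ℝ v x) • dampedCharFun hb P v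
      = ∫ z, Real.fourierChar (-inner ℝ v x) •
        Complex.exp (-b * ‖v‖ ^ 2 + 2 * Real.pi * Complex.I * inner ℝ z v) ∂P := fun v => by
    simp only [Circle.smul_def, smul_eq_mul]
    rw [integral_const_mul, dampedCharFun_apply hb hR, charFun_apply, ← integral_mul_const]
    congr 1
    refine integral_congr_ae (ae_of_all _ fun z => ?_)
    dsimp only
    rw [Complex.ofReal_exp, ← Complex.exp_add, inner_smul_right]
    push_cast
    congr 1
    ring
  simp_rw [h1]
  rw [integral_integral_swap]
  · rw [← integral_complex_ofReal]
    refine integral_congr_ae (ae_of_all _ fun z => ?_)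
    have h2 := fourier_gaussian_innerProductSpace' (b := (b : ℂ)) (by simpa using hb) z x
    rw [Real.fourier_eq] at h2
    dsimp only
    rw [h2, gaussianDensity, finrank_euclideanSpace_fin]
    push_cast
    rw [Complex.ofReal_cpow (by have := Real.pi_pos; positivity)]
    push_cast
    congr 2
    ring
  · have hc : Continuous fun p : EuclideanSpace ℝ (Fin d) × EuclideanSpace ℝ (Fin d) =>
        Real.fourierChar (-inner ℝ p.1 x) •
        Complex.exp (-b * ‖p.1‖ ^ 2 + 2 * Real.pi * Complex.I * inner ℝ p.2 p.1) := by
      fun_prop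
    refine ((integrable_rexp_neg_mul_sq_norm (d := d) hb).comp_fst P).mono'
      hc.aestronglyMeasurable (ae_of_all _ fun p => ?_)
    simp only [Function.uncurry, Circle.norm_smul, Complex.norm_exp]
    refine le_of_eq (congrArg Real.exp ?_)
    simp [← Complex.ofReal_pow]

/-- The pairing of the potential with the Fourier transform of a damped characteristic function. -/
theorem TamePotential.integral_mul_fourier_dampedCharFun (hg : TamePotential s M A L g)
    (hd : 2 ≤ d) (hs : 0 ≤ s) (hsd : s < d) (hb : 0 < b) [IsFiniteMeasure P] {R : ℝ}
    (hR : ∀ᵐ z ∂P, ‖z‖ ≤ R) :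
    ∫ x, (g x : ℂ) * (𝓕 (dampedCharFun hb P) : 𝓢(EuclideanSpace ℝ (Fin d), ℂ)) x
      = (∫ z, ∫ y, g (z - y) ∂(gaussianMeasure d b) ∂P : ℝ) := by
  have := isProbabilityMeasure_gaussianMeasure (d := d) hb
  have hP : Integrable (logGrowth s) P :=
    Integrable.of_bound measurable_logGrowth.aestronglyMeasurable R (hR.mono fun z hz => by
      rw [Real.norm_of_nonneg (logGrowth_nonneg z)]
      exact (logGrowth_le_norm z).trans hz)
  have hint := hg.integrable_prod hd hs hsd gaussianMeasure_absolutelyContinuous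
    (densitySup_gaussianMeasure_ne_top hb) hP (integrable_logGrowth_gaussianMeasure hb)
  have hshift : ∀ z : EuclideanSpace ℝ (Fin d), (fun y => g (z - y) * gaussianDensity b y)
      = fun y => (fun x => g x * gaussianDensity b (z - x)) (z - y) := fun z => by
    funext y; simp
  have hshiftn : ∀ z : EuclideanSpace ℝ (Fin d), (fun y => ‖g (z - y)‖ * gaussianDensity b y)
      = fun y => (fun x => ‖g x * gaussianDensity b (z - x)‖) (z - y) := fun z => by
    funext y
    simp [abs_of_nonneg (gaussianDensity_nonneg hb y)]
  have hswap : Integrable (Function.uncurry fun z x => g x * gaussianDensity b (z - x))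
      (P.prod volume) := by
    have hm : Measurable (Function.uncurry fun z x => g x * gaussianDensity b (z - x)) :=
      (hg.measurable.comp measurable_snd).mul
        (continuous_gaussianDensity.measurable.comp (measurable_fst.sub measurable_snd))
    rw [integrable_prod_iff hm.aestronglyMeasurable]
    rw [integrable_prod_iff hint.1] at hint
    refine ⟨hint.1.mono fun z hz => ?_, hint.2.congr (ae_of_all _ fun z => ?_)⟩
    · rw [integrable_gaussianMeasure_iff hb] at hz
      dsimp only at hz
      rw [hshift z] at hz
      exact (integrable_comp_sub_left _ z).1 hz
    · dsimp only
      rw [integral_gaussianMeasure hb, hshiftn z,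
        integral_sub_left_eq_self (fun x => ‖g x * gaussianDensity b (z - x)‖) volume z]
      rfl
  simp_rw [fourier_dampedCharFun hb hR, ← Complex.ofReal_mul]
  rw [integral_complex_ofReal]
  congr 1
  simp_rw [← integral_const_mul]
  rw [← integral_integral_swap hswap]
  refine integral_congr_ae (ae_of_all _ fun z => ?_)
  dsimp only
  rw [integral_gaussianMeasure hb, hshift z,
    integral_sub_left_eq_self (fun x => g x * gaussianDensity b (z - x)) volume z]

end

section

variable {d : ℕ} {s M A L : ℝ} {g : EuclideanSpace ℝ (Fin d) → ℝ}

/-- The Riesz kernel is integrable against a power weight. -/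
theorem integrable_rieszKernel_mul_one_add_norm_rpow (hd : 2 ≤ d) (hs : 0 ≤ s) (hsd : s < d) :
    Integrable fun y : EuclideanSpace ℝ (Fin d) =>
      (rieszKernel s y + 1) * (1 + ‖y‖) ^ (-((d : ℝ) + 2)) := by
  have h1 : Integrable ((Metric.ball (0 : EuclideanSpace ℝ (Fin d)) 1).indicator
      (rieszKernel s)) := by
    rw [integrable_indicator_iff Metric.isOpen_ball.measurableSet]
    refine ⟨measurable_rieszKernel.aestronglyMeasurable, ?_⟩
    rw [hasFiniteIntegral_iff_ofReal (ae_of_all _ fun _ => rieszKernel_nonneg _)]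
    obtain ⟨C, -, hC⟩ := exists_lintegral_ball_rieszKernel_le hd hsd
    exact (hC 1 one_pos).trans_lt ENNReal.ofReal_lt_top
  have h2 : Integrable fun y : EuclideanSpace ℝ (Fin d) => (1 + ‖y‖) ^ (-((d : ℝ) + 1)) :=
    integrable_one_add_norm (by rw [finrank_euclideanSpace_fin]; linarith)
  have hm : Measurable fun y : EuclideanSpace ℝ (Fin d) =>
      (rieszKernel s y + 1) * (1 + ‖y‖) ^ (-((d : ℝ) + 2)) :=
    (measurable_rieszKernel.add_const 1).mul ((measurable_norm.const_add 1).pow_const _)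
  refine (h1.add (h2.const_mul 2)).mono' hm.aestronglyMeasurable (ae_of_all _ fun y => ?_)
  have hy := norm_nonneg y
  rw [Real.norm_of_nonneg (mul_nonneg (by linarith [rieszKernel_nonneg (s := s) y])
    (by positivity))]
  have hle1 : (1 + ‖y‖) ^ (-((d : ℝ) + 2)) ≤ 1 :=
    Real.rpow_le_one_of_one_le_of_nonpos (by linarith) (by linarith [Nat.cast_nonneg (α := ℝ) d])
  have hsplit : (1 + ‖y‖) ^ (-((d : ℝ) + 1)) = (1 + ‖y‖) * (1 + ‖y‖) ^ (-((d : ℝ) + 2)) := by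
    nth_rewrite 2 [← Real.rpow_one (1 + ‖y‖)]
    rw [← Real.rpow_add (by positivity)]
    congr 1; ring
  have hker := rieszKernel_le_indicator_add hs y 0
  rw [sub_zero] at hker
  have hl0 : logGrowth s (0 : EuclideanSpace ℝ (Fin d)) ≤ 0 :=
    (logGrowth_le_norm _).trans_eq norm_zero
  have hly := logGrowth_le_norm (s := s) y
  set k := (Metric.ball (0 : EuclideanSpace ℝ (Fin d)) 1).indicator (rieszKernel s) y with hk
  have hk0 : 0 ≤ k := Set.indicator_nonneg (fun _ _ => rieszKernel_nonneg _) y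
  set q := (1 + ‖y‖) ^ (-((d : ℝ) + 2))
  have hq : 0 ≤ q := by positivity
  simp only [Pi.add_apply]
  rw [← hk, hsplit]
  calc (rieszKernel s y + 1) * q ≤ (k + 2 * (1 + ‖y‖)) * q :=
        mul_le_mul_of_nonneg_right (by linarith) hq
    _ ≤ k + 2 * ((1 + ‖y‖) * q) := by nlinarith

/-- The Schwartz seminorm controlling the pairing with a Riesz-type potential. -/
noncomputable def decaySeminorm (d : ℕ) : Seminorm ℂ 𝓢(EuclideanSpace ℝ (Fin d), ℂ) :=
  (Finset.Iic (d + 2, 0)).sup fun m => SchwartzMap.seminorm ℂ m.1 m.2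

theorem continuous_decaySeminorm : Continuous (decaySeminorm d) :=
  Seminorm.continuous_finsetSup fun m _ =>
    (schwartz_withSeminorms ℂ (EuclideanSpace ℝ (Fin d)) ℂ).continuous_seminorm m

theorem norm_le_decaySeminorm (f : 𝓢(EuclideanSpace ℝ (Fin d), ℂ))
    (y : EuclideanSpace ℝ (Fin d)) :
    ‖f y‖ ≤ 2 ^ (d + 2) * decaySeminorm d f * (1 + ‖y‖) ^ (-((d : ℝ) + 2)) := by
  have h := SchwartzMap.one_add_le_sup_seminorm_apply (𝕜 := ℂ) (m := (d + 2, 0)) (k := d + 2)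
    (n := 0) le_rfl le_rfl f y
  rw [norm_iteratedFDeriv_zero] at h
  have hp : (0 : ℝ) < (1 + ‖y‖) ^ (d + 2) := by positivity
  have he : (1 + ‖y‖) ^ (-((d : ℝ) + 2)) = ((1 + ‖y‖) ^ (d + 2))⁻¹ := by
    rw [Real.rpow_neg (by positivity), ← Real.rpow_natCast]
    push_cast
    rfl
  rw [he, ← div_eq_mul_inv, le_div_iff₀ hp, mul_comm]
  exact h

/-- Pairings of functions bounded by the Riesz kernel with Schwartz functions. -/
theorem exists_integral_mul_schwartz_le (hd : 2 ≤ d) (hs : 0 ≤ s) (hsd : s < d) :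
    ∃ C : ℝ, 0 ≤ C ∧ ∀ (u : EuclideanSpace ℝ (Fin d) → ℝ) (D : ℝ), Measurable u → 0 ≤ D →
      (∀ y, y ≠ 0 → |u y| ≤ D * (rieszKernel s y + 1)) →
      ∀ f : 𝓢(EuclideanSpace ℝ (Fin d), ℂ), Integrable (fun y => (u y : ℂ) * f y) ∧
        ‖∫ y, (u y : ℂ) * f y‖ ≤ C * (D * decaySeminorm d f) := by
  have hint := integrable_rieszKernel_mul_one_add_norm_rpow hd hs hsd
  have := nontrivial_euclideanSpace (d := d) (by omega)
  set I := ∫ y : EuclideanSpace ℝ (Fin d), (rieszKernel s y + 1) * (1 + ‖y‖) ^ (-((d : ℝ) + 2))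
  have hI : 0 ≤ I := integral_nonneg fun y =>
    mul_nonneg (by linarith [rieszKernel_nonneg (s := s) y]) (by positivity)
  refine ⟨2 ^ (d + 2) * I, by positivity, fun u D hu hD hle f => ?_⟩
  have hf0 : 0 ≤ decaySeminorm d f := apply_nonneg _ _
  have hb : ∀ᵐ y : EuclideanSpace ℝ (Fin d), ‖(u y : ℂ) * f y‖ ≤ D * (2 ^ (d + 2) *
      decaySeminorm d f) * ((rieszKernel s y + 1) * (1 + ‖y‖) ^ (-((d : ℝ) + 2))) := by
    have h0 : ∀ᵐ y : EuclideanSpace ℝ (Fin d), y ≠ 0 := by simp [ae_iff]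
    refine h0.mono fun y hy => ?_
    rw [norm_mul, Complex.norm_real, Real.norm_eq_abs]
    have hk : 0 ≤ rieszKernel s y + 1 := by linarith [rieszKernel_nonneg (s := s) y]
    calc _ ≤ D * (rieszKernel s y + 1) *
          (2 ^ (d + 2) * decaySeminorm d f * (1 + ‖y‖) ^ (-((d : ℝ) + 2))) :=
          mul_le_mul (hle y hy) (norm_le_decaySeminorm f y) (norm_nonneg _) (by positivity)
      _ = _ := by ring
  have hi : Integrable fun y => (u y : ℂ) * f y :=
    (hint.const_mul _).mono' ((Complex.measurable_ofReal.comp hu).mul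
      f.continuous.measurable).aestronglyMeasurable hb
  refine ⟨hi, (norm_integral_le_of_norm_le (hint.const_mul _) hb).trans_eq ?_⟩
  rw [integral_const_mul]
  ring

/-- Rescaling in the pairing with a Fourier transform. -/
theorem integral_mul_fourier_comp_smul (u : EuclideanSpace ℝ (Fin d) → ℝ) {R : ℝ} (hR : 0 < R)
    {ψ χ : 𝓢(EuclideanSpace ℝ (Fin d), ℂ)} (h : ∀ ξ, χ ξ = ψ (R • ξ)) :
    ∫ x, (u x : ℂ) * (𝓕 χ : 𝓢(EuclideanSpace ℝ (Fin d), ℂ)) x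
      = ∫ y, (u (R • y) : ℂ) * (𝓕 ψ : 𝓢(EuclideanSpace ℝ (Fin d), ℂ)) y := by
  have hF : ∀ y, (𝓕 ψ : 𝓢(EuclideanSpace ℝ (Fin d), ℂ)) y
      = (R ^ d : ℝ) • (𝓕 χ : 𝓢(EuclideanSpace ℝ (Fin d), ℂ)) (R • y) := fun y => by
    rw [SchwartzMap.fourier_coe, SchwartzMap.fourier_coe, Real.fourier_eq, Real.fourier_eq]
    have h1 := Measure.integral_comp_smul (volume : Measure (EuclideanSpace ℝ (Fin d)))
      (fun v => Real.fourierChar (-inner ℝ v y) • ψ v) R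
    have h2 : ∀ v, Real.fourierChar (-inner ℝ v (R • y)) • χ v
        = Real.fourierChar (-inner ℝ (R • v) y) • ψ (R • v) := fun v => by
      rw [h v, real_inner_smul_left, real_inner_smul_right]
    simp_rw [h2]
    rw [h1, finrank_euclideanSpace_fin, smul_smul, abs_of_pos (by positivity),
      mul_inv_cancel₀ (by positivity), one_smul]
  simp_rw [hF]
  have h1 := Measure.integral_comp_smul (volume : Measure (EuclideanSpace ℝ (Fin d)))
    (fun x => (u x : ℂ) * (𝓕 χ : 𝓢(EuclideanSpace ℝ (Fin d), ℂ)) x) R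
  simp_rw [mul_smul_comm]
  rw [integral_smul, h1, finrank_euclideanSpace_fin, smul_smul, abs_of_pos (by positivity),
    mul_inv_cancel₀ (by positivity), one_smul]

end

section Cutoff

variable {d : ℕ}

/-- A smooth cutoff function, equal to one in the unit ball and supported in a ball of radius 2. -/
noncomputable def cutoffBump (d : ℕ) : ContDiffBump (0 : EuclideanSpace ℝ (Fin d)) :=
  ⟨1, 2, one_pos, one_lt_two⟩

/-- The smooth cutoff function as a Schwartz function. -/
noncomputable def cutoffSchwartz (d : ℕ) : 𝓢(EuclideanSpace ℝ (Fin d), ℂ) :=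
  SchwartzMap.postcompCLM (𝕜 := ℝ) Complex.ofRealCLM
    ((cutoffBump d).hasCompactSupport.toSchwartzMap (cutoffBump d).contDiff)

theorem cutoffSchwartz_apply (ξ : EuclideanSpace ℝ (Fin d)) :
    cutoffSchwartz d ξ = (cutoffBump d ξ : ℝ) := rfl

theorem cutoffBump_eq_one {ξ : EuclideanSpace ℝ (Fin d)} (h : ‖ξ‖ ≤ 1) : cutoffBump d ξ = 1 :=
  (cutoffBump d).one_of_mem_closedBall (by simpa [cutoffBump] using h)

theorem cutoffBump_eq_zero {ξ : EuclideanSpace ℝ (Fin d)} (h : 2 ≤ ‖ξ‖) : cutoffBump d ξ = 0 :=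
  (cutoffBump d).zero_of_le_dist (by simpa [cutoffBump] using h)

/-- Homotheties as continuous linear equivalences. -/
noncomputable def homothety (d : ℕ) {R : ℝ} (hR : 0 < R) :
    EuclideanSpace ℝ (Fin d) ≃L[ℝ] EuclideanSpace ℝ (Fin d) :=
  ContinuousLinearEquiv.smulLeft (Units.mk0 R hR.ne')

/-- The function `ξ ↦ φ (ξ / R) θ ξ` with the cutoff function `θ`. -/
noncomputable def dilatedCutoff (φ : 𝓢(EuclideanSpace ℝ (Fin d), ℂ)) {R : ℝ} (hR : 0 < R) :
    𝓢(EuclideanSpace ℝ (Fin d), ℂ) :=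
  SchwartzMap.smulLeftCLM ℂ (cutoffSchwartz d)
    (SchwartzMap.compCLMOfContinuousLinearEquiv ℂ (homothety d (inv_pos.2 hR)) φ)

theorem dilatedCutoff_apply (φ : 𝓢(EuclideanSpace ℝ (Fin d), ℂ)) {R : ℝ} (hR : 0 < R)
    (ξ : EuclideanSpace ℝ (Fin d)) :
    dilatedCutoff φ hR ξ = cutoffSchwartz d ξ * φ (R⁻¹ • ξ) := by
  rw [dilatedCutoff, SchwartzMap.smulLeftCLM_apply_apply (cutoffSchwartz d).hasTemperateGrowth]
  rfl

/-- The function `ξ ↦ φ ξ θ (R ξ)` with the cutoff function `θ`. -/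
noncomputable def cutoffNearZero (φ : 𝓢(EuclideanSpace ℝ (Fin d), ℂ)) {R : ℝ} (hR : 0 < R) :
    𝓢(EuclideanSpace ℝ (Fin d), ℂ) :=
  SchwartzMap.compCLMOfContinuousLinearEquiv ℂ (homothety d hR) (dilatedCutoff φ hR)

theorem cutoffNearZero_apply (φ : 𝓢(EuclideanSpace ℝ (Fin d), ℂ)) {R : ℝ} (hR : 0 < R)
    (ξ : EuclideanSpace ℝ (Fin d)) :
    cutoffNearZero φ hR ξ = dilatedCutoff φ hR (R • ξ) := rfl

theorem norm_iteratedFDeriv_comp_smul_le (φ : 𝓢(EuclideanSpace ℝ (Fin d), ℂ)) (h0 : φ 0 = 0)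
    (i : ℕ) : ∃ C : ℝ, 0 ≤ C ∧ ∀ R : ℝ, 1 ≤ R → ∀ ξ,
      ‖iteratedFDeriv ℝ i (fun ξ => φ (R⁻¹ • ξ)) ξ‖ ≤ C * R⁻¹ * (1 + ‖ξ‖) := by
  rcases Nat.eq_zero_or_pos i with rfl | hi
  · refine ⟨SchwartzMap.seminorm ℝ 0 1 φ, apply_nonneg _ _, fun R hR ξ => ?_⟩
    have h1 : ∀ x ∈ (Set.univ : Set (EuclideanSpace ℝ (Fin d))),
        ‖fderiv ℝ φ x‖ ≤ SchwartzMap.seminorm ℝ 0 1 φ := fun x _ => by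
      rw [← norm_iteratedFDeriv_one]
      exact φ.norm_iteratedFDeriv_le_seminorm ℝ 1 x
    have h2 := convex_univ.norm_image_sub_le_of_norm_fderiv_le
      (fun x _ => φ.differentiableAt) h1 (Set.mem_univ 0) (Set.mem_univ (R⁻¹ • ξ))
    rw [h0, sub_zero, sub_zero, norm_smul, Real.norm_of_nonneg (by positivity)] at h2
    rw [norm_iteratedFDeriv_zero]
    refine h2.trans ?_
    rw [mul_assoc]
    have := apply_nonneg (SchwartzMap.seminorm ℝ 0 1) φ
    gcongr
    linarith
  · refine ⟨SchwartzMap.seminorm ℝ 0 i φ, apply_nonneg _ _, fun R hR ξ => ?_⟩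
    set T : EuclideanSpace ℝ (Fin d) →L[ℝ] EuclideanSpace ℝ (Fin d) :=
      R⁻¹ • ContinuousLinearMap.id ℝ _
    have hR0 : 0 < R := by linarith
    have hT : ‖T‖ ≤ R⁻¹ := by
      refine (norm_smul_le R⁻¹ (ContinuousLinearMap.id ℝ (EuclideanSpace ℝ (Fin d)))).trans ?_
      rw [Real.norm_of_nonneg (by positivity)]
      exact mul_le_of_le_one_right (by positivity) ContinuousLinearMap.norm_id_le
    have h1 := T.iteratedFDeriv_comp_right (φ.smooth ⊤) ξ (i := i) (by exact_mod_cast le_top)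
    have h2 : (fun ξ => φ (R⁻¹ • ξ)) = φ ∘ T := rfl
    rw [h2, h1]
    refine (ContinuousMultilinearMap.norm_compContinuousLinearMap_le _ _).trans ?_
    rw [Finset.prod_const, Finset.card_univ, Fintype.card_fin]
    have h3 : ‖T‖ ^ i ≤ R⁻¹ := (pow_le_pow_left₀ (norm_nonneg _) hT i).trans
      (pow_le_of_le_one (by positivity) (inv_le_one_of_one_le₀ hR) (by omega))
    have h4 := φ.norm_iteratedFDeriv_le_seminorm ℝ i (T ξ)
    calc _ ≤ SchwartzMap.seminorm ℝ 0 i φ * R⁻¹ :=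
          mul_le_mul h4 h3 (by positivity) (apply_nonneg _ _)
      _ ≤ _ := le_mul_of_one_le_right
          (mul_nonneg (apply_nonneg _ _) (by positivity)) (by linarith [norm_nonneg ξ])

theorem seminorm_dilatedCutoff_le (φ : 𝓢(EuclideanSpace ℝ (Fin d), ℂ)) (h0 : φ 0 = 0)
    (k m : ℕ) : ∃ C : ℝ, ∀ (R : ℝ) (hR : 1 ≤ R),
      SchwartzMap.seminorm ℂ k m (dilatedCutoff φ (zero_lt_one.trans_le hR)) ≤ C * R⁻¹ := by
  choose D hD0 hD using norm_iteratedFDeriv_comp_smul_le φ h0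
  set S : ℕ → ℕ → ℝ := fun k j => SchwartzMap.seminorm ℝ k j (cutoffSchwartz d)
  have hS : ∀ k j, 0 ≤ S k j := fun k j => apply_nonneg _ _
  refine ⟨∑ j ∈ Finset.range (m + 1), (m.choose j : ℝ) * (S k j + S (k + 1) j) * D (m - j),
    fun R hR => ?_⟩
  have hR0 : 0 < R := by linarith
  refine SchwartzMap.seminorm_le_bound ℂ k m _ (mul_nonneg (Finset.sum_nonneg fun j _ =>
    mul_nonneg (mul_nonneg (by positivity) (add_nonneg (hS _ _) (hS _ _))) (hD0 _))
    (by positivity)) fun ξ => ?_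
  have he : (dilatedCutoff φ hR0 : EuclideanSpace ℝ (Fin d) → ℂ)
      = fun ξ => cutoffSchwartz d ξ • (fun ξ => φ (R⁻¹ • ξ)) ξ := by
    funext ξ; rw [dilatedCutoff_apply]; rfl
  have hc : ContDiff ℝ ∞ fun ξ => φ (R⁻¹ • ξ) := (φ.smooth ⊤).comp (contDiff_id.const_smul R⁻¹)
  rw [he]
  refine (mul_le_mul_of_nonneg_left (norm_iteratedFDeriv_smul_le ((cutoffSchwartz d).smooth ⊤) hc ξ
    (n := m) (by exact_mod_cast le_top)) (by positivity)).trans ?_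
  rw [Finset.mul_sum, Finset.sum_mul]
  refine Finset.sum_le_sum fun j _ => ?_
  have h1 := (cutoffSchwartz d).le_seminorm ℝ k j ξ
  have h2 := (cutoffSchwartz d).le_seminorm ℝ (k + 1) j ξ
  set a := ‖iteratedFDeriv ℝ j (cutoffSchwartz d) ξ‖
  calc ‖ξ‖ ^ k * ((m.choose j : ℝ) * a * ‖iteratedFDeriv ℝ (m - j) (fun ξ => φ (R⁻¹ • ξ)) ξ‖)
      ≤ ‖ξ‖ ^ k * ((m.choose j : ℝ) * a * (D (m - j) * R⁻¹ * (1 + ‖ξ‖))) := by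
        gcongr
        exact hD _ R hR ξ
    _ = (m.choose j : ℝ) * (‖ξ‖ ^ k * a + ‖ξ‖ ^ (k + 1) * a) * D (m - j) * R⁻¹ := by ring
    _ ≤ _ := by
        have := hD0 (m - j)
        gcongr

end Cutoff

section

variable {d : ℕ} {s M A L : ℝ} {g : EuclideanSpace ℝ (Fin d) → ℝ}

theorem rieszKernel_smul_nat_le (hs : 0 ≤ s) {R : ℝ} (hR : 1 ≤ R) {y : EuclideanSpace ℝ (Fin d)}
    (hy : y ≠ 0) : rieszKernel s (R • y) ≤ (1 + Real.log R) * (rieszKernel s y + 1) := by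
  have hR0 : 0 < R := by linarith
  have h := rieszKernel_smul_le (s := s) hR0 hy
  have hl : 0 ≤ Real.log R := Real.log_nonneg hR
  have h1 : R ^ (-s) ≤ 1 := Real.rpow_le_one_of_one_le_of_nonpos hR (by linarith)
  have h2 : logIf (s = 0) R ≤ Real.log R := by
    unfold logIf; split_ifs
    · rw [abs_of_nonneg hl]
    · exact hl
  have h3 : 0 ≤ 1 / ‖y‖ ^ s := by positivity
  have h4 : R ^ (-s) * (1 / ‖y‖ ^ s) ≤ 1 / ‖y‖ ^ s := mul_le_of_le_one_left h3 h1
  have h5 : rieszKernel s y = 1 / ‖y‖ ^ s + logIf (s = 0) ‖y‖ := rfl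
  have h6 := rieszKernel_nonneg (s := s) y
  nlinarith [mul_nonneg hl h6]

/-- Cutting off a Schwartz function vanishing at the origin near the origin does not change its
pairing with a tame potential in the limit. -/
theorem TamePotential.tendsto_integral_mul_fourier_cutoffNearZero (hg : TamePotential s M A L g)
    (hd : 2 ≤ d) (hs : 0 ≤ s) (hsd : s < d) (φ : 𝓢(EuclideanSpace ℝ (Fin d), ℂ)) (h0 : φ 0 = 0) :
    Tendsto (fun n : ℕ => ∫ x, (g x : ℂ) *
      (𝓕 (cutoffNearZero φ (Nat.cast_add_one_pos (α := ℝ) n)) :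
        𝓢(EuclideanSpace ℝ (Fin d), ℂ)) x) atTop (𝓝 0) := by
  obtain ⟨C, hC0, hC⟩ := exists_integral_mul_schwartz_le hd hs hsd
  have hA := hg.nonneg_left
  set ψ : ℕ → 𝓢(EuclideanSpace ℝ (Fin d), ℂ) := fun n =>
    dilatedCutoff φ (Nat.cast_add_one_pos (α := ℝ) n) with hψ
  set l : ℕ → ℝ := fun n => 1 + Real.log ((n : ℝ) + 1) with hl
  have hR : ∀ n : ℕ, (1 : ℝ) ≤ (n : ℝ) + 1 := fun n => by linarith [Nat.cast_nonneg (α := ℝ) n]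
  have hl0 : ∀ n, 0 ≤ l n := fun n => by have := Real.log_nonneg (hR n); positivity
  have hlim : Tendsto (fun n => (l n : ℂ) • ψ n) atTop (𝓝 0) := by
    rw [(schwartz_withSeminorms ℂ (EuclideanSpace ℝ (Fin d)) ℂ).tendsto_nhds]
    intro km ε hε
    obtain ⟨D, hD⟩ := seminorm_dilatedCutoff_le φ h0 km.1 km.2
    have ht : Tendsto (fun n : ℕ => l n * (D * ((n : ℝ) + 1)⁻¹)) atTop (𝓝 0) := by
      have h1 : Tendsto (fun x : ℝ => (1 + Real.log x) * (D * x⁻¹)) atTop (𝓝 0) := by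
        have h2 : Tendsto (fun x : ℝ => D * (x⁻¹ + Real.log x / x)) atTop (𝓝 (D * (0 + 0))) :=
          (tendsto_inv_atTop_zero.add
            (by simpa using Real.tendsto_pow_log_div_mul_add_atTop 1 0 1 one_ne_zero)).const_mul D
        simp only [add_zero, mul_zero] at h2
        refine h2.congr fun x => ?_
        rw [div_eq_mul_inv]; ring
      exact h1.comp (tendsto_atTop_add_const_right _ 1 tendsto_natCast_atTop_atTop)
    filter_upwards [ht.eventually (gt_mem_nhds hε)] with n hn
    rw [sub_zero, map_smul_eq_mul, Complex.norm_real, Real.norm_of_nonneg (hl0 n)]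
    exact lt_of_le_of_lt (mul_le_mul_of_nonneg_left (hD _ (hR n)) (hl0 n)) hn
  have hF : Tendsto (fun n => decaySeminorm d (𝓕 ((l n : ℂ) • ψ n))) atTop (𝓝 0) := by
    have hc : Continuous fun f : 𝓢(EuclideanSpace ℝ (Fin d), ℂ) => decaySeminorm d (𝓕 f) :=
      continuous_decaySeminorm.comp FourierTransform.continuous_fourier
    have := (hc.tendsto 0).comp hlim
    rw [FourierTransform.fourier_zero, map_zero] at this
    exact this
  have hF' := hF.const_mul (C * A)
  rw [mul_zero] at hF'
  refine squeeze_zero_norm (fun n => ?_) hF'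
  have h1 : ∀ ξ, cutoffNearZero φ (Nat.cast_add_one_pos (α := ℝ) n) ξ
      = ψ n (((n : ℝ) + 1) • ξ) := fun ξ => rfl
  rw [integral_mul_fourier_comp_smul g (Nat.cast_add_one_pos (α := ℝ) n) h1]
  have hb := (hC (fun y => g (((n : ℝ) + 1) • y)) (A * l n)
    (hg.measurable.comp (measurable_const_smul _)) (mul_nonneg hA (hl0 n)) (fun y hy => by
      refine (hg.abs_bound _ (smul_ne_zero (by have := hR n; positivity) hy)).trans ?_
      rw [mul_assoc]
      exact mul_le_mul_of_nonneg_left (rieszKernel_smul_nat_le hs (hR n) hy) hA)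
    (𝓕 (ψ n))).2
  refine hb.trans_eq ?_
  rw [FourierTransform.fourier_smul, map_smul_eq_mul, Complex.norm_real,
    Real.norm_of_nonneg (hl0 n)]
  ring

end

section

variable {d : ℕ} {s M A L : ℝ} {g : EuclideanSpace ℝ (Fin d) → ℝ}

/-- The pairing of a tame potential with the Fourier transform of a nonnegative Schwartz function
that vanishes at the origin is bounded below if the Fourier transform of the potential is. -/
theorem TamePotential.lintegral_le_pairing (hg : TamePotential s M A L g)
    (hd : 2 ≤ d) (hs : 0 ≤ s) (hsd : s < d) {G : EuclideanSpace ℝ (Fin d) → ℝ} (hG : Measurable G)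
    (hF : HasFourierAwayFromZero g G) {C₁ C₂ : ℝ} (hC₁ : 0 < C₁)
    (hGb : ∀ ξ, ξ ≠ 0 → C₁ / ‖ξ‖ ^ ((d : ℝ) - s) ≤ G ξ ∧ G ξ ≤ C₂ / ‖ξ‖ ^ ((d : ℝ) - s))
    (φ : 𝓢(EuclideanSpace ℝ (Fin d), ℂ)) (h0 : φ 0 = 0) {f : EuclideanSpace ℝ (Fin d) → ℝ}
    (hf : ∀ ξ, φ ξ = (f ξ : ℂ)) (hf0 : ∀ ξ, 0 ≤ f ξ) :
    ∫⁻ ξ, ENNReal.ofReal (C₁ / ‖ξ‖ ^ ((d : ℝ) - s) * f ξ)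
      ≤ ENNReal.ofReal (∫ x, (g x : ℂ) * (𝓕 φ : 𝓢(EuclideanSpace ℝ (Fin d), ℂ)) x).re := by
  have hnt := nontrivial_euclideanSpace (d := d) (by omega)
  have hae0 : ∀ᵐ y : EuclideanSpace ℝ (Fin d), y ≠ 0 := by simp [ae_iff]
  have he : 0 < (d : ℝ) - s := by linarith
  have hR : ∀ n : ℕ, (0 : ℝ) < (n : ℝ) + 1 := fun n => Nat.cast_add_one_pos n
  obtain ⟨C, -, hC⟩ := exists_integral_mul_schwartz_le hd hs hsd
  have hfe : f = fun ξ => (φ ξ).re := by funext ξ; rw [hf ξ, Complex.ofReal_re]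
  have hfc : Continuous f := by rw [hfe]; exact Complex.continuous_re.comp φ.continuous
  set w : ℕ → EuclideanSpace ℝ (Fin d) → ℝ := fun n ξ => 1 - cutoffBump d (((n : ℝ) + 1) • ξ)
    with hw
  have hw0 : ∀ n ξ, 0 ≤ w n ξ := fun n ξ => sub_nonneg.2 (cutoffBump d).le_one
  have hw1 : ∀ n ξ, w n ξ ≤ 1 := fun n ξ => sub_le_self _ (cutoffBump d).nonneg
  have hwz : ∀ (n : ℕ) ξ, ‖ξ‖ ≤ ((n : ℝ) + 1)⁻¹ → w n ξ = 0 := fun n ξ h => by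
    have : ‖((n : ℝ) + 1) • ξ‖ ≤ 1 := by
      rw [norm_smul, Real.norm_of_nonneg (hR n).le]
      calc ((n : ℝ) + 1) * ‖ξ‖ ≤ ((n : ℝ) + 1) * ((n : ℝ) + 1)⁻¹ := by gcongr
        _ = 1 := mul_inv_cancel₀ (hR n).ne'
    simp only [w]
    rw [cutoffBump_eq_one this, sub_self]
  have hwc : ∀ n, Continuous (w n) := fun n =>
    continuous_const.sub ((cutoffBump d).continuous.comp (continuous_const_smul _))
  set Φ : ℕ → 𝓢(EuclideanSpace ℝ (Fin d), ℂ) := fun n => φ - cutoffNearZero φ (hR n) with hΦ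
  have hΦa : ∀ n ξ, Φ n ξ = ((f ξ * w n ξ : ℝ) : ℂ) := fun n ξ => by
    have h1 : Φ n ξ = φ ξ - cutoffNearZero φ (hR n) ξ := rfl
    rw [h1, cutoffNearZero_apply, dilatedCutoff_apply, cutoffSchwartz_apply, smul_smul,
      inv_mul_cancel₀ (hR n).ne', one_smul, hf ξ]
    simp only [w]
    push_cast
    ring
  have hsupp : ∀ n, (0 : EuclideanSpace ℝ (Fin d)) ∉ tsupport (Φ n) := fun n => by
    rw [notMem_tsupport_iff_eventuallyEq]
    filter_upwards [Metric.ball_mem_nhds (0 : EuclideanSpace ℝ (Fin d)) (inv_pos.2 (hR n))]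
      with ξ hξ
    rw [mem_ball_zero_iff] at hξ
    rw [hΦa, hwz n ξ hξ.le, mul_zero, Complex.ofReal_zero, Pi.zero_apply]
  -- integrability on the Fourier side
  have hGi : ∀ n, Integrable fun ξ => G ξ * (f ξ * w n ξ) := fun n => by
    have hφi : Integrable fun ξ => |C₂| * (((n : ℝ) + 1)⁻¹ ^ ((d : ℝ) - s))⁻¹ * ‖φ ξ‖ :=
      φ.integrable.norm.const_mul _
    refine hφi.mono' (hG.mul (hfc.measurable.mul (hwc n).measurable)).aestronglyMeasurable
      (hae0.mono fun ξ hξ => ?_)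
    have hξ' := norm_pos_iff.2 hξ
    have hG0 : 0 ≤ G ξ := le_trans (by positivity) (hGb ξ hξ).1
    rw [Real.norm_of_nonneg (mul_nonneg hG0 (mul_nonneg (hf0 ξ) (hw0 n ξ)))]
    rcases le_or_gt ‖ξ‖ ((n : ℝ) + 1)⁻¹ with h | h
    · rw [hwz n ξ h, mul_zero, mul_zero]; have := hR n; positivity
    · have h1 : f ξ * w n ξ ≤ ‖φ ξ‖ := by
        rw [hf ξ, Complex.norm_real, Real.norm_of_nonneg (hf0 ξ)]
        exact mul_le_of_le_one_right (hf0 ξ) (hw1 n ξ)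
      have h2 : G ξ ≤ |C₂| * (((n : ℝ) + 1)⁻¹ ^ ((d : ℝ) - s))⁻¹ := by
        refine (hGb ξ hξ).2.trans ?_
        rw [div_eq_mul_inv]
        have := inv_pos.2 (hR n)
        gcongr
        exact le_abs_self _
      exact mul_le_mul h2 h1
        (mul_nonneg (hf0 ξ) (hw0 n ξ)) (le_trans hG0 h2)
  have hint : ∀ f : 𝓢(EuclideanSpace ℝ (Fin d), ℂ), Integrable fun x => (g x : ℂ) * f x := fun f =>
    (hC g A hg.measurable hg.nonneg_left (fun y hy => (hg.abs_bound y hy).trans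
      (mul_le_mul_of_nonneg_left (by linarith) hg.nonneg_left)) f).1
  have hpair : ∀ n, ∫ x, (g x : ℂ) * (𝓕 (Φ n) : 𝓢(EuclideanSpace ℝ (Fin d), ℂ)) x
      = (∫ ξ, G ξ * (f ξ * w n ξ) : ℝ) := fun n => by
    rw [hF (Φ n) (hsupp n), ← integral_complex_ofReal]
    refine integral_congr_ae (ae_of_all _ fun ξ => ?_)
    dsimp only
    rw [hΦa]
    push_cast
    rfl
  have hsplit : ∀ n, ∫ x, (g x : ℂ) * (𝓕 (Φ n) : 𝓢(EuclideanSpace ℝ (Fin d), ℂ)) x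
      = (∫ x, (g x : ℂ) * (𝓕 φ : 𝓢(EuclideanSpace ℝ (Fin d), ℂ)) x)
        - ∫ x, (g x : ℂ) * (𝓕 (cutoffNearZero φ (hR n)) :
          𝓢(EuclideanSpace ℝ (Fin d), ℂ)) x := fun n => by
    rw [← integral_sub (hint _) (hint _)]
    refine integral_congr_ae (ae_of_all _ fun x => ?_)
    dsimp only
    rw [← mul_sub]
    have : 𝓕 (Φ n) = 𝓕 φ - 𝓕 (cutoffNearZero φ (hR n)) := (FourierTransform.fourierCLM ℂ 𝓢(EuclideanSpace ℝ (Fin d), ℂ)).map_sub _ _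
    rw [this]
    rfl
  set T := ∫ x, (g x : ℂ) * (𝓕 φ : 𝓢(EuclideanSpace ℝ (Fin d), ℂ)) x with hT
  have hlim : Tendsto (fun n => ∫ ξ, G ξ * (f ξ * w n ξ)) atTop (𝓝 T.re) := by
    have h1 := (hg.tendsto_integral_mul_fourier_cutoffNearZero hd hs hsd φ h0).const_sub T
    rw [sub_zero] at h1
    refine ((Complex.continuous_re.tendsto T).comp h1).congr fun n => ?_
    simp only [Function.comp_apply]
    rw [← hsplit n, hpair n, Complex.ofReal_re]
  have hlim' := (ENNReal.continuous_ofReal.tendsto T.re).comp hlim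
  refine le_trans ?_ hlim'.liminf_eq.le
  have hfat : ∫⁻ ξ, ENNReal.ofReal (C₁ / ‖ξ‖ ^ ((d : ℝ) - s) * f ξ)
      ≤ ∫⁻ ξ, liminf (fun n => ENNReal.ofReal (C₁ / ‖ξ‖ ^ ((d : ℝ) - s) * (f ξ * w n ξ))) atTop := by
    refine lintegral_mono_ae (hae0.mono fun ξ hξ => le_of_eq (Eq.symm ?_))
    refine Tendsto.liminf_eq (tendsto_const_nhds.congr' ?_)
    have hξ' := norm_pos_iff.2 hξ
    filter_upwards [eventually_ge_atTop ⌈2 / ‖ξ‖⌉₊] with n hn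
    have h1 : 2 / ‖ξ‖ ≤ n := (Nat.le_ceil _).trans (by exact_mod_cast hn)
    have h2 : 2 ≤ ‖((n : ℝ) + 1) • ξ‖ := by
      rw [norm_smul, Real.norm_of_nonneg (hR n).le]
      rw [div_le_iff₀ hξ'] at h1
      nlinarith
    have h3 : w n ξ = 1 := by
      simp only [w]
      rw [cutoffBump_eq_zero h2, sub_zero]
    rw [h3, mul_one]
  refine hfat.trans ((lintegral_liminf_le fun n => ?_).trans (liminf_le_liminf
    (Eventually.of_forall fun n => ?_)))
  · exact ((measurable_const.div (measurable_norm.pow_const _)).mul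
      (hfc.measurable.mul (hwc n).measurable)).ennreal_ofReal
  · simp only [Function.comp_apply]
    rw [ofReal_integral_eq_lintegral_ofReal (hGi n) (hae0.mono fun ξ hξ => mul_nonneg
      (le_trans (by have := norm_pos_iff.2 hξ; positivity) (hGb ξ hξ).1)
      (mul_nonneg (hf0 ξ) (hw0 n ξ)))]
    refine lintegral_mono_ae (hae0.mono fun ξ hξ => ENNReal.ofReal_le_ofReal ?_)
    exact mul_le_mul_of_nonneg_right (hGb ξ hξ).1 (mul_nonneg (hf0 ξ) (hw0 n ξ))

end

section

variable {d : ℕ} {s M A L b : ℝ} {g : EuclideanSpace ℝ (Fin d) → ℝ}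
  {P : Measure (EuclideanSpace ℝ (Fin d))}

namespace TamePotential

theorem integrable_sub_gaussianMeasure (hg : TamePotential s M A L g) (hd : 2 ≤ d) (hs : 0 ≤ s)
    (hsd : s < d) (hb : 0 < b) (z : EuclideanSpace ℝ (Fin d)) :
    Integrable (fun y => g (z - y)) (gaussianMeasure d b) := by
  have := isProbabilityMeasure_gaussianMeasure (d := d) hb
  have h := hg.integrable_prod hd hs hsd (α := Measure.dirac z)
    gaussianMeasure_absolutelyContinuous (densitySup_gaussianMeasure_ne_top hb)
    (integrable_dirac_real _ _) (integrable_logGrowth_gaussianMeasure hb)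
  rw [integrable_prod_iff h.1] at h
  simpa using h.1

theorem integral_sub_gaussianMeasure_le (hg : TamePotential s M A L g) (hd : 2 ≤ d) (hs : 0 ≤ s)
    (hsd : s < d) (hb : 0 < b) {z : EuclideanSpace ℝ (Fin d)} (hz : z ≠ 0) :
    ∫ y, g (z - y) ∂(gaussianMeasure d b)
      ≤ g z + M / (2 * d) * ∫ y, ‖y‖ ^ 2 ∂(gaussianMeasure d b) := by
  obtain ⟨C, -, hC⟩ := integral_sq_norm_gaussianMeasure_le d
  have hp := Real.pi_pos
  have h1 := (integrable_gaussianMeasure_iff hb).1 (hg.integrable_sub_gaussianMeasure hd hs hsd hb z)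
  have h2 : Integrable fun y => g (z + y) * gaussianDensity b y := by
    refine h1.comp_neg.congr (ae_of_all _ fun y => ?_)
    simp [gaussianDensity_neg]
  have h3 := (integrable_gaussianMeasure_iff hb).1 (hC b hb).1
  have h4 := integrable_gaussianDensity (d := d) hb
  have he : (fun y => (g (z + y) - g z - M / (2 * d) * ‖y‖ ^ 2) *
      (fun r => (Real.pi / b) ^ ((d : ℝ) / 2) * Real.exp (-(Real.pi ^ 2 / b) * r ^ 2)) ‖y‖)
      = fun y => g (z + y) * gaussianDensity b y - g z * gaussianDensity b y
        - M / (2 * d) * (‖y‖ ^ 2 * gaussianDensity b y) := by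
    funext y; simp only [gaussianDensity]; ring
  have h5 := hg.integral_radial_le hd hz
    (w := fun r => (Real.pi / b) ^ ((d : ℝ) / 2) * Real.exp (-(Real.pi ^ 2 / b) * r ^ 2))
    (fun r => by positivity)
  rw [he] at h5
  have h6 := h5 ((h2.sub (h4.const_mul _)).sub (h3.const_mul _))
  have h24 : Integrable fun y => g (z + y) * gaussianDensity b y - g z * gaussianDensity b y :=
    h2.sub (h4.const_mul _)
  rw [integral_sub h24 (h3.const_mul _), integral_sub h2 (h4.const_mul _), integral_const_mul,
    integral_const_mul, integral_gaussianDensity hb] at h6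
  have h7 : ∫ y, g (z - y) ∂(gaussianMeasure d b) = ∫ y, g (z + y) * gaussianDensity b y := by
    rw [integral_gaussianMeasure hb, ← integral_neg_eq_self]
    simp [gaussianDensity_neg]
  rw [h7, integral_gaussianMeasure hb]
  linarith

theorem exists_le_integral_sub_gaussianMeasure (hg : TamePotential s M A L g) (hd : 2 ≤ d)
    (hs : 0 ≤ s) (hsd : s < d) : ∃ D : ℝ, 0 ≤ D ∧ ∀ b : ℝ, 0 < b →
      ∀ z : EuclideanSpace ℝ (Fin d),
      -(D * (1 + logGrowth s z + (1 + ∫ y, ‖y‖ ^ 2 ∂(gaussianMeasure d b))))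
        ≤ ∫ y, g (z - y) ∂(gaussianMeasure d b) := by
  obtain ⟨D, hD0, hD⟩ := hg.exists_lower_bound_logGrowth hs
  obtain ⟨C, -, hC⟩ := integral_sq_norm_gaussianMeasure_le d
  refine ⟨D, hD0, fun b hb z => ?_⟩
  have := isProbabilityMeasure_gaussianMeasure (d := d) hb
  have := nullSingletonClass_of_absolutelyContinuous hd
    (gaussianMeasure_absolutelyContinuous (d := d) (b := b))
  have hae : ∀ᵐ y ∂(gaussianMeasure d b), y ≠ z := by simp [ae_iff]
  have h1 : Integrable (fun y => -(D * (1 + logGrowth s z + (1 + ‖y‖ ^ 2))))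
      (gaussianMeasure d b) :=
    (((integrable_const _).add ((integrable_const _).add (hC b hb).1)).const_mul D).neg
  have h2 := integral_mono_ae h1 (hg.integrable_sub_gaussianMeasure hd hs hsd hb z)
    (hae.mono fun y hy => by
      refine le_trans (neg_le_neg (mul_le_mul_of_nonneg_left ?_ hD0)) (hD _ (sub_ne_zero.2 hy.symm))
      linarith [logGrowth_sub_le (s := s) z y, logGrowth_le_one_add_sq (s := s) y])
  have h3 : Integrable (fun y => 1 + ‖y‖ ^ 2) (gaussianMeasure d b) :=
    (integrable_const _).add (hC b hb).1
  refine le_trans (le_of_eq ?_) h2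
  rw [integral_neg, integral_const_mul, integral_add (integrable_const _) h3,
    integral_add (integrable_const _) (hC b hb).1]
  simp

theorem exists_sub_le_integral_sub_gaussianMeasure (hg : TamePotential s M A L g) (hd : 2 ≤ d)
    (hs : 0 ≤ s) (hsd : s < d) {z : EuclideanSpace ℝ (Fin d)} (hz : z ≠ 0) {ε : ℝ} (hε : 0 < ε) :
    ∃ D : ℝ, ∀ b : ℝ, 0 < b →
      g z - ε - D * ∫ y, ‖y‖ ^ 2 ∂(gaussianMeasure d b) ≤ ∫ y, g (z - y) ∂(gaussianMeasure d b) := by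
  obtain ⟨D, hD0, hD⟩ := hg.exists_lower_bound_logGrowth hs
  obtain ⟨C, -, hC⟩ := integral_sq_norm_gaussianMeasure_le d
  obtain ⟨δ, hδ, hδc⟩ := Metric.continuousAt_iff.1 (hg.continuousAt hz) ε hε
  have hl := logGrowth_nonneg (s := s) z
  set D' := D + (D * (2 + logGrowth s z) + |g z|) / δ ^ 2 with hD'
  have hD'0 : 0 ≤ D' := by positivity
  refine ⟨D', fun b hb => ?_⟩
  have := isProbabilityMeasure_gaussianMeasure (d := d) hb
  have := nullSingletonClass_of_absolutelyContinuous hd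
    (gaussianMeasure_absolutelyContinuous (d := d) (b := b))
  have hae : ∀ᵐ y ∂(gaussianMeasure d b), y ≠ z := by simp [ae_iff]
  have h1 : Integrable (fun y => g z - ε - D' * ‖y‖ ^ 2) (gaussianMeasure d b) :=
    (integrable_const _).sub ((hC b hb).1.const_mul D')
  have h2 := integral_mono_ae h1 (hg.integrable_sub_gaussianMeasure hd hs hsd hb z)
    (hae.mono fun y hy => by
      dsimp only
      rcases lt_or_ge ‖y‖ δ with h | h
      · have h3 := hδc (x := z - y) (by rw [dist_eq_norm]; simpa using h)
        rw [Real.dist_eq, abs_lt] at h3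
        have : 0 ≤ D' * ‖y‖ ^ 2 := by positivity
        linarith
      · have h3 := hD _ (sub_ne_zero.2 hy.symm)
        have h4 : D * (1 + logGrowth s (z - y)) ≤ D * (2 + logGrowth s z + ‖y‖ ^ 2) :=
          mul_le_mul_of_nonneg_left (by
            linarith [logGrowth_sub_le (s := s) z y, logGrowth_le_one_add_sq (s := s) y]) hD0
        have h5 : D * (2 + logGrowth s z) + |g z|
            ≤ (D * (2 + logGrowth s z) + |g z|) / δ ^ 2 * ‖y‖ ^ 2 := by
          rw [div_mul_eq_mul_div, le_div_iff₀ (by positivity)]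
          gcongr
        have h6 : D' * ‖y‖ ^ 2
            = D * ‖y‖ ^ 2 + (D * (2 + logGrowth s z) + |g z|) / δ ^ 2 * ‖y‖ ^ 2 := by
          rw [hD']; ring
        linarith [le_abs_self (g z)])
  refine le_trans (le_of_eq ?_) h2
  rw [integral_sub (integrable_const _) ((hC b hb).1.const_mul D'), integral_const_mul]
  simp

/-- Averages of a tame potential over small Gaussians converge, with domination. -/
theorem tendsto_integral_integral_gaussianMeasure (hg : TamePotential s M A L g) (hd : 2 ≤ d)
    (hs : 0 ≤ s) (hsd : s < d) [IsFiniteMeasure P] (hP0 : ∀ᵐ z ∂P, z ≠ 0) (hPg : Integrable g P)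
    (hPl : Integrable (logGrowth s) P) :
    Tendsto (fun n : ℕ => ∫ z, ∫ y, g (z - y) ∂(gaussianMeasure d ((n : ℝ) + 1)⁻¹) ∂P) atTop
      (𝓝 (∫ z, g z ∂P)) := by
  obtain ⟨C, hC0, hC⟩ := integral_sq_norm_gaussianMeasure_le d
  obtain ⟨D, hD0, hD⟩ := hg.exists_le_integral_sub_gaussianMeasure hd hs hsd
  have hM := hg.nonneg
  have hb : ∀ n : ℕ, (0 : ℝ) < ((n : ℝ) + 1)⁻¹ := fun n => inv_pos.2 (Nat.cast_add_one_pos n)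
  have hm0 : ∀ n : ℕ, 0 ≤ ∫ y, ‖y‖ ^ 2 ∂(gaussianMeasure d ((n : ℝ) + 1)⁻¹) := fun n =>
    integral_nonneg fun y => by positivity
  have hm1 : ∀ n : ℕ, ∫ y, ‖y‖ ^ 2 ∂(gaussianMeasure d ((n : ℝ) + 1)⁻¹) ≤ C := fun n =>
    (hC _ (hb n)).2.trans (mul_le_of_le_one_right hC0 (inv_le_one_of_one_le₀ (by simp)))
  have hmlim : Tendsto (fun n : ℕ => ∫ y, ‖y‖ ^ 2 ∂(gaussianMeasure d ((n : ℝ) + 1)⁻¹)) atTop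
      (𝓝 0) := by
    refine squeeze_zero hm0 (fun n => (hC _ (hb n)).2) ?_
    have := (tendsto_one_div_add_atTop_nhds_zero_nat (𝕜 := ℝ)).const_mul C
    simpa using this
  refine tendsto_integral_of_dominated_convergence
    (fun z => |g z| + M / (2 * d) * C + D * (1 + logGrowth s z + (1 + C))) (fun n => ?_) ?_
    (fun n => hP0.mono fun z hz => ?_) (hP0.mono fun z hz => ?_)
  · have := isProbabilityMeasure_gaussianMeasure (d := d) (hb n)
    exact (hg.integrable_prod hd hs hsd gaussianMeasure_absolutelyContinuous
      (densitySup_gaussianMeasure_ne_top (hb n)) hPl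
      (integrable_logGrowth_gaussianMeasure (hb n))).integral_prod_left.1
  · exact (hPg.abs.add (integrable_const _)).add
      ((((integrable_const _).add hPl).add (integrable_const _)).const_mul D)
  · have h1 := hg.integral_sub_gaussianMeasure_le hd hs hsd (hb n) hz
    have h2 := hD _ (hb n) z
    have h3 : M / (2 * d) * ∫ y, ‖y‖ ^ 2 ∂(gaussianMeasure d ((n : ℝ) + 1)⁻¹)
        ≤ M / (2 * d) * C := mul_le_mul_of_nonneg_left (hm1 n) (by positivity)
    have h4 : D * (1 + logGrowth s z + (1 + ∫ y, ‖y‖ ^ 2 ∂(gaussianMeasure d ((n : ℝ) + 1)⁻¹)))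
        ≤ D * (1 + logGrowth s z + (1 + C)) := by gcongr; exact hm1 n
    have h5 : 0 ≤ M / (2 * d) * C := by positivity
    have h6 : 0 ≤ D * (1 + logGrowth s z + (1 + C)) := by
      have := logGrowth_nonneg (s := s) z
      positivity
    rw [Real.norm_eq_abs, _root_.abs_le]
    constructor <;> linarith [le_abs_self (g z), abs_nonneg (g z)]
  · rw [Metric.tendsto_atTop']
    intro ε hε
    obtain ⟨D₂, hD₂⟩ := hg.exists_sub_le_integral_sub_gaussianMeasure hd hs hsd hz (half_pos hε)
    have ht1 := (hmlim.const_mul D₂).eventually (gt_mem_nhds (show D₂ * 0 < ε / 2 by simpa using half_pos hε))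
    have ht2 := (hmlim.const_mul (M / (2 * d))).eventually
      (gt_mem_nhds (show M / (2 * d) * 0 < ε by simpa using hε))
    obtain ⟨N, hN⟩ := eventually_atTop.1 (ht1.and ht2)
    refine ⟨N, fun n hn => ?_⟩
    obtain ⟨h1, h2⟩ := hN n hn.le
    have h3 := hD₂ _ (hb n)
    have h4 := hg.integral_sub_gaussianMeasure_le hd hs hsd (hb n) hz
    rw [Real.dist_eq, abs_lt]
    constructor <;> linarith

end TamePotential

/-- The law of the difference of independent variables. -/
noncomputable def differenceMeasure (α β : Measure (EuclideanSpace ℝ (Fin d))) :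
    Measure (EuclideanSpace ℝ (Fin d)) := (α.prod β).map fun p => p.1 - p.2

variable {α β m : Measure (EuclideanSpace ℝ (Fin d))}

theorem measurable_sub_prod : Measurable
    fun p : EuclideanSpace ℝ (Fin d) × EuclideanSpace ℝ (Fin d) => p.1 - p.2 :=
  measurable_fst.sub measurable_snd

theorem isFiniteMeasure_differenceMeasure [IsFiniteMeasure α] [IsFiniteMeasure β] :
    IsFiniteMeasure (differenceMeasure α β) :=
  Measure.isFiniteMeasure_map _ _

theorem ae_norm_le_differenceMeasure [IsFiniteMeasure α] [IsFiniteMeasure β] {R : ℝ}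
    (hα : ∀ᵐ z ∂α, ‖z‖ ≤ R) (hβ : ∀ᵐ z ∂β, ‖z‖ ≤ R) :
    ∀ᵐ z ∂(differenceMeasure α β), ‖z‖ ≤ 2 * R := by
  rw [differenceMeasure, ae_map_iff measurable_sub_prod.aemeasurable
    (measurableSet_le measurable_norm measurable_const)]
  have h1 : ∀ᵐ p ∂(α.prod β), ‖p.1‖ ≤ R := Measure.quasiMeasurePreserving_fst.ae hα
  have h2 : ∀ᵐ p ∂(α.prod β), ‖p.2‖ ≤ R := Measure.quasiMeasurePreserving_snd.ae hβ
  filter_upwards [h1, h2] with p hp1 hp2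
  linarith [norm_sub_le p.1 p.2]

theorem charFun_differenceMeasure [IsFiniteMeasure α] [IsFiniteMeasure β]
    (t : EuclideanSpace ℝ (Fin d)) :
    charFun (differenceMeasure α β) t = charFun α t * (starRingEnd ℂ) (charFun β t) := by
  rw [← charFun_neg, charFun_apply, charFun_apply, charFun_apply, differenceMeasure,
    integral_map measurable_sub_prod.aemeasurable (by fun_prop), ← integral_prod_mul]
  refine integral_congr_ae (ae_of_all _ fun p => ?_)
  dsimp only
  rw [← Complex.exp_add, inner_sub_left, inner_neg_right]
  push_cast
  congr 1
  ring

theorem integral_differenceMeasure (hg : Measurable g) :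
    ∫ z, g z ∂(differenceMeasure α β) = ∫ p, g (p.1 - p.2) ∂(α.prod β) :=
  integral_map measurable_sub_prod.aemeasurable hg.aestronglyMeasurable

theorem normSq_sub_eq (u v : ℂ) : u * (starRingEnd ℂ) u + v * (starRingEnd ℂ) v
    - u * (starRingEnd ℂ) v - v * (starRingEnd ℂ) u = ((‖u - v‖ ^ 2 : ℝ) : ℂ) := by
  rw [← Complex.normSq_eq_norm_sq, ← Complex.mul_conj, map_sub]
  ring

/-- The interaction energy of compactly supported measures controls the Sobolev norm of their
difference. -/
theorem TamePotential.homogeneousSobolevSq_le_of_bounded (hg : TamePotential s M A L g)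
    (hd : 2 ≤ d) (hs : 0 ≤ s) (hsd : s < d) {G : EuclideanSpace ℝ (Fin d) → ℝ} (hG : Measurable G)
    (hF : HasFourierAwayFromZero g G) {C₁ C₂ : ℝ} (hC₁ : 0 < C₁)
    (hGb : ∀ ξ, ξ ≠ 0 → C₁ / ‖ξ‖ ^ ((d : ℝ) - s) ≤ G ξ ∧ G ξ ≤ C₂ / ‖ξ‖ ^ ((d : ℝ) - s))
    [IsProbabilityMeasure α] [IsProbabilityMeasure m] {R : ℝ}
    (hα : ∀ᵐ z ∂α, ‖z‖ ≤ R) (hm : ∀ᵐ z ∂m, ‖z‖ ≤ R)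
    (hdiag : ∀ ρ ∈ ({α, m} : Set (Measure (EuclideanSpace ℝ (Fin d)))),
      ∀ ν ∈ ({α, m} : Set (Measure (EuclideanSpace ℝ (Fin d)))), ∀ᵐ p ∂(ρ.prod ν), p.1 ≠ p.2)
    (hint : ∀ ρ ∈ ({α, m} : Set (Measure (EuclideanSpace ℝ (Fin d)))),
      ∀ ν ∈ ({α, m} : Set (Measure (EuclideanSpace ℝ (Fin d)))),
      Integrable (fun p : EuclideanSpace ℝ (Fin d) × EuclideanSpace ℝ (Fin d) => g (p.1 - p.2))
        (ρ.prod ν)) :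
    homogeneousSobolevSq ((s - d) / 2) α m ≤ ENNReal.ofReal ((2 * Real.pi) ^ s / C₁ *
      (∫ p, g (p.1 - p.2) ∂(α.prod α) + ∫ p, g (p.1 - p.2) ∂(m.prod m)
        - ∫ p, g (p.1 - p.2) ∂(α.prod m) - ∫ p, g (p.1 - p.2) ∂(m.prod α))) := by
  have hαmem : α ∈ ({α, m} : Set (Measure (EuclideanSpace ℝ (Fin d)))) := by simp
  have hmmem : m ∈ ({α, m} : Set (Measure (EuclideanSpace ℝ (Fin d)))) := by simp
  have hπ := Real.pi_pos
  have hfin : ∀ (ρ ν : Measure (EuclideanSpace ℝ (Fin d))) [IsFiniteMeasure ρ] [IsFiniteMeasure ν],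
      IsFiniteMeasure (differenceMeasure ρ ν) := fun ρ ν _ _ => isFiniteMeasure_differenceMeasure
  have hb : ∀ n : ℕ, (0 : ℝ) < ((n : ℝ) + 1)⁻¹ := fun n => inv_pos.2 (Nat.cast_add_one_pos n)
  -- convergence of the four energies
  have hlim : ∀ (ρ ν : Measure (EuclideanSpace ℝ (Fin d))) [IsFiniteMeasure ρ] [IsFiniteMeasure ν],
      (∀ᵐ z ∂ρ, ‖z‖ ≤ R) → (∀ᵐ z ∂ν, ‖z‖ ≤ R) → (∀ᵐ p ∂(ρ.prod ν), p.1 ≠ p.2) →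
      Integrable (fun p : EuclideanSpace ℝ (Fin d) × EuclideanSpace ℝ (Fin d) => g (p.1 - p.2))
        (ρ.prod ν) →
      Tendsto (fun n : ℕ => ∫ z, ∫ y, g (z - y) ∂(gaussianMeasure d ((n : ℝ) + 1)⁻¹)
        ∂(differenceMeasure ρ ν)) atTop (𝓝 (∫ p, g (p.1 - p.2) ∂(ρ.prod ν))) := by
    intro ρ ν _ _ hρ hν hne hi
    rw [← integral_differenceMeasure hg.measurable]
    refine hg.tendsto_integral_integral_gaussianMeasure hd hs hsd ?_ ?_ ?_
    · rw [differenceMeasure, ae_map_iff (p := fun z => z ≠ 0) measurable_sub_prod.aemeasurable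
        (measurableSet_singleton (0 : EuclideanSpace ℝ (Fin d))).compl]
      exact hne.mono fun p hp => sub_ne_zero.2 hp
    · exact (integrable_map_measure hg.measurable.aestronglyMeasurable
        measurable_sub_prod.aemeasurable).2 hi
    · refine Integrable.of_bound measurable_logGrowth.aestronglyMeasurable (2 * R)
        ((ae_norm_le_differenceMeasure hρ hν).mono fun z hz => ?_)
      rw [Real.norm_of_nonneg (logGrowth_nonneg z)]
      exact (logGrowth_le_norm z).trans hz
  have hE := (((hlim α α hα hα (hdiag α hαmem α hαmem) (hint α hαmem α hαmem)).add
    (hlim m m hm hm (hdiag m hmmem m hmmem) (hint m hmmem m hmmem))).sub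
    (hlim α m hα hm (hdiag α hαmem m hmmem) (hint α hαmem m hmmem))).sub
    (hlim m α hm hα (hdiag m hmmem α hαmem) (hint m hmmem α hαmem))
  set E := ∫ p, g (p.1 - p.2) ∂(α.prod α) + ∫ p, g (p.1 - p.2) ∂(m.prod m)
        - ∫ p, g (p.1 - p.2) ∂(α.prod m) - ∫ p, g (p.1 - p.2) ∂(m.prod α)
  -- the Fourier side
  set u : EuclideanSpace ℝ (Fin d) → ℝ := fun ξ =>
    ‖charFun α ((2 * Real.pi) • ξ) - charFun m ((2 * Real.pi) • ξ)‖ ^ 2 with hu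
  have hum : Measurable u := by
    have h1 : Measurable fun ξ => charFun α ((2 * Real.pi) • ξ) :=
      measurable_charFun.comp (measurable_const_smul _)
    have h2 : Measurable fun ξ => charFun m ((2 * Real.pi) • ξ) :=
      measurable_charFun.comp (measurable_const_smul _)
    exact (h1.sub h2).norm.pow_const 2
  have hpair : ∀ n : ℕ, ∫⁻ ξ, ENNReal.ofReal (C₁ / ‖ξ‖ ^ ((d : ℝ) - s) *
      (u ξ * Real.exp (-((n : ℝ) + 1)⁻¹ * ‖ξ‖ ^ 2))) ≤ ENNReal.ofReal (
      (∫ z, ∫ y, g (z - y) ∂(gaussianMeasure d ((n : ℝ) + 1)⁻¹) ∂(differenceMeasure α α))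
      + (∫ z, ∫ y, g (z - y) ∂(gaussianMeasure d ((n : ℝ) + 1)⁻¹) ∂(differenceMeasure m m))
      - (∫ z, ∫ y, g (z - y) ∂(gaussianMeasure d ((n : ℝ) + 1)⁻¹) ∂(differenceMeasure α m))
      - (∫ z, ∫ y, g (z - y) ∂(gaussianMeasure d ((n : ℝ) + 1)⁻¹) ∂(differenceMeasure m α))) := by
    intro n
    set Φ : 𝓢(EuclideanSpace ℝ (Fin d), ℂ) := dampedCharFun (hb n) (differenceMeasure α α)
      + dampedCharFun (hb n) (differenceMeasure m m) - dampedCharFun (hb n) (differenceMeasure α m)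
      - dampedCharFun (hb n) (differenceMeasure m α) with hΦ
    have hΦa : ∀ ξ, Φ ξ = ((u ξ * Real.exp (-((n : ℝ) + 1)⁻¹ * ‖ξ‖ ^ 2) : ℝ) : ℂ) := fun ξ => by
      have h1 : Φ ξ = dampedCharFun (hb n) (differenceMeasure α α) ξ
        + dampedCharFun (hb n) (differenceMeasure m m) ξ
        - dampedCharFun (hb n) (differenceMeasure α m) ξ
        - dampedCharFun (hb n) (differenceMeasure m α) ξ := rfl
      rw [h1, dampedCharFun_apply _ (ae_norm_le_differenceMeasure hα hα),
        dampedCharFun_apply _ (ae_norm_le_differenceMeasure hm hm),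
        dampedCharFun_apply _ (ae_norm_le_differenceMeasure hα hm),
        dampedCharFun_apply _ (ae_norm_le_differenceMeasure hm hα), charFun_differenceMeasure,
        charFun_differenceMeasure, charFun_differenceMeasure, charFun_differenceMeasure,
        ← add_mul, ← sub_mul, ← sub_mul, normSq_sub_eq, ← Complex.ofReal_mul]
    have h0 : Φ 0 = 0 := by
      rw [hΦa]
      simp [hu, charFun_zero]
    have h2 := hg.lintegral_le_pairing hd hs hsd hG hF hC₁ hGb Φ h0 hΦa (fun ξ => by positivity)
    refine h2.trans_eq ?_
    obtain ⟨C, -, hC⟩ := exists_integral_mul_schwartz_le hd hs hsd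
    have hi : ∀ f : 𝓢(EuclideanSpace ℝ (Fin d), ℂ), Integrable fun x => (g x : ℂ) * f x :=
      fun f => (hC g A hg.measurable hg.nonneg_left (fun y hy => (hg.abs_bound y hy).trans
        (mul_le_mul_of_nonneg_left (by linarith) hg.nonneg_left)) f).1
    have h3 : 𝓕 Φ = 𝓕 (dampedCharFun (hb n) (differenceMeasure α α))
        + 𝓕 (dampedCharFun (hb n) (differenceMeasure m m))
        - 𝓕 (dampedCharFun (hb n) (differenceMeasure α m))
        - 𝓕 (dampedCharFun (hb n) (differenceMeasure m α)) := by
      change FourierTransform.fourierCLM ℂ 𝓢(EuclideanSpace ℝ (Fin d), ℂ) Φ = _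
      rw [hΦ, map_sub, map_sub, map_add]
      rfl
    have h4 : ∀ x, (g x : ℂ) * (𝓕 Φ : 𝓢(EuclideanSpace ℝ (Fin d), ℂ)) x
        = (g x : ℂ) * (𝓕 (dampedCharFun (hb n) (differenceMeasure α α)) :
            𝓢(EuclideanSpace ℝ (Fin d), ℂ)) x
        + (g x : ℂ) * (𝓕 (dampedCharFun (hb n) (differenceMeasure m m)) :
            𝓢(EuclideanSpace ℝ (Fin d), ℂ)) x
        - (g x : ℂ) * (𝓕 (dampedCharFun (hb n) (differenceMeasure α m)) :
            𝓢(EuclideanSpace ℝ (Fin d), ℂ)) x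
        - (g x : ℂ) * (𝓕 (dampedCharFun (hb n) (differenceMeasure m α)) :
            𝓢(EuclideanSpace ℝ (Fin d), ℂ)) x := fun x => by
      rw [← mul_add, ← mul_sub, ← mul_sub, h3]
      rfl
    have h5 : ∀ f₁ f₂ f₃ f₄ : 𝓢(EuclideanSpace ℝ (Fin d), ℂ),
        ∫ x, ((g x : ℂ) * f₁ x + (g x : ℂ) * f₂ x - (g x : ℂ) * f₃ x - (g x : ℂ) * f₄ x)
        = (∫ x, (g x : ℂ) * f₁ x) + (∫ x, (g x : ℂ) * f₂ x) - (∫ x, (g x : ℂ) * f₃ x)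
          - ∫ x, (g x : ℂ) * f₄ x := fun f₁ f₂ f₃ f₄ => by
      have h12 : Integrable fun x => (g x : ℂ) * f₁ x + (g x : ℂ) * f₂ x := (hi f₁).add (hi f₂)
      have h123 : Integrable fun x => (g x : ℂ) * f₁ x + (g x : ℂ) * f₂ x - (g x : ℂ) * f₃ x :=
        h12.sub (hi f₃)
      rw [integral_sub h123 (hi f₄), integral_sub h12 (hi f₃), integral_add (hi f₁) (hi f₂)]
    simp_rw [h4]
    rw [h5,
      hg.integral_mul_fourier_dampedCharFun hd hs hsd (hb n) (ae_norm_le_differenceMeasure hα hα),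
      hg.integral_mul_fourier_dampedCharFun hd hs hsd (hb n) (ae_norm_le_differenceMeasure hm hm),
      hg.integral_mul_fourier_dampedCharFun hd hs hsd (hb n) (ae_norm_le_differenceMeasure hα hm),
      hg.integral_mul_fourier_dampedCharFun hd hs hsd (hb n) (ae_norm_le_differenceMeasure hm hα)]
    simp only [← Complex.ofReal_add, ← Complex.ofReal_sub, Complex.ofReal_re]
  have hmain : ∫⁻ ξ, ENNReal.ofReal (C₁ / ‖ξ‖ ^ ((d : ℝ) - s) * u ξ) ≤ ENNReal.ofReal E := by
    have hlim' := (ENNReal.continuous_ofReal.tendsto E).comp hE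
    have hm' : ∀ n : ℕ, Measurable fun ξ : EuclideanSpace ℝ (Fin d) =>
        ENNReal.ofReal (C₁ / ‖ξ‖ ^ ((d : ℝ) - s) *
          (u ξ * Real.exp (-((n : ℝ) + 1)⁻¹ * ‖ξ‖ ^ 2))) := fun n =>
      ((measurable_const.div (measurable_norm.pow_const _)).mul (hum.mul (by fun_prop))).ennreal_ofReal
    calc _ = ∫⁻ ξ, liminf (fun n : ℕ => ENNReal.ofReal (C₁ / ‖ξ‖ ^ ((d : ℝ) - s) *
          (u ξ * Real.exp (-((n : ℝ) + 1)⁻¹ * ‖ξ‖ ^ 2)))) atTop := by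
          refine lintegral_congr fun ξ => (Tendsto.liminf_eq ?_).symm
          refine (ENNReal.continuous_ofReal.tendsto _).comp (Tendsto.const_mul _ ?_)
          have h1 : Tendsto (fun n : ℕ => Real.exp (-((n : ℝ) + 1)⁻¹ * ‖ξ‖ ^ 2)) atTop
              (𝓝 (Real.exp (-0 * ‖ξ‖ ^ 2))) := by
            refine (Real.continuous_exp.tendsto _).comp (Tendsto.mul_const _ (Tendsto.neg ?_))
            simpa using tendsto_one_div_add_atTop_nhds_zero_nat (𝕜 := ℝ)
          simpa using h1.const_mul (u ξ)
      _ ≤ _ := (lintegral_liminf_le hm').trans ((liminf_le_liminf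
          (Eventually.of_forall hpair)).trans hlim'.liminf_eq.le)
  -- change of variables
  have hmeas : Measurable fun ξ : EuclideanSpace ℝ (Fin d) =>
      ENNReal.ofReal (‖ξ‖ ^ (2 * ((s - d) / 2)) * ‖charFun α ξ - charFun m ξ‖ ^ 2) :=
    ((measurable_norm.pow_const _).mul
      ((measurable_charFun.sub measurable_charFun).norm.pow_const 2)).ennreal_ofReal
  have h2π : 0 < 2 * Real.pi := by positivity
  rw [homogeneousSobolevSq, lintegral_eq_mul_lintegral_comp_smul hmeas h2π]
  have hpt : ∀ ξ : EuclideanSpace ℝ (Fin d),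
      ENNReal.ofReal (‖(2 * Real.pi) • ξ‖ ^ (2 * ((s - d) / 2)) *
        ‖charFun α ((2 * Real.pi) • ξ) - charFun m ((2 * Real.pi) • ξ)‖ ^ 2)
      = ENNReal.ofReal ((2 * Real.pi) ^ (s - d) / C₁) *
        ENNReal.ofReal (C₁ / ‖ξ‖ ^ ((d : ℝ) - s) * u ξ) := fun ξ => by
    rw [← ENNReal.ofReal_mul (by positivity)]
    congr 1
    rw [norm_smul, Real.norm_of_nonneg h2π.le, show 2 * ((s - d) / 2) = s - (d : ℝ) by ring,
      Real.mul_rpow h2π.le (norm_nonneg _), show s - (d : ℝ) = -((d : ℝ) - s) by ring,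
      Real.rpow_neg (norm_nonneg ξ)]
    simp only [hu]
    field_simp
  simp_rw [hpt]
  rw [lintegral_const_mul' _ _ ENNReal.ofReal_ne_top, ← mul_assoc,
    ← ENNReal.ofReal_mul (by positivity)]
  refine (mul_le_mul_right hmain _).trans_eq ?_
  rw [← ENNReal.ofReal_mul (by positivity)]
  congr 2
  rw [Real.rpow_sub h2π, Real.rpow_natCast]
  field_simp

end

section

variable {X Y : Type*} [MeasurableSpace X] [MeasurableSpace Y]

theorem smul_restrict_prod_smul_restrict (ρ : Measure X) (ν : Measure Y) [SFinite ρ] [SFinite ν]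
    (a b : ℝ≥0∞) (S : Set X) (T : Set Y) :
    (a • ρ.restrict S).prod (b • ν.restrict T) = (a * b) • (ρ.prod ν).restrict (S ×ˢ T) := by
  rw [Measure.prod_smul_left, Measure.prod_smul_right, Measure.prod_restrict, smul_smul]

theorem tendsto_integral_smul_restrict {E : Type*} [NormedAddCommGroup E] [NormedSpace ℝ E]
    {ρ : Measure X} {f : X → E} (hf : Integrable f ρ) {S : ℕ → Set X} (hS : Monotone S)
    (hSm : ∀ n, MeasurableSet (S n)) (hSu : ⋃ n, S n = Set.univ) {a : ℕ → ℝ≥0∞}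
    (ha : Tendsto a atTop (𝓝 1)) :
    Tendsto (fun n => ∫ x, f x ∂(a n • ρ.restrict (S n))) atTop (𝓝 (∫ x, f x ∂ρ)) := by
  have h1 := tendsto_setIntegral_of_monotone (f := f) (μ := ρ) hSm hS (by rw [hSu]; exact hf.integrableOn)
  rw [hSu, setIntegral_univ] at h1
  have h2 : Tendsto (fun n => (a n).toReal) atTop (𝓝 1) := by
    exact (ENNReal.tendsto_toReal ENNReal.one_ne_top).comp ha
  simpa [integral_smul_measure] using h2.smul h1

theorem tendsto_integral_prod_truncation {E : Type*} [NormedAddCommGroup E] [NormedSpace ℝ E]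
    {ρ : Measure X} {ν : Measure Y} [SFinite ρ] [SFinite ν] {f : X × Y → E}
    (hf : Integrable f (ρ.prod ν)) {S : ℕ → Set X} (hS : Monotone S)
    (hSm : ∀ n, MeasurableSet (S n)) (hSu : ⋃ n, S n = Set.univ) {T : ℕ → Set Y} (hT : Monotone T)
    (hTm : ∀ n, MeasurableSet (T n)) (hTu : ⋃ n, T n = Set.univ) {a b : ℕ → ℝ≥0∞}
    (ha : Tendsto a atTop (𝓝 1)) (hb : Tendsto b atTop (𝓝 1)) :
    Tendsto (fun n => ∫ p, f p ∂((a n • ρ.restrict (S n)).prod (b n • ν.restrict (T n)))) atTop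
      (𝓝 (∫ p, f p ∂(ρ.prod ν))) := by
  simp_rw [smul_restrict_prod_smul_restrict]
  refine tendsto_integral_smul_restrict hf (fun m n h => Set.prod_mono (hS h) (hT h))
    (fun n => (hSm n).prod (hTm n)) ?_ ?_
  · rw [Set.iUnion_prod_of_monotone hS hT, hSu, hTu, Set.univ_prod_univ]
  · simpa using ENNReal.Tendsto.mul ha (Or.inl one_ne_zero) hb (Or.inl one_ne_zero)

end

section

variable {d : ℕ} {s M A L : ℝ} {g : EuclideanSpace ℝ (Fin d) → ℝ}
  {α μ : Measure (EuclideanSpace ℝ (Fin d))}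

/-- The normalized restriction of a measure to a ball about the origin. -/
noncomputable def ballTruncation (μ : Measure (EuclideanSpace ℝ (Fin d))) (n : ℕ) :
    Measure (EuclideanSpace ℝ (Fin d)) :=
  (μ (Metric.ball 0 n))⁻¹ • μ.restrict (Metric.ball 0 n)

theorem monotone_ball_natCast :
    Monotone fun n : ℕ => Metric.ball (0 : EuclideanSpace ℝ (Fin d)) n :=
  fun _ _ h => Metric.ball_subset_ball (Nat.cast_le.2 h)

theorem tendsto_inv_measure_ball [IsProbabilityMeasure μ] :
    Tendsto (fun n : ℕ => (μ (Metric.ball 0 n))⁻¹) atTop (𝓝 1) := by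
  have h := tendsto_measure_iUnion_atTop (μ := μ) (monotone_ball_natCast (d := d))
  rw [Metric.iUnion_ball_nat, measure_univ] at h
  simpa using tendsto_inv_iff.2 h

theorem eventually_isProbabilityMeasure_ballTruncation [IsProbabilityMeasure μ] :
    ∀ᶠ n : ℕ in atTop, IsProbabilityMeasure (ballTruncation μ n) := by
  filter_upwards [(tendsto_inv_measure_ball (μ := μ)).eventually_lt_const ENNReal.one_lt_top] with n hn
  refine ⟨?_⟩
  rw [ballTruncation, Measure.smul_apply, Measure.restrict_apply_univ, smul_eq_mul]
  exact ENNReal.inv_mul_cancel (ENNReal.inv_lt_top.1 hn).ne' (measure_ne_top _ _)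

theorem ballTruncation_absolutelyContinuous (n : ℕ) : ballTruncation μ n ≪ μ :=
  (Measure.smul_absolutelyContinuous).trans Measure.absolutelyContinuous_restrict

theorem ae_norm_le_ballTruncation (n : ℕ) : ∀ᵐ z ∂(ballTruncation μ n), ‖z‖ ≤ n := by
  refine Measure.smul_absolutelyContinuous.ae_le ?_
  filter_upwards [ae_restrict_mem Metric.isOpen_ball.measurableSet] with z hz
  exact (mem_ball_zero_iff.1 hz).le

theorem tendsto_charFun_ballTruncation [IsProbabilityMeasure μ] (ξ : EuclideanSpace ℝ (Fin d)) :
    Tendsto (fun n => charFun (ballTruncation μ n) ξ) atTop (𝓝 (charFun μ ξ)) := by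
  simp_rw [charFun_apply]
  refine tendsto_integral_smul_restrict ?_ monotone_ball_natCast
    (fun n => Metric.isOpen_ball.measurableSet) (Metric.iUnion_ball_nat 0) tendsto_inv_measure_ball
  refine Integrable.of_bound (Measurable.aestronglyMeasurable (by fun_prop)) 1
    (ae_of_all _ fun y => ?_)
  rw [Complex.norm_exp_ofReal_mul_I]

theorem TamePotential.integrable_prod_swap (hg : TamePotential s M A L g)
    [SFinite α] [SFinite μ]
    (h : Integrable (fun p : EuclideanSpace ℝ (Fin d) × EuclideanSpace ℝ (Fin d) => g (p.1 - p.2))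
      (α.prod μ)) :
    Integrable (fun p : EuclideanSpace ℝ (Fin d) × EuclideanSpace ℝ (Fin d) => g (p.1 - p.2))
      (μ.prod α) := by
  refine h.swap.congr (ae_of_all _ fun p => ?_)
  rcases eq_or_ne (p.1 - p.2) 0 with h0 | h0
  · have : p.2 - p.1 = 0 := by rw [← neg_sub, h0, neg_zero]
    simp [h0, this]
  · simp only [Function.comp, Prod.fst_swap, Prod.snd_swap]
    rw [hg.even _ h0, neg_sub]

theorem TamePotential.integral_prod_comm (hg : TamePotential s M A L g) [SFinite α] [SFinite μ] :
    ∫ p, g (p.1 - p.2) ∂(μ.prod α) = ∫ p, g (p.1 - p.2) ∂(α.prod μ) := by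
  rw [← MeasureTheory.integral_prod_swap]
  refine integral_congr_ae (ae_of_all _ fun p => ?_)
  rcases eq_or_ne (p.1 - p.2) 0 with h0 | h0
  · have : p.2 - p.1 = 0 := by rw [← neg_sub, h0, neg_zero]
    simp [h0, this]
  · simp only [Prod.fst_swap, Prod.snd_swap]
    rw [hg.even _ h0, neg_sub]

/-- The interaction energy controls the Sobolev norm of the difference of a compactly supported
measure and a measure of bounded density. -/
theorem TamePotential.homogeneousSobolevSq_le (hg : TamePotential s M A L g)
    (hd : 2 ≤ d) (hs : 0 ≤ s) (hsd : s < d) {G : EuclideanSpace ℝ (Fin d) → ℝ} (hG : Measurable G)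
    (hF : HasFourierAwayFromZero g G) {C₁ C₂ : ℝ} (hC₁ : 0 < C₁)
    (hGb : ∀ ξ, ξ ≠ 0 → C₁ / ‖ξ‖ ^ ((d : ℝ) - s) ≤ G ξ ∧ G ξ ≤ C₂ / ‖ξ‖ ^ ((d : ℝ) - s))
    [IsProbabilityMeasure α] [NullSingletonClass α] [IsProbabilityMeasure μ] {R : ℝ}
    (hα : ∀ᵐ z ∂α, ‖z‖ ≤ R)
    (hαi : Integrable (fun p : EuclideanSpace ℝ (Fin d) × EuclideanSpace ℝ (Fin d) =>
      g (p.1 - p.2)) (α.prod α))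
    (hμ : μ ≪ volume) (hμd : densitySup μ ≠ ⊤) (hμl : Integrable (logGrowth s) μ) :
    homogeneousSobolevSq ((s - d) / 2) α μ ≤ ENNReal.ofReal ((2 * Real.pi) ^ s / C₁ *
      (∫ p, g (p.1 - p.2) ∂(α.prod α) + ∫ p, g (p.1 - p.2) ∂(μ.prod μ)
        - ∫ p, g (p.1 - p.2) ∂(α.prod μ) - ∫ p, g (p.1 - p.2) ∂(μ.prod α))) := by
  have hαl : Integrable (logGrowth s) α := by
    refine Integrable.of_bound measurable_logGrowth.aestronglyMeasurable R (hα.mono fun z hz => ?_)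
    rw [Real.norm_of_nonneg (logGrowth_nonneg z)]
    exact (logGrowth_le_norm z).trans hz
  have hαμ := hg.integrable_prod hd hs hsd hμ hμd hαl hμl
  have hμα := hg.integrable_prod_swap hαμ
  have hμμ := hg.integrable_prod hd hs hsd hμ hμd hμl hμl
  have hbm : ∀ n : ℕ, MeasurableSet (Metric.ball (0 : EuclideanSpace ℝ (Fin d)) n) := fun n =>
    Metric.isOpen_ball.measurableSet
  have hbu := Metric.iUnion_ball_nat (0 : EuclideanSpace ℝ (Fin d))
  have hα1 : α = (1 : ℝ≥0∞) • α.restrict Set.univ := by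
    rw [one_smul, Measure.restrict_univ]
  have hinv := tendsto_inv_measure_ball (μ := μ)
  have huniv : ⋃ _ : ℕ, (Set.univ : Set (EuclideanSpace ℝ (Fin d))) = Set.univ :=
    Set.iUnion_const _
  have ht1 := tendsto_integral_prod_truncation hμμ monotone_ball_natCast hbm hbu
    monotone_ball_natCast hbm hbu hinv hinv
  have ht2 := tendsto_integral_prod_truncation hαμ (S := fun _ => Set.univ) (a := fun _ => 1)
    monotone_const (fun _ => MeasurableSet.univ) huniv monotone_ball_natCast hbm hbu
    tendsto_const_nhds hinv
  have ht3 := tendsto_integral_prod_truncation hμα (T := fun _ => Set.univ) (b := fun _ => 1)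
    monotone_ball_natCast hbm hbu monotone_const (fun _ => MeasurableSet.univ) huniv
    hinv tendsto_const_nhds
  simp only [← hα1] at ht2 ht3
  have hE := ((tendsto_const_nhds (x := ∫ p, g (p.1 - p.2) ∂(α.prod α))).add ht1).sub ht2 |>.sub ht3
  have hE' := (ENNReal.continuous_ofReal.tendsto _).comp (hE.const_mul ((2 * Real.pi) ^ s / C₁))
  have hbd : ∀ᶠ n : ℕ in atTop, homogeneousSobolevSq ((s - d) / 2) α (ballTruncation μ n)
      ≤ ENNReal.ofReal ((2 * Real.pi) ^ s / C₁ * (∫ p, g (p.1 - p.2) ∂(α.prod α)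
        + ∫ p, g (p.1 - p.2) ∂((ballTruncation μ n).prod (ballTruncation μ n))
        - ∫ p, g (p.1 - p.2) ∂(α.prod (ballTruncation μ n))
        - ∫ p, g (p.1 - p.2) ∂((ballTruncation μ n).prod α))) := by
    filter_upwards [eventually_isProbabilityMeasure_ballTruncation (μ := μ),
      hinv.eventually_lt_const ENNReal.one_lt_top] with n hn hn'
    have hnull := nullSingletonClass_of_absolutelyContinuous hd
      ((ballTruncation_absolutelyContinuous (μ := μ) n).trans hμ)
    have hi1 : Integrable (fun p : EuclideanSpace ℝ (Fin d) × EuclideanSpace ℝ (Fin d) =>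
        g (p.1 - p.2)) ((ballTruncation μ n).prod (ballTruncation μ n)) := by
      rw [ballTruncation, smul_restrict_prod_smul_restrict]
      exact hμμ.restrict.smul_measure (ENNReal.mul_lt_top hn' hn').ne
    have hi2 : Integrable (fun p : EuclideanSpace ℝ (Fin d) × EuclideanSpace ℝ (Fin d) =>
        g (p.1 - p.2)) (α.prod (ballTruncation μ n)) := by
      rw [hα1, ballTruncation, smul_restrict_prod_smul_restrict]
      exact hαμ.restrict.smul_measure (ENNReal.mul_lt_top ENNReal.one_lt_top hn').ne
    have hi3 := hg.integrable_prod_swap hi2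
    refine hg.homogeneousSobolevSq_le_of_bounded hd hs hsd hG hF hC₁ hGb (R := max R n)
      (hα.mono fun z hz => hz.trans (le_max_left _ _))
      ((ae_norm_le_ballTruncation n).mono fun z hz => hz.trans (le_max_right _ _)) ?_ ?_
    · rintro ρ (rfl | rfl) ν (rfl | rfl) <;> exact ae_prod_ne _ _
    · rintro ρ (rfl | rfl) ν (rfl | rfl)
      exacts [hαi, hi2, hi3, hi1]
  refine le_trans ?_ ((liminf_le_liminf hbd).trans hE'.liminf_eq.le)
  have hmeas : ∀ n : ℕ, Measurable fun ξ : EuclideanSpace ℝ (Fin d) =>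
      ENNReal.ofReal (‖ξ‖ ^ (2 * ((s - d) / 2)) *
        ‖charFun α ξ - charFun (ballTruncation μ n) ξ‖ ^ 2) := fun n => by
    have : SFinite (ballTruncation μ n) := by unfold ballTruncation; infer_instance
    exact ((measurable_norm.pow_const _).mul
      ((measurable_charFun.sub measurable_charFun).norm.pow_const 2)).ennreal_ofReal
  refine le_trans (le_of_eq ?_) (lintegral_liminf_le hmeas)
  refine lintegral_congr fun ξ => (Tendsto.liminf_eq ?_).symm
  exact (ENNReal.continuous_ofReal.tendsto _).comp
    ((((tendsto_charFun_ballTruncation ξ).const_sub _).norm.pow 2).const_mul _)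

end

section

variable {d : ℕ} {s M A L : ℝ} {g : EuclideanSpace ℝ (Fin d) → ℝ}
  {α μ : Measure (EuclideanSpace ℝ (Fin d))}

theorem continuous_charFun_of_isFiniteMeasure [IsFiniteMeasure α] : Continuous (charFun α) := by
  simp_rw [funext (charFun_apply (μ := α))]
  refine continuous_of_dominated (bound := fun _ => 1)
    (fun ξ => Measurable.aestronglyMeasurable (by fun_prop))
    (fun ξ => ae_of_all _ fun y => ?_) (integrable_const _) (ae_of_all _ fun y => by fun_prop)
  rw [Complex.norm_exp_ofReal_mul_I]

theorem eq_of_homogeneousSobolevSq_eq_zero (hd : 0 < d) [IsFiniteMeasure α] [IsFiniteMeasure μ]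
    {σ : ℝ} (h : homogeneousSobolevSq σ α μ = 0) : α = μ := by
  have := nontrivial_euclideanSpace hd
  have hmeas : Measurable fun ξ : EuclideanSpace ℝ (Fin d) =>
      ENNReal.ofReal (‖ξ‖ ^ (2 * σ) * ‖charFun α ξ - charFun μ ξ‖ ^ 2) :=
    ((measurable_norm.pow_const _).mul
      ((measurable_charFun.sub measurable_charFun).norm.pow_const 2)).ennreal_ofReal
  rw [homogeneousSobolevSq, lintegral_eq_zero_iff hmeas] at h
  refine Measure.ext_of_charFun ?_
  refine Continuous.ae_eq_iff_eq volume continuous_charFun_of_isFiniteMeasure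
    continuous_charFun_of_isFiniteMeasure |>.1 ?_
  have h0 : ∀ᵐ ξ : EuclideanSpace ℝ (Fin d), ξ ≠ 0 := by simp [ae_iff]
  filter_upwards [h, h0] with ξ h1 h2
  have h3 : 0 < ‖ξ‖ ^ (2 * σ) := Real.rpow_pos_of_pos (norm_pos_iff.2 h2) _
  have h4 := ENNReal.ofReal_eq_zero.1 h1
  by_contra hne
  have h5 : 0 < ‖charFun α ξ - charFun μ ξ‖ := norm_pos_iff.2 (sub_ne_zero.2 hne)
  exact absurd h4 (not_le.2 (by positivity))

theorem TamePotential.neg_apply (hg : TamePotential s M A L g) (z : EuclideanSpace ℝ (Fin d)) :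
    g (-z) = g z := by
  rcases eq_or_ne z 0 with rfl | h
  · rw [neg_zero]
  · exact (hg.even z h).symm

theorem offDiagonalKernel_swap (hg : TamePotential s M A L g)
    (p : EuclideanSpace ℝ (Fin d) × EuclideanSpace ℝ (Fin d)) :
    offDiagonalKernel g p.swap = offDiagonalKernel g p := by
  by_cases h : p.1 = p.2
  · simp [offDiagonalKernel, offDiagonal, h]
  · have h' : ¬ p.2 = p.1 := fun h' => h h'.symm
    simp [offDiagonalKernel, offDiagonal, h, h', ← hg.neg_apply (p.1 - p.2)]

theorem offDiagonalEnergy_comm (hg : TamePotential s M A L g) [SFinite α] [SFinite μ] :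
    offDiagonalEnergy g α μ = offDiagonalEnergy g μ α := by
  rw [offDiagonalEnergy_eq, offDiagonalEnergy_eq, ← integral_prod_swap]
  simp_rw [offDiagonalKernel_swap hg]

theorem smearedPotential_eq (g : EuclideanSpace ℝ (Fin d) → ℝ) {η : ℝ} (hη : 0 < η)
    (z : EuclideanSpace ℝ (Fin d)) : smearedPotential g η z
      = ∫ θ, g (z + η • (θ : EuclideanSpace ℝ (Fin d))) ∂(unitSphereMeasure d) := by
  rw [smearedPotential, integral_uniformSphere _ _ hη.ne',
    ← integral_unitSphereMeasure_neg (fun θ => g (z + η • θ))]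
  simp [sub_eq_add_neg]

theorem TamePotential.smearedPotential_neg (hg : TamePotential s M A L g) {η : ℝ} (hη : 0 < η)
    (z : EuclideanSpace ℝ (Fin d)) : smearedPotential g η (-z) = smearedPotential g η z := by
  rw [smearedPotential, smearedPotential_eq g hη, integral_uniformSphere _ _ hη.ne']
  refine integral_congr_ae (ae_of_all _ fun θ => ?_)
  dsimp only
  rw [← hg.neg_apply]
  congr 1
  module

namespace TamePotential

theorem rieszKernel_smul_sphere {η : ℝ} (hη : 0 < η)
    (θ : Metric.sphere (0 : EuclideanSpace ℝ (Fin d)) 1) :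
    rieszKernel s (η • (θ : EuclideanSpace ℝ (Fin d))) = 1 / η ^ s + logIf (s = 0) η := by
  simp [rieszKernel, norm_smul, abs_of_pos hη]

theorem integrable_sphere (hg : TamePotential s M A L g) (hd : 2 ≤ d) {η : ℝ} (hη : 0 < η)
    (z : EuclideanSpace ℝ (Fin d)) :
    Integrable (fun θ : Metric.sphere (0 : EuclideanSpace ℝ (Fin d)) 1 =>
      g (z + η • (θ : EuclideanSpace ℝ (Fin d)))) (unitSphereMeasure d) := by
  have := isProbabilityMeasure_unitSphereMeasure_of_two_le hd
  rcases eq_or_ne z 0 with rfl | hz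
  · refine Integrable.of_bound ((hg.measurable.comp
      (measurable_add_smul_sphere 0 η)).aestronglyMeasurable) (A * (1 / η ^ s + logIf (s = 0) η))
      ((ae_add_smul_ne_zero hd 0 hη).mono fun θ hθ => ?_)
    refine (hg.abs_bound _ hθ).trans (le_of_eq ?_)
    rw [zero_add, rieszKernel_smul_sphere hη]
  · exact (hg.integral_sphere_le hd hz hη).1

theorem smearedPotential_zero_le (hg : TamePotential s M A L g) (hd : 2 ≤ d) {η : ℝ}
    (hη : 0 < η) : smearedPotential g η 0 ≤ A * (1 / η ^ s + logIf (s = 0) η) := by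
  have := isProbabilityMeasure_unitSphereMeasure_of_two_le hd
  rw [smearedPotential_eq g hη]
  refine (integral_mono_ae (hg.integrable_sphere hd hη 0)
    (integrable_const (A * (1 / η ^ s + logIf (s = 0) η)))
    ((ae_add_smul_ne_zero hd 0 hη).mono fun θ hθ => ?_)).trans_eq (by simp)
  refine (le_abs_self _).trans ((hg.abs_bound _ hθ).trans (le_of_eq ?_))
  rw [zero_add, rieszKernel_smul_sphere hη]

theorem integral_uniformSphere_sub {η : ℝ} (hη : 0 < η) (x w : EuclideanSpace ℝ (Fin d)) :
    ∫ y, g (y - w) ∂(uniformSphere x η) = smearedPotential g η (x - w) := by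
  rw [smearedPotential_eq g hη, integral_uniformSphere _ _ hη.ne']
  simp only [add_sub_right_comm]

/-- The interaction of two smeared charges is at most that of a smeared charge and a point
charge, up to the lack of superharmonicity. -/
theorem integral_prod_uniformSphere_uniformSphere_le (hg : TamePotential s M A L g) (hd : 2 ≤ d)
    {η η' : ℝ} (hη : 0 < η) (hη' : 0 < η') (x w : EuclideanSpace ℝ (Fin d)) :
    Integrable (fun p : EuclideanSpace ℝ (Fin d) × EuclideanSpace ℝ (Fin d) => g (p.1 - p.2))
      ((uniformSphere x η).prod (uniformSphere w η')) ∧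
    ∫ p, g (p.1 - p.2) ∂((uniformSphere x η).prod (uniformSphere w η'))
      ≤ smearedPotential g η (x - w) + M / (2 * d) * η' ^ 2 := by
  have := isProbabilityMeasure_uniformSphere (by omega : 0 < d) x η
  have := nullSingletonClass_uniformSphere hd x hη
  rw [← integral_uniformSphere_sub hη x w]
  refine hg.integral_prod_uniformSphere_le hd (R := ‖x‖ + η) (by simp [ae_iff])
    (ae_uniformSphere hη fun y hy => ?_) ?_ hη'
  · have := norm_add_le x (y - x)
    rw [hy] at this
    simpa using this
  · rw [integrable_uniformSphere_iff hη.ne']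
    simpa only [add_sub_right_comm] using hg.integrable_sphere hd hη (x - w)

theorem integral_uniformSphere_prod (hg : TamePotential s M A L g) {η : ℝ}
    (hη : 0 < η) (x : EuclideanSpace ℝ (Fin d)) [IsProbabilityMeasure μ]
    [SFinite (uniformSphere x η)]
    (hi : Integrable (fun p : EuclideanSpace ℝ (Fin d) × EuclideanSpace ℝ (Fin d) => g (p.1 - p.2))
      ((uniformSphere x η).prod μ)) :
    Integrable (fun y => smearedPotential g η (y - x)) μ ∧
    ∫ p, g (p.1 - p.2) ∂((uniformSphere x η).prod μ) = ∫ y, smearedPotential g η (y - x) ∂μ := by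
  have h : ∀ y, ∫ z, g (z - y) ∂(uniformSphere x η) = smearedPotential g η (y - x) := fun y => by
    rw [integral_uniformSphere_sub hη, ← hg.smearedPotential_neg hη, neg_sub]
  rw [integral_prod_symm _ hi]
  simp only [h]
  refine ⟨?_, trivial⟩
  simpa only [h] using hi.integral_prod_right

theorem integral_dirac_prod (hg : TamePotential s M A L g) (x : EuclideanSpace ℝ (Fin d))
    [IsProbabilityMeasure μ]
    (hi : Integrable (fun p : EuclideanSpace ℝ (Fin d) × EuclideanSpace ℝ (Fin d) => g (p.1 - p.2))
      ((Measure.dirac x).prod μ)) :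
    Integrable (fun y => g (y - x)) μ ∧
    ∫ p, g (p.1 - p.2) ∂((Measure.dirac x).prod μ) = ∫ y, g (y - x) ∂μ := by
  have h : ∀ y, g (x - y) = g (y - x) := fun y => by rw [← hg.neg_apply, neg_sub]
  rw [integral_prod _ hi]
  refine ⟨?_, by simp [h]⟩
  rw [integrable_prod_iff hi.1] at hi
  simpa [h] using hi.1

end TamePotential

end

section

variable {d N : ℕ} {s M A L : ℝ} {g : EuclideanSpace ℝ (Fin d) → ℝ}
  {μ : Measure (EuclideanSpace ℝ (Fin d))} {x : Fin N → EuclideanSpace ℝ (Fin d)}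
  {η : Fin N → ℝ}

theorem ae_norm_le_smearedEmpiricalMeasure (hη : ∀ i, 0 < η i) :
    ∃ R : ℝ, ∀ᵐ z ∂(smearedEmpiricalMeasure x η), ‖z‖ ≤ R := by
  refine ⟨∑ i, (‖x i‖ + η i), ?_⟩
  rw [smearedEmpiricalMeasure_eq_average]
  refine ae_averageMeasure fun i => ae_uniformSphere (hη i) fun y hy => ?_
  have h1 := norm_add_le (x i) (y - x i)
  rw [hy, add_sub_cancel] at h1
  exact h1.trans (Finset.single_le_sum (f := fun i => ‖x i‖ + η i)
    (fun j _ => add_nonneg (norm_nonneg _) (hη j).le) (Finset.mem_univ i))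

theorem nullSingletonClass_smearedEmpiricalMeasure (hd : 2 ≤ d) (hη : ∀ i, 0 < η i) :
    NullSingletonClass (smearedEmpiricalMeasure x η) := by
  refine ⟨fun y => ?_⟩
  have : ∀ᵐ z ∂(smearedEmpiricalMeasure x η), z ≠ y := by
    rw [smearedEmpiricalMeasure_eq_average]
    refine ae_averageMeasure fun i => ?_
    have := nullSingletonClass_uniformSphere hd (x i) (hη i)
    simp [ae_iff]
  simpa [ae_iff] using this

theorem isProbabilityMeasure_smearedEmpiricalMeasure (hd : 2 ≤ d) (hN : 1 ≤ N) :
    IsProbabilityMeasure (smearedEmpiricalMeasure x η) := by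
  rw [smearedEmpiricalMeasure_eq_average]
  exact isProbabilityMeasure_averageMeasure hN fun i =>
    isProbabilityMeasure_uniformSphere (by omega) _ _

theorem isProbabilityMeasure_empiricalMeasure (hN : 1 ≤ N) :
    IsProbabilityMeasure (empiricalMeasure x) := by
  rw [empiricalMeasure_eq_average]
  exact isProbabilityMeasure_averageMeasure hN fun i => inferInstance

/-- The interaction energy of the difference `α - μ`. -/
noncomputable def differenceEnergy (g : EuclideanSpace ℝ (Fin d) → ℝ)
    (α μ : Measure (EuclideanSpace ℝ (Fin d))) : ℝ :=
  ∫ p, g (p.1 - p.2) ∂(α.prod α) + ∫ p, g (p.1 - p.2) ∂(μ.prod μ)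
    - ∫ p, g (p.1 - p.2) ∂(α.prod μ) - ∫ p, g (p.1 - p.2) ∂(μ.prod α)

namespace TamePotential

theorem integral_smearedEmpiricalMeasure_prod_self_le (hg : TamePotential s M A L g) (hd : 2 ≤ d)
    (hN : 1 ≤ N) (hη : ∀ i, 0 < η i) :
    Integrable (fun p : EuclideanSpace ℝ (Fin d) × EuclideanSpace ℝ (Fin d) => g (p.1 - p.2))
      ((smearedEmpiricalMeasure x η).prod (smearedEmpiricalMeasure x η)) ∧
    ∫ p, g (p.1 - p.2) ∂((smearedEmpiricalMeasure x η).prod (smearedEmpiricalMeasure x η))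
      ≤ (N : ℝ)⁻¹ * ∑ i, (N : ℝ)⁻¹ * ∑ j, (smearedPotential g (η i) (x i - x j)
        + M / (2 * d) * η j ^ 2) := by
  have hp : ∀ i, IsProbabilityMeasure (uniformSphere (x i) (η i)) := fun i =>
    isProbabilityMeasure_uniformSphere (by omega) _ _
  have := isProbabilityMeasure_smearedEmpiricalMeasure (x := x) (η := η) hd hN
  have h := fun i j => hg.integral_prod_uniformSphere_uniformSphere_le hd (hη i) (hη j) (x i) (x j)
  have hi : ∀ i, Integrable (fun p : EuclideanSpace ℝ (Fin d) × EuclideanSpace ℝ (Fin d) =>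
      g (p.1 - p.2)) ((uniformSphere (x i) (η i)).prod (smearedEmpiricalMeasure x η)) := fun i => by
    rw [smearedEmpiricalMeasure_eq_average, prod_averageMeasure]
    exact integrable_averageMeasure hN fun j => (h i j).1
  have he : (smearedEmpiricalMeasure x η).prod (smearedEmpiricalMeasure x η)
      = averageMeasure fun i => (uniformSphere (x i) (η i)).prod (smearedEmpiricalMeasure x η) :=
    averageMeasure_prod (ν := fun i => uniformSphere (x i) (η i)) _
  rw [he, integral_averageMeasure hi, smul_eq_mul]
  refine ⟨integrable_averageMeasure hN hi, ?_⟩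
  gcongr with i
  rw [smearedEmpiricalMeasure_eq_average, prod_averageMeasure,
    integral_averageMeasure fun j => (h i j).1, smul_eq_mul]
  gcongr with j
  exact (h i j).2

/-- Smearing the charges changes the interaction with a background of bounded density little. -/
theorem integral_empiricalMeasure_prod_sub_le (hg : TamePotential s M A L g) (hd : 2 ≤ d)
    (hs : 0 ≤ s) (hsd : s < d) (hN : 1 ≤ N) (hη : ∀ i, 0 < η i) [IsProbabilityMeasure μ]
    (hμ : μ ≪ volume) (hμd : densitySup μ ≠ ⊤) (hμl : Integrable (logGrowth s) μ) {D : Fin N → ℝ}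
    (hD : ∀ i, ∫ y, (g (y - x i) - ∫ θ, g (y - x i + η i • (θ : EuclideanSpace ℝ (Fin d)))
          ∂(unitSphereMeasure d)) ∂μ ≤ D i) :
    ∫ p, g (p.1 - p.2) ∂((empiricalMeasure x).prod μ)
      - ∫ p, g (p.1 - p.2) ∂((smearedEmpiricalMeasure x η).prod μ) ≤ (N : ℝ)⁻¹ * ∑ i, D i := by
  have hp : ∀ i, IsProbabilityMeasure (uniformSphere (x i) (η i)) := fun i =>
    isProbabilityMeasure_uniformSphere (by omega) _ _
  have hi1 : ∀ i, Integrable (fun p : EuclideanSpace ℝ (Fin d) × EuclideanSpace ℝ (Fin d) =>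
      g (p.1 - p.2)) ((Measure.dirac (x i)).prod μ) := fun i =>
    hg.integrable_prod hd hs hsd hμ hμd (integrable_dirac_real _ _) hμl
  have hi2 : ∀ i, Integrable (fun p : EuclideanSpace ℝ (Fin d) × EuclideanSpace ℝ (Fin d) =>
      g (p.1 - p.2)) ((uniformSphere (x i) (η i)).prod μ) := fun i => by
    refine hg.integrable_prod hd hs hsd hμ hμd ?_ hμl
    refine Integrable.of_bound measurable_logGrowth.aestronglyMeasurable (‖x i‖ + η i)
      (ae_uniformSphere (hη i) fun y hy => ?_)
    rw [Real.norm_of_nonneg (logGrowth_nonneg y)]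
    have h1 := norm_add_le (x i) (y - x i)
    rw [hy, add_sub_cancel] at h1
    exact (logGrowth_le_norm y).trans h1
  have h1 := fun i => hg.integral_dirac_prod (x i) (hi1 i)
  have h2 := fun i => hg.integral_uniformSphere_prod (hη i) (x i) (hi2 i)
  rw [empiricalMeasure_eq_average, smearedEmpiricalMeasure_eq_average, averageMeasure_prod,
    averageMeasure_prod, integral_averageMeasure hi1, integral_averageMeasure hi2, smul_eq_mul,
    smul_eq_mul, ← mul_sub, ← Finset.sum_sub_distrib]
  gcongr with i
  rw [(h1 i).2, (h2 i).2, ← integral_sub (h1 i).1 (h2 i).1]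
  refine le_trans (le_of_eq ?_) (hD i)
  simp only [smearedPotential_eq g (hη i)]

theorem modulatedEnergy_eq (hg : TamePotential s M A L g) (hd : 2 ≤ d) (hN : 1 ≤ N)
    [IsProbabilityMeasure μ] (hμ : μ ≪ volume) :
    modulatedEnergy g x μ = (N : ℝ)⁻¹ * (∑ i, (N : ℝ)⁻¹ * ∑ j, offDiagonalKernel g (x i, x j))
      - 2 * ∫ p, g (p.1 - p.2) ∂((empiricalMeasure x).prod μ)
      + ∫ p, g (p.1 - p.2) ∂(μ.prod μ) := by
  have := isProbabilityMeasure_empiricalMeasure (x := x) hN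
  have := nullSingletonClass_of_absolutelyContinuous hd hμ
  rw [modulatedEnergy, offDiagonalEnergy_comm hg (α := μ), offDiagonalEnergy_empirical hN,
    offDiagonalEnergy_of_nullSingletonClass, offDiagonalEnergy_of_nullSingletonClass]
  ring

theorem nearPair_le (hg : TamePotential s M A L g) (hd : 2 ≤ d) (hη : ∀ i, 0 < η i)
    (hx : Function.Injective x) (r₀ : ℝ) :
    nearPairSum g r₀ x η ≤ (∑ i, ∑ j, (offDiagonalKernel g (x i, x j)
        - smearedPotential g (η i) (x i - x j) + M / (2 * d) * η i ^ 2))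
      + ∑ i, smearedPotential g (η i) 0 := by
  classical
  have hM := hg.nonneg
  have hdiag : ∀ i, smearedPotential g (η i) 0
      = ∑ j, if i = j then smearedPotential g (η i) 0 else 0 := fun i => by simp
  rw [Finset.sum_congr rfl fun i _ => hdiag i, ← Finset.sum_add_distrib, nearPairSum]
  refine Finset.sum_le_sum fun i _ => ?_
  rw [← Finset.sum_add_distrib]
  refine Finset.sum_le_sum fun j _ => ?_
  have hc : 0 ≤ M / (2 * d) * η i ^ 2 := by positivity
  rcases eq_or_ne i j with rfl | hij
  · simpa [offDiagonalKernel, offDiagonal] using hc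
  · have hne : x i ≠ x j := fun h => hij (hx h)
    have h1 := (hg.integral_sphere_le hd (sub_ne_zero.2 hne) (hη i)).2
    rw [← smearedPotential_eq g (hη i)] at h1
    have h2 : offDiagonalKernel g (x i, x j) = g (x i - x j) := by
      simp [offDiagonalKernel, offDiagonal, hne]
    have h3 : g (x j - x i) = g (x i - x j) := by rw [← hg.neg_apply, neg_sub]
    have h4 : smearedPotential g (η i) (x j - x i) = smearedPotential g (η i) (x i - x j) := by
      rw [← hg.smearedPotential_neg (hη i), neg_sub]
    rw [h2, h3, h4, if_neg hij, add_zero]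
    split_ifs
    · exact max_le (by linarith) (by linarith)
    · linarith

/-- The energy of the smeared configuration is bounded by the modulated energy. -/
theorem nearPairSum_add_differenceEnergy_le (hg : TamePotential s M A L g) (hd : 2 ≤ d)
    (hs : 0 ≤ s) (hsd : s < d) (hN : 1 ≤ N) (hη : ∀ i, 0 < η i) (hx : Function.Injective x)
    [IsProbabilityMeasure μ] (hμ : μ ≪ volume) (hμd : densitySup μ ≠ ⊤)
    (hμl : Integrable (logGrowth s) μ) {D : Fin N → ℝ}
    (hD : ∀ i, ∫ y, (g (y - x i) - ∫ θ, g (y - x i + η i • (θ : EuclideanSpace ℝ (Fin d)))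
          ∂(unitSphereMeasure d)) ∂μ ≤ D i) (r₀ : ℝ) :
    1 / (N : ℝ) ^ 2 * nearPairSum g r₀ x η + differenceEnergy g (smearedEmpiricalMeasure x η) μ
      ≤ modulatedEnergy g x μ + 1 / (N : ℝ) ^ 2 * ∑ i, smearedPotential g (η i) 0
        + M / d / N * ∑ i, η i ^ 2 + 2 / N * ∑ i, D i := by
  have := isProbabilityMeasure_smearedEmpiricalMeasure (x := x) (η := η) hd hN
  have hN0 : (0 : ℝ) < N := by exact_mod_cast hN
  have h1 := (hg.integral_smearedEmpiricalMeasure_prod_self_le hd hN hη (x := x)).2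
  have h2 := hg.integral_empiricalMeasure_prod_sub_le hd hs hsd hN hη hμ hμd hμl hD
  have h3 := hg.nearPair_le hd hη hx r₀
  have h4 := mul_le_mul_of_nonneg_left h3 (by positivity : 0 ≤ 1 / (N : ℝ) ^ 2)
  rw [hg.modulatedEnergy_eq hd hN hμ, differenceEnergy,
    hg.integral_prod_comm (α := smearedEmpiricalMeasure x η) (μ := μ)]
  simp only [← Finset.mul_sum, Finset.sum_add_distrib, Finset.sum_sub_distrib, Finset.sum_const,
    Finset.card_univ, Fintype.card_fin, nsmul_eq_mul] at h1 h2 h4 ⊢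
  set S := ∑ i, η i ^ 2
  set P := ∑ i, ∑ j, smearedPotential g (η i) (x i - x j)
  set Q := ∑ i, ∑ j, offDiagonalKernel g (x i, x j)
  set Z := ∑ i, smearedPotential g (η i) 0
  have e1 : (N : ℝ)⁻¹ * ((N : ℝ)⁻¹ * (P + M / (2 * d) * (N * S)))
      = 1 / (N : ℝ) ^ 2 * P + M / (2 * d) / N * S := by field_simp
  have e2 : 1 / (N : ℝ) ^ 2 * (Q - P + M / (2 * d) * (N * S) + Z)
      = 1 / (N : ℝ) ^ 2 * Q - 1 / (N : ℝ) ^ 2 * P + M / (2 * d) / N * S + 1 / (N : ℝ) ^ 2 * Z := by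
    field_simp
  have e3 : M / d / N * S = M / (2 * d) / N * S + M / (2 * d) / N * S := by ring
  have e4 : 2 / (N : ℝ) * ∑ i, D i = 2 * ((N : ℝ)⁻¹ * ∑ i, D i) := by ring
  have e5 : (N : ℝ)⁻¹ * ((N : ℝ)⁻¹ * Q) = 1 / (N : ℝ) ^ 2 * Q := by ring
  rw [e1] at h1
  rw [e2] at h4
  rw [e3, e4, e5]
  linarith

theorem homogeneousSobolevSq_smeared_le (hg : TamePotential s M A L g)
    (hd : 2 ≤ d) (hs : 0 ≤ s) (hsd : s < d) {G : EuclideanSpace ℝ (Fin d) → ℝ} (hG : Measurable G)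
    (hF : HasFourierAwayFromZero g G) {C₁ C₂ : ℝ} (hC₁ : 0 < C₁)
    (hGb : ∀ ξ, ξ ≠ 0 → C₁ / ‖ξ‖ ^ ((d : ℝ) - s) ≤ G ξ ∧ G ξ ≤ C₂ / ‖ξ‖ ^ ((d : ℝ) - s))
    (hN : 1 ≤ N) (hη : ∀ i, 0 < η i) [IsProbabilityMeasure μ] (hμ : μ ≪ volume)
    (hμd : densitySup μ ≠ ⊤) (hμl : Integrable (logGrowth s) μ) :
    homogeneousSobolevSq ((s - d) / 2) (smearedEmpiricalMeasure x η) μ ≠ ⊤ ∧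
    (homogeneousSobolevSq ((s - d) / 2) (smearedEmpiricalMeasure x η) μ).toReal
      ≤ (2 * Real.pi) ^ s / C₁ * differenceEnergy g (smearedEmpiricalMeasure x η) μ := by
  have := isProbabilityMeasure_smearedEmpiricalMeasure (x := x) (η := η) hd hN
  have := nullSingletonClass_smearedEmpiricalMeasure (x := x) hd hη
  obtain ⟨R, hR⟩ := ae_norm_le_smearedEmpiricalMeasure (x := x) hη
  have hπ := Real.pi_pos
  have h : homogeneousSobolevSq ((s - d) / 2) (smearedEmpiricalMeasure x η) μ ≤ ENNReal.ofReal
      ((2 * Real.pi) ^ s / C₁ * differenceEnergy g (smearedEmpiricalMeasure x η) μ) :=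
    hg.homogeneousSobolevSq_le hd hs hsd hG hF hC₁ hGb hR
    (hg.integral_smearedEmpiricalMeasure_prod_self_le hd hN hη).1 hμ hμd hμl
  refine ⟨ne_top_of_le_ne_top ENNReal.ofReal_ne_top h, ?_⟩
  refine ENNReal.toReal_le_of_le_ofReal ?_ h
  refine mul_nonneg (by positivity) ?_
  by_contra! hneg
  have h0 : homogeneousSobolevSq ((s - d) / 2) (smearedEmpiricalMeasure x η) μ = 0 := by
    rw [ENNReal.ofReal_of_nonpos (mul_nonpos_of_nonneg_of_nonpos (by positivity) hneg.le)] at h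
    exact le_antisymm h zero_le
  rw [eq_of_homogeneousSobolevSq_eq_zero (by omega) h0] at hneg
  simp [differenceEnergy] at hneg

end TamePotential

end

section

variable {d N : ℕ} {s M A L : ℝ} {g : EuclideanSpace ℝ (Fin d) → ℝ}

theorem smearingError_nonneg {η : ℝ} (hη : 0 < η) : 0 ≤ smearingError d s η := by
  have h1 := logIf_nonneg (s = 0) η
  have h2 := logIf_nonneg (s = (d : ℝ) - 2) η
  have h3 : (0 : ℝ) ≤ if s < (d : ℝ) - 2 then η ^ 2 else 0 := by split_ifs <;> positivity
  unfold smearingError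
  positivity

theorem smearingError_le (hd : 2 ≤ d) (hsd : s ≤ (d : ℝ) - 2) {η : ℝ} (hη : 0 < η) (hη1 : η ≤ 1) :
    smearingError d s η
      ≤ 2 * η ^ 2 + η ^ 2 * logIf (s = 0) η + η ^ 2 * logIf (s = (d : ℝ) - 2) η := by
  have h1 : η ^ ((d : ℝ) - s) ≤ η ^ 2 := by
    rw [← Real.rpow_natCast]
    exact Real.rpow_le_rpow_of_exponent_ge hη hη1 (by push_cast; linarith)
  have h2 : (if s < (d : ℝ) - 2 then η ^ 2 else 0) ≤ η ^ 2 := by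
    split_ifs
    · exact le_rfl
    · positivity
  have h3 : η ^ d * logIf (s = 0) η ≤ η ^ 2 * logIf (s = 0) η :=
    mul_le_mul_of_nonneg_right (pow_le_pow_of_le_one hη.le hη1 hd) (logIf_nonneg _ _)
  unfold smearingError
  linarith

/-- The rate in the lower bound of the modulated energy. -/
noncomputable def energyRate (d N : ℕ) (s : ℝ) : ℝ :=
  (N : ℝ) ^ (-2 / (2 + s)) + (N : ℝ)⁻¹ * logIf (s = 0) N
    + (N : ℝ) ^ (-2 / (d : ℝ)) * logIf (s = (d : ℝ) - 2) N

/-- The smearing radius that optimizes the lower bound of the modulated energy. -/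
noncomputable def optimalRadius (s r : ℝ) (N : ℕ) : ℝ := r * (N : ℝ) ^ (-1 / (2 + s))

theorem optimalRadius_pos (hN : 1 ≤ N) {r : ℝ} (hr : 0 < r) : 0 < optimalRadius s r N :=
  mul_pos hr (Real.rpow_pos_of_pos (by exact_mod_cast hN) _)

theorem optimalRadius_le (hs : 0 ≤ s) (hN : 1 ≤ N) {r : ℝ} (hr : 0 < r) :
    optimalRadius s r N ≤ r := by
  refine mul_le_of_le_one_right hr.le (Real.rpow_le_one_of_one_le_of_nonpos (by exact_mod_cast hN) ?_)
  exact div_nonpos_of_nonpos_of_nonneg (by norm_num) (by linarith)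

theorem optimalRadius_sq_le (hN : 1 ≤ N) {r : ℝ} (hr : 0 < r) (hr1 : r ≤ 1) :
    optimalRadius s r N ^ 2 ≤ (N : ℝ) ^ (-2 / (2 + s)) := by
  have hN0 : (0 : ℝ) < N := by exact_mod_cast hN
  rw [optimalRadius, mul_pow, ← Real.rpow_mul_natCast hN0.le]
  refine (mul_le_of_le_one_left (by positivity) (pow_le_one₀ hr.le hr1)).trans_eq ?_
  congr 1
  push_cast
  ring

theorem inv_mul_optimalRadius_rpow (hs : 0 ≤ s) (hN : 1 ≤ N) {r : ℝ} (hr : 0 < r) :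
    (N : ℝ)⁻¹ * (1 / optimalRadius s r N ^ s) = r ^ (-s) * (N : ℝ) ^ (-2 / (2 + s)) := by
  have hN0 : (0 : ℝ) < N := by exact_mod_cast hN
  have h2s : 2 + s ≠ 0 := by linarith
  rw [one_div, ← Real.rpow_neg (optimalRadius_pos hN hr).le, optimalRadius,
    Real.mul_rpow hr.le (by positivity), ← Real.rpow_mul hN0.le, mul_left_comm, ← Real.rpow_neg_one,
    ← Real.rpow_add hN0]
  congr 2
  field_simp
  ring

theorem logIf_optimalRadius_le (hs : 0 ≤ s) (hN : 1 ≤ N) {r : ℝ} (hr : 0 < r) (p : Prop) :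
    logIf p (optimalRadius s r N) ≤ |Real.log r| + logIf p N := by
  have hN0 : (0 : ℝ) < N := by exact_mod_cast hN
  unfold logIf
  split_ifs
  · rw [optimalRadius, Real.log_mul hr.ne' (by positivity), Real.log_rpow hN0]
    refine (abs_add_le _ _).trans (add_le_add_right ?_ _)
    rw [abs_mul]
    refine mul_le_of_le_one_left (abs_nonneg _) ?_
    rw [abs_div, abs_neg, abs_one, abs_of_pos (by linarith : 0 < 2 + s), div_le_one (by linarith)]
    linarith
  · simp

theorem rpow_mul_logIf_le (hs : 0 ≤ s) (hN : 1 ≤ N) {r : ℝ} (hr : 0 < r) :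
    (N : ℝ) ^ (-2 / (2 + s)) * logIf (s = 0) (optimalRadius s r N)
        + (N : ℝ) ^ (-2 / (2 + s)) * logIf (s = (d : ℝ) - 2) (optimalRadius s r N)
      ≤ (2 * |Real.log r| + 1) * energyRate d N s := by
  have hN0 : (0 : ℝ) < N := by exact_mod_cast hN
  have hP : 0 ≤ (N : ℝ) ^ (-2 / (2 + s)) := by positivity
  have h1 := mul_le_mul_of_nonneg_left (logIf_optimalRadius_le hs hN hr (s = 0)) hP
  have h2 := mul_le_mul_of_nonneg_left (logIf_optimalRadius_le hs hN hr (s = (d : ℝ) - 2)) hP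
  have h3 : (N : ℝ) ^ (-2 / (2 + s)) * logIf (s = 0) N = (N : ℝ)⁻¹ * logIf (s = 0) N := by
    by_cases h : s = 0
    · rw [h, add_zero, neg_div, div_self two_ne_zero, Real.rpow_neg_one]
    · simp [logIf, h]
  have h4 : (N : ℝ) ^ (-2 / (2 + s)) * logIf (s = (d : ℝ) - 2) N
      = (N : ℝ) ^ (-2 / (d : ℝ)) * logIf (s = (d : ℝ) - 2) N := by
    by_cases h : s = (d : ℝ) - 2
    · rw [show 2 + s = (d : ℝ) by linarith]
    · simp [logIf, h]
  rw [mul_add] at h1 h2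
  rw [h3] at h1
  rw [h4] at h2
  have h5 : 0 ≤ (N : ℝ)⁻¹ * logIf (s = 0) N := mul_nonneg (by positivity) (logIf_nonneg _ _)
  have h6 : 0 ≤ (N : ℝ) ^ (-2 / (d : ℝ)) * logIf (s = (d : ℝ) - 2) N :=
    mul_nonneg (by positivity) (logIf_nonneg _ _)
  have h7 := abs_nonneg (Real.log r)
  have h8 := mul_nonneg h7 h5
  have h9 := mul_nonneg h7 h6
  unfold energyRate
  linarith

theorem rpow_le_energyRate : (N : ℝ) ^ (-2 / (2 + s)) ≤ energyRate d N s := by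
  have h5 : 0 ≤ (N : ℝ)⁻¹ * logIf (s = 0) N := mul_nonneg (by positivity) (logIf_nonneg _ _)
  have h6 : 0 ≤ (N : ℝ) ^ (-2 / (d : ℝ)) * logIf (s = (d : ℝ) - 2) N :=
    mul_nonneg (by positivity) (logIf_nonneg _ _)
  unfold energyRate
  linarith

theorem smearingError_optimalRadius_le (hd : 2 ≤ d) (hs : 0 ≤ s) (hsd : s ≤ (d : ℝ) - 2)
    (hN : 1 ≤ N) {r : ℝ} (hr : 0 < r) (hr1 : r ≤ 1) :
    smearingError d s (optimalRadius s r N) ≤ (2 * |Real.log r| + 3) * energyRate d N s := by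
  have h1 := smearingError_le hd hsd (optimalRadius_pos (s := s) hN hr)
    ((optimalRadius_le hs hN hr).trans hr1)
  have h2 := optimalRadius_sq_le (s := s) hN hr hr1
  have h3 := mul_le_mul_of_nonneg_right h2 (logIf_nonneg (s = 0) (optimalRadius s r N))
  have h4 := mul_le_mul_of_nonneg_right h2 (logIf_nonneg (s = (d : ℝ) - 2) (optimalRadius s r N))
  have h5 := rpow_mul_logIf_le (d := d) hs hN hr
  have h6 := rpow_le_energyRate (d := d) (N := N) (s := s)
  linarith

theorem TamePotential.inv_mul_smearedPotential_optimalRadius_le (hg : TamePotential s M A L g)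
    (hd : 2 ≤ d) (hs : 0 ≤ s) (hN : 1 ≤ N) {r : ℝ} (hr : 0 < r) :
    (N : ℝ)⁻¹ * smearedPotential g (optimalRadius s r N) 0
      ≤ A * (r ^ (-s) + 2 * |Real.log r| + 1) * energyRate d N s := by
  have hN0 : (0 : ℝ) < N := by exact_mod_cast hN
  have h1 := mul_le_mul_of_nonneg_left
    (hg.smearedPotential_zero_le hd (optimalRadius_pos (s := s) hN hr)) (inv_nonneg.2 hN0.le)
  refine h1.trans ?_
  rw [mul_left_comm, mul_add, inv_mul_optimalRadius_rpow hs hN hr, mul_assoc]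
  refine mul_le_mul_of_nonneg_left ?_ hg.nonneg_left
  have h3 : (N : ℝ)⁻¹ * logIf (s = 0) (optimalRadius s r N)
      = (N : ℝ) ^ (-2 / (2 + s)) * logIf (s = 0) (optimalRadius s r N) := by
    by_cases h : s = 0
    · rw [h, add_zero, neg_div, div_self two_ne_zero, Real.rpow_neg_one]
    · simp [logIf, h]
  have h5 := rpow_mul_logIf_le (d := d) hs hN hr
  have h6 : 0 ≤ (N : ℝ) ^ (-2 / (2 + s)) * logIf (s = (d : ℝ) - 2) (optimalRadius s r N) :=
    mul_nonneg (by positivity) (logIf_nonneg _ _)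
  have h7 : r ^ (-s) * (N : ℝ) ^ (-2 / (2 + s)) ≤ r ^ (-s) * energyRate d N s :=
    mul_le_mul_of_nonneg_left rpow_le_energyRate (by positivity)
  rw [h3]
  linarith

theorem nearPairSum_nonneg (r₀ : ℝ) (x : Fin N → EuclideanSpace ℝ (Fin d)) (η : Fin N → ℝ) :
    0 ≤ nearPairSum g r₀ x η := by
  unfold nearPairSum
  refine Finset.sum_nonneg fun i _ => Finset.sum_nonneg fun j _ => ?_
  split_ifs
  · exact le_max_right _ _
  · exact le_rfl

end

theorem proposition2p1
    (d : ℕ) (hd : 2 ≤ d) (s : ℝ) (hs : 0 ≤ s) (hsd : s ≤ (d : ℝ) - 2)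
    (r₀ : ℝ) (hr₀ : 0 < r₀) (K : ℕ → ℝ) (B C₁ C₂ cs c₀ : ℝ)
    (hC₁ : 0 < C₁) (hcs : cs < 1) (hc₀ : 0 < c₀) :
    ∃ C : ℝ, 0 < C ∧
      ∀ g : EuclideanSpace ℝ (Fin d) → ℝ, RieszTypePotential d s r₀ K B C₁ C₂ cs c₀ g →
      ∀ (N : ℕ), 1 ≤ N →
      ∀ x : Fin N → EuclideanSpace ℝ (Fin d), Function.Injective x →
      ∀ μ : Measure (EuclideanSpace ℝ (Fin d)), IsProbabilityMeasure μ →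
        μ ≪ volume → densitySup μ ≠ ⊤ →
        (s = 0 → Integrable (fun y => Real.log (1 + ‖y‖)) μ) →
        ModulatedEnergyConverges g x μ ∧
        (∀ η : Fin N → ℝ, (∀ i, 0 < η i ∧ η i < r₀ / 2) →
          homogeneousSobolevSq ((s - d) / 2) (smearedEmpiricalMeasure x η) μ ≠ ⊤ ∧
          1 / (N : ℝ) ^ 2 * nearPairSum g r₀ x η
            + C⁻¹ * (homogeneousSobolevSq ((s - d) / 2) (smearedEmpiricalMeasure x η) μ).toReal
          ≤ modulatedEnergy g x μ
            + 1 / (N : ℝ) ^ 2 * ∑ i, smearedPotential g (η i) 0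
            + C / N * ∑ i, η i ^ 2
            + C / N * ∑ i, (densitySup μ).toReal * smearingError d s (η i)) ∧
        -C * (1 + (densitySup μ).toReal) *
            ((N : ℝ) ^ (-2 / (2 + s))
              + (N : ℝ)⁻¹ * logIf (s = 0) N
              + (N : ℝ) ^ (-2 / (d : ℝ)) * logIf (s = (d : ℝ) - 2) N)
          ≤ modulatedEnergy g x μ := by
  have hsd' : s < d := by linarith
  set M := d * (|K 2| / r₀ ^ (s + 2)) with hM
  have hM0 : 0 ≤ M := by positivity
  obtain ⟨D, hD0, hD⟩ := exists_integral_sub_smeared_le (M := M) hd hs hsd hr₀ (abs_nonneg (K 0))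
    (abs_nonneg (K 2))
  have hπ := Real.pi_pos
  set κ := (2 * Real.pi) ^ s / C₁ with hκ
  have hκ0 : 0 < κ := by positivity
  set C := κ + M / d + 2 * D with hC
  have hMd : 0 ≤ M / d := by positivity
  have hC0 : 0 < C := by positivity
  set r := min 1 (r₀ / 4) with hr
  have hr0 : 0 < r := by positivity
  set E := |K 0| * (r ^ (-s) + 2 * |Real.log r| + 1) with hE
  have hE0 : 0 ≤ E := by positivity
  set C' := E + C * (2 * |Real.log r| + 3) with hC'
  have hCC' : C ≤ C' := by
    have := mul_nonneg hC0.le (abs_nonneg (Real.log r))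
    rw [hC']; linarith
  refine ⟨C', hC0.trans_le hCC', fun g hg N hN x hx μ _ hμ hμd hμlog => ?_⟩
  have ht := hg.tame hs hr₀
  obtain ⟨G, hG, hF, hGb⟩ := hg.fourier_bound
  have hN0 : (0 : ℝ) < N := by exact_mod_cast hN
  have hμl : Integrable (logGrowth s) μ := by
    unfold logGrowth
    by_cases h : s = 0
    · simpa [h] using hμlog h
    · simp [h]
  have key : ∀ η : Fin N → ℝ, (∀ i, 0 < η i ∧ η i < r₀ / 2) →
      homogeneousSobolevSq ((s - d) / 2) (smearedEmpiricalMeasure x η) μ ≠ ⊤ ∧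
      1 / (N : ℝ) ^ 2 * nearPairSum g r₀ x η
        + C⁻¹ * (homogeneousSobolevSq ((s - d) / 2) (smearedEmpiricalMeasure x η) μ).toReal
      ≤ modulatedEnergy g x μ
        + 1 / (N : ℝ) ^ 2 * ∑ i, smearedPotential g (η i) 0
        + C / N * ∑ i, η i ^ 2
        + C / N * ∑ i, (densitySup μ).toReal * smearingError d s (η i) := fun η hη => by
    have h1 := ht.homogeneousSobolevSq_smeared_le hd hs hsd' hG hF hC₁ hGb hN (fun i => (hη i).1)
      hμ hμd hμl (x := x)
    have h2 := ht.nearPairSum_add_differenceEnergy_le hd hs hsd' hN (fun i => (hη i).1) hx hμ hμd hμl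
      (fun i => hD g ht μ inferInstance hμ hμd (x i) (η i) (hη i).1 (hη i).2) r₀
    refine ⟨h1.1, ?_⟩
    have h3 : C⁻¹ * (homogeneousSobolevSq ((s - d) / 2) (smearedEmpiricalMeasure x η) μ).toReal
        ≤ differenceEnergy g (smearedEmpiricalMeasure x η) μ := by
      have h4 : 0 ≤ differenceEnergy g (smearedEmpiricalMeasure x η) μ :=
        nonneg_of_mul_nonneg_right (ENNReal.toReal_nonneg.trans h1.2) hκ0
      rw [inv_mul_le_iff₀ hC0]
      exact h1.2.trans (mul_le_mul_of_nonneg_right (by rw [hC]; linarith) h4)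
    have hS : 0 ≤ ∑ i, η i ^ 2 := Finset.sum_nonneg fun i _ => by positivity
    have hT : 0 ≤ ∑ i, (densitySup μ).toReal * smearingError d s (η i) :=
      Finset.sum_nonneg fun i _ =>
        mul_nonneg ENNReal.toReal_nonneg (smearingError_nonneg (hη i).1)
    rw [Finset.sum_add_distrib, ← Finset.mul_sum, ← Finset.mul_sum] at h2
    set S := ∑ i, η i ^ 2
    set T := ∑ i, (densitySup μ).toReal * smearingError d s (η i)
    have e1 : M / d / N * S + 2 / N * (D * S + D * T) = (M / d + 2 * D) / N * S + 2 * D / N * T := by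
      ring
    have h5 : (M / d + 2 * D) / N * S ≤ C / N * S := by
      refine mul_le_mul_of_nonneg_right ?_ hS
      gcongr
      rw [hC]; linarith
    have h6 : 2 * D / N * T ≤ C / N * T := by
      refine mul_le_mul_of_nonneg_right ?_ hT
      gcongr
      rw [hC]; linarith
    linarith
  refine ⟨ht.modulatedEnergyConverges hd hs hsd' hN x hμ hμd hμl, fun η hη => ?_, ?_⟩
  · refine ⟨(key η hη).1, le_trans ?_ ((key η hη).2.trans ?_)⟩
    · gcongr
    · have hS : 0 ≤ ∑ i, η i ^ 2 := Finset.sum_nonneg fun i _ => by positivity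
      have hT : 0 ≤ ∑ i, (densitySup μ).toReal * smearingError d s (η i) :=
        Finset.sum_nonneg fun i _ =>
          mul_nonneg ENNReal.toReal_nonneg (smearingError_nonneg (hη i).1)
      gcongr
  · set η := optimalRadius s r N
    have hη0 : 0 < η := optimalRadius_pos hN hr0
    have hηr : η < r₀ / 2 := ((optimalRadius_le hs hN hr0).trans (min_le_right _ _)).trans_lt
      (by linarith)
    have h1 := (key (fun _ => η) fun _ => ⟨hη0, hηr⟩).2
    have h2 : 0 ≤ 1 / (N : ℝ) ^ 2 * nearPairSum g r₀ x fun _ => η :=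
      mul_nonneg (by positivity) (nearPairSum_nonneg _ _ _)
    have h3 : 0 ≤ C⁻¹ * (homogeneousSobolevSq ((s - d) / 2)
        (smearedEmpiricalMeasure x fun _ => η) μ).toReal :=
      mul_nonneg (inv_nonneg.2 hC0.le) ENNReal.toReal_nonneg
    simp only [Finset.sum_const, Finset.card_univ, Fintype.card_fin, nsmul_eq_mul] at h1
    set m := (densitySup μ).toReal
    have hm : 0 ≤ m := ENNReal.toReal_nonneg
    have e1 : 1 / (N : ℝ) ^ 2 * (N * smearedPotential g η 0) = (N : ℝ)⁻¹ * smearedPotential g η 0 := by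
      field_simp
    have e2 : C / (N : ℝ) * (N * η ^ 2) = C * η ^ 2 := by field_simp
    have e3 : C / (N : ℝ) * (N * (m * smearingError d s η)) = C * (m * smearingError d s η) := by
      field_simp
    rw [e1, e2, e3] at h1
    have h4 := ht.inv_mul_smearedPotential_optimalRadius_le hd hs hN hr0
    have h5 := mul_le_mul_of_nonneg_left
      ((optimalRadius_sq_le (s := s) hN hr0 (min_le_left _ _)).trans (rpow_le_energyRate (d := d))) hC0.le
    have h6 := mul_le_mul_of_nonneg_left (mul_le_mul_of_nonneg_left
      (smearingError_optimalRadius_le hd hs hsd hN hr0 (min_le_left _ _)) hm) hC0.le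
    change -C' * (1 + m) * energyRate d N s ≤ _
    have hR : 0 ≤ energyRate d N s := le_trans (by positivity) (rpow_le_energyRate (d := d))
    have h7 := mul_nonneg hE0 (mul_nonneg hm hR)
    have h8 := mul_nonneg (mul_nonneg hC0.le (abs_nonneg (Real.log r))) hR
    have h9 := mul_nonneg hC0.le hR
    have e4 : -C' * (1 + m) * energyRate d N s = -(E * energyRate d N s + E * (m * energyRate d N s)
        + 2 * (C * |Real.log r| * energyRate d N s) + 3 * (C * energyRate d N s)
        + C * (m * ((2 * |Real.log r| + 3) * energyRate d N s))) := by
      rw [hC']; ring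
    rw [e4]
    linarith
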